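/- Let $c>0$, $\Delta>0$ with $c\Delta<4$, let $M\ge 2$ be even, and let $\chi_n,\chi_n^{*}$ ($n=1,\dots,M$) be the Bose operators with $[\chi_n,\chi_m^{*}]=\Delta\,\delta_{nm}$, acting on the finite-particle space (the linear span of the occupation-number states, which are taken orthonormal) with pseudo-vacuum $|0\rangle$, $\chi_n|0\rangle=0$. Put $Z_n=1+(-1)^n\frac{c\Delta}{4}$, $\rho_{Z_n}=\sqrt{Z_n+\frac c4\chi_n^*\chi_n}$, $$L_n(\lambda)=\begin{pmatrix}-\frac{i\lambda\Delta}{2}+Z_n+\frac c2\chi_n^*\chi_n & -i\sqrt c\,\chi_n^*\rho_{Z_n}\\ i\sqrt c\,\rho_{Z_n}\chi_n & \frac{i\lambda\Delta}{2}+Z_n+\frac c2\chi_n^*\chi_n\end{pmatrix},\qquad L_M(\lambda)\cdots L_1(\lambda)=\begin{pmatrix}A(\lambda)&B(\lambda)\\ C(\lambda)&D(\lambda)\end{pmatrix},$$ $\tau(\lambda)=A(\lambda)+D(\lambda)$, $\nu=-\frac{2i}{\Delta}+\frac{ic}{2}$, $|\psi(\{\lambda_a\}_1^N)\rangle=B(\lambda_1)\cdots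 B(\lambda_N)|0\rangle$, and $$a(\lambda)=\Big(-\tfrac{i\lambda\Delta}{2}+1+\tfrac{c\Delta}{4}\Big)^{\frac M2}\Big(-\tfrac{i\lambda\Delta}{2}+1-\tfrac{c\Delta}{4}\Big)^{\frac M2},\qquad d(\lambda)=\Big(\tfrac{i\lambda\Delta}{2}+1+\tfrac{c\Delta}{4}\Big)^{\frac M2}\Big(\tfrac{i\lambda\Delta}{2}+1-\tfrac{c\Delta}{4}\Big)^{\frac M2}.$$ Pairwise distinct real numbers $x_1,\dots,x_n$ are said to solve the Bethe equations if $$\frac{d(x_r)}{a(x_r)}=\prod_{p\ne r}\frac{x_r-x_p+ic}{x_r-x_p-ic},\qquad r=1,\dots,n$$ (for instance, solutions of the logarithmic Bethe equations $-i\ln\frac{d(x_r)}{a(x_r)}+\sum_{p}\theta(x_r-x_p)=2\pi(\ell_r-\frac{n+1}2)$ with integers $\ell_1<\dots<\ell_n$ and $\theta(\lambda)=i\ln\frac{ic+\lambda}{ic-\lambda}$). Let $N\ge 0$, and let $\{\mu_{\ell_a}\}_{1}^{N+1}$ and $\{\lambda_{r_a}\}_1^N$ be two such solutions, with $N+1$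 and $N$ elements. Put $$e^{-2i\pi\widehat F(\omega)}=\prod_{a=1}^{N+1}\frac{\mu_{\ell_a}-\omega+ic}{\mu_{\ell_a}-\omega-ic}\prod_{a=1}^{N}\frac{\lambda_{r_a}-\omega-ic}{\lambda_{r_a}-\omega+ic}$$ and assume that $e^{-2i\pi\widehat F(\lambda_{r_k})}\neq 1$ for $k=1,\dots,N$ (by the Bethe equations this implies $\mu_{\ell_a}\ne\lambda_{r_k}$ for all $a,k$). Then $\tau(\nu)$ is invertible, and $$F^{(\Delta)}_{\Phi^\dagger}\big(\{\mu_{\ell_a}\}_1^{N+1};\{\lambda_{r_a}\}_1^{N}\big)=\frac{2i}{\Delta\sqrt c}\,\big\langle\psi(\{\mu_{\ell_a}\}_1^{N+1})\big|\,\tau^{-1}(\nu)B(\nu)\,\big|\psi(\{\lambda_{r_a}\}_1^{N})\big\rangle$$ has the determinant representation $$F^{(\Delta)}_{\Phi^\dagger}=\frac{-2\sqrt c}{\Delta}\prod_{a=1}^{N+1}\frac{\nu-\mu_{\ell_a}}{\nu-\mu_{\ell_a}-ic}\cdot\frac{\prod_{a=1}^{N}(\lambda_{r_a}-\nu+ic)}{\prod_{a=1}^{N+1}(\mu_{\ell_a}-\nu)}\prod_{a=1}^{N+1}\prod_{b=1}^{N}\frac{1}{\mu_{\ell_a}-\lambda_{r_b}}\prod_{a=1}^{N+1}d(\mu_{\ell_a})$$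 $$\times\prod_{k=1}^{N}\Big\{a(\lambda_{r_k})\big[1-e^{-2i\pi\widehat F(\lambda_{r_k})}\big]\prod_{b=1}^{N+1}(\mu_{\ell_b}-\lambda_{r_k}-ic)\Big\}\cdot\det_N\big[\delta_{jk}+U^{(\Delta)}_{jk}\big],$$ where $$U^{(\Delta)}_{jk}=-i\prod_{a=1}^{N+1}\frac{\lambda_{r_j}-\mu_{\ell_a}}{\lambda_{r_j}-\mu_{\ell_a}+ic}\cdot\frac{\prod_{a=1}^{N}(\lambda_{r_j}-\lambda_{r_a}+ic)}{\prod_{a\ne j}(\lambda_{r_j}-\lambda_{r_a})}\cdot\frac{K(\lambda_{r_j},\lambda_{r_k}\mid\nu)}{e^{-2i\pi\widehat F(\lambda_{r_j})}-1},$$ $$K(\omega,\omega'\mid\nu)=\frac{\nu-\omega-ic}{\nu-\omega}\Big\{K(\omega-\omega')-i\Big(1-\frac{\nu-\omega'+ic}{\nu-\omega'-ic}\Big)\Big(\frac1{\omega-\omega'+ic}-\frac1{\omega-\nu+ic}\Big)\Big\},$$ and $K(\lambda)=\theta'(\lambda)$ with $\theta(\lambda)=i\ln\frac{ic+\lambda}{ic-\lambda}$,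 that is $K(\lambda)=\frac{2c}{\lambda^2+c^2}$ for real $\lambda$. -/

import Mathlib

open scoped BigOperators ComplexConjugate

noncomputable section

namespace LatticeNLS

/-! ### The lattice bosons -/

/-- The dense subspace of `⨂ₙ L²(ℝ)` (with `M` sites) spanned by the orthonormal
occupation-number states: `Finsupp.single k 1` is the normalized state with `k j` quanta at the
site `j`. The site numbered `n = 1, …, M` is `j = n - 1 : Fin M`. -/
abbrev Fock (M : ℕ) : Type := (Fin M → ℕ) →₀ ℂ

/-- The scalar product, antilinear in the first argument, for which the occupation-number states
are orthonormal. -/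
def braket {M : ℕ} (u v : Fock M) : ℂ := u.sum fun k z => conj z * v k

/-- The pseudo-vacuum, killed by every annihilation operator. -/
def vacuum (M : ℕ) : Fock M := Finsupp.single 0 1

/-- The annihilation operator `χ_j`, normalized by `[χ_j, χ_k^*] = Δ δ_{jk}`. -/
def chi {M : ℕ} (Δ : ℝ) (j : Fin M) : Module.End ℂ (Fock M) :=
  Finsupp.linearCombination ℂ fun k =>
    Finsupp.single (Function.update k j (k j - 1)) ((Real.sqrt (Δ * k j) : ℝ) : ℂ)

/-- The creation operator `χ_j^*`, the adjoint of `χ_j`. -/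
def chiStar {M : ℕ} (Δ : ℝ) (j : Fin M) : Module.End ℂ (Fock M) :=
  Finsupp.linearCombination ℂ fun k =>
    Finsupp.single (Function.update k j (k j + 1)) ((Real.sqrt (Δ * (k j + 1)) : ℝ) : ℂ)

/-- `Z_n = 1 + (-1)^n c Δ / 4` at the site `n = j + 1`. -/
def siteZ {M : ℕ} (c Δ : ℝ) (j : Fin M) : ℝ := 1 + (-1) ^ ((j : ℕ) + 1) * (c * Δ / 4)

/-- The operator `ρ_{Z_j} = √(Z_j + c χ_j^* χ_j / 4)`; on occupation-number states
`χ_j^* χ_j` acts as multiplication by `Δ k_j`. -/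
def rho {M : ℕ} (c Δ : ℝ) (j : Fin M) : Module.End ℂ (Fock M) :=
  Finsupp.linearCombination ℂ fun k =>
    Finsupp.single k ((Real.sqrt (siteZ c Δ j + c * (Δ * k j) / 4) : ℝ) : ℂ)

/-! ### The monodromy matrix -/

/-- The Izergin-Korepin Lax matrix at the site `j`. -/
def lax {M : ℕ} (c Δ : ℝ) (j : Fin M) (x : ℂ) : Matrix (Fin 2) (Fin 2) (Module.End ℂ (Fock M)) :=
  !![(-(Complex.I * x * Δ / 2) + siteZ c Δ j) • (1 : Module.End ℂ (Fock M))
        + ((c : ℂ) / 2) • (chiStar Δ j * chi Δ j),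
      (-(Complex.I * (Real.sqrt c : ℝ))) • (chiStar Δ j * rho c Δ j);
     (Complex.I * (Real.sqrt c : ℝ)) • (rho c Δ j * chi Δ j),
      (Complex.I * x * Δ / 2 + siteZ c Δ j) • (1 : Module.End ℂ (Fock M))
        + ((c : ℂ) / 2) • (chiStar Δ j * chi Δ j)]

/-- The monodromy matrix `T(x) = L_M(x) ⋯ L_1(x)`. -/
def monodromy (c Δ : ℝ) (M : ℕ) (x : ℂ) : Matrix (Fin 2) (Fin 2) (Module.End ℂ (Fock M)) :=
  (List.ofFn fun j : Fin M => lax c Δ j.rev x).prod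

/-- The entry `B(x)` of the monodromy matrix. -/
def opB (c Δ : ℝ) (M : ℕ) (x : ℂ) : Module.End ℂ (Fock M) := monodromy c Δ M x 0 1

/-- The transfer matrix `τ(x) = tr T(x) = A(x) + D(x)`. -/
def transfer (c Δ : ℝ) (M : ℕ) (x : ℂ) : Module.End ℂ (Fock M) := (monodromy c Δ M x).trace

/-- The Bethe vector `B(x_1) ⋯ B(x_N) |0⟩`. -/
def betheVector (c Δ : ℝ) (M : ℕ) {N : ℕ} (x : Fin N → ℝ) : Fock M :=
  (List.ofFn fun a => opB c Δ M (x a)).prod (vacuum M)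

/-- The eigenvalue of `A(x)` on the pseudo-vacuum. -/
def vacA (c Δ : ℝ) (M : ℕ) (x : ℂ) : ℂ :=
  (-(Complex.I * x * Δ / 2) + 1 + c * Δ / 4) ^ (M / 2) *
    (-(Complex.I * x * Δ / 2) + 1 - c * Δ / 4) ^ (M / 2)

/-- The eigenvalue of `D(x)` on the pseudo-vacuum. -/
def vacD (c Δ : ℝ) (M : ℕ) (x : ℂ) : ℂ :=
  (Complex.I * x * Δ / 2 + 1 + c * Δ / 4) ^ (M / 2) *
    (Complex.I * x * Δ / 2 + 1 - c * Δ / 4) ^ (M / 2)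

/-- The special point `ν = -2i/Δ + ic/2` of the spectral parameter. -/
def nu (c Δ : ℝ) : ℂ := -(2 * Complex.I / Δ) + Complex.I * c / 2

/-! ### Bethe equations -/

/-- `x_1, …, x_N` are pairwise distinct real solutions of the Bethe Ansatz equations
`d(x_r) / a(x_r) = ∏_{p ≠ r} (x_r - x_p + ic) / (x_r - x_p - ic)`. -/
structure IsBetheSolution (c Δ : ℝ) (M : ℕ) {N : ℕ} (x : Fin N → ℝ) : Prop where
  injective : Function.Injective x
  equation : ∀ r, vacD c Δ M (x r) / vacA c Δ M (x r) =
    ∏ p ∈ Finset.univ.erase r,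
      ((x r : ℂ) - x p + Complex.I * c) / ((x r : ℂ) - x p - Complex.I * c)

/-- The bare phase `θ(x) = i ln((ic + x)/(ic - x))`. -/
def theta (c : ℝ) (x : ℂ) : ℂ :=
  Complex.I * Complex.log ((Complex.I * c + x) / (Complex.I * c - x))

/-- Solutions of the logarithmic Bethe equations
`-i ln(d(x_r)/a(x_r)) + ∑_p θ(x_r - x_p) = 2π (ℓ_r - (N+1)/2)` with integers `ℓ_1 < ⋯ < ℓ_N`,
for any branch `w` of `ln(d/a)`, are Bethe solutions. -/
theorem IsBetheSolution.of_log {c Δ : ℝ} (hc : 0 < c) {M N : ℕ} {x : Fin N → ℝ} (w : ℂ → ℂ)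
    (hw : ∀ r, Complex.exp (w (x r)) = vacD c Δ M (x r) / vacA c Δ M (x r))
    (l : Fin N → ℤ) (hl : StrictMono l)
    (h : ∀ r, -Complex.I * w (x r) + ∑ p, theta c ((x r : ℂ) - x p) =
      2 * Real.pi * ((l r : ℂ) - ((N : ℂ) + 1) / 2)) : IsBetheSolution c Δ M x := by
  have key : ∀ y : ℝ, (Complex.I * c + y ≠ 0) ∧ (Complex.I * c - y ≠ 0) := by
    intro y
    constructor <;> intro e <;> have := congrArg Complex.im e <;> simp at this <;> linarith
  refine ⟨fun r s hrs => ?_, fun r => ?_⟩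
  · have e := (h r).symm.trans ((by rw [hrs]) : _ = _) |>.trans (h s)
    have hpi : (2 * Real.pi : ℂ) ≠ 0 := by simp [Real.pi_ne_zero]
    have e' : (l r : ℂ) = l s := by
      have := mul_left_cancel₀ hpi e
      simpa using this
    exact hl.injective (by exact_mod_cast e')
  · have hq : ∀ p, Complex.exp (-(Complex.I * theta c ((x r : ℂ) - x p))) =
        (Complex.I * c + ((x r : ℂ) - x p)) / (Complex.I * c - ((x r : ℂ) - x p)) := by
      intro p
      have k := key (x r - x p)
      push_cast at k
      rw [theta, ← mul_assoc, Complex.I_mul_I, neg_one_mul, neg_neg,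
        Complex.exp_log (div_ne_zero k.1 k.2)]
    have hN : Complex.exp (Complex.I * (2 * Real.pi * ((l r : ℂ) - ((N : ℂ) + 1) / 2))) =
        (-1) ^ (N + 1) := by
      have : Complex.I * (2 * Real.pi * ((l r : ℂ) - ((N : ℂ) + 1) / 2)) =
          l r * (2 * Real.pi * Complex.I) - ((N + 1 : ℕ) : ℂ) * (Real.pi * Complex.I) := by
        push_cast; ring
      rw [this, Complex.exp_sub, Complex.exp_int_mul_two_pi_mul_I, Complex.exp_nat_mul,
        Complex.exp_pi_mul_I, one_div, ← inv_pow]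
      norm_num
    have hw' : w (x r) = Complex.I * (2 * Real.pi * ((l r : ℂ) - ((N : ℂ) + 1) / 2)) +
        ∑ p, -(Complex.I * theta c ((x r : ℂ) - x p)) := by
      rw [← h r, Finset.sum_neg_distrib, ← Finset.mul_sum]
      linear_combination (w (x r)) * Complex.I_mul_I
    rw [← hw r, hw', Complex.exp_add, hN, Complex.exp_sum]
    simp only [hq]
    rw [← Finset.mul_prod_erase _ _ (Finset.mem_univ r)]
    have h1 : (Complex.I * c + ((x r : ℂ) - x r)) / (Complex.I * c - ((x r : ℂ) - x r)) = 1 := by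
      have k := (key 0).1
      simp only [Complex.ofReal_zero, add_zero] at k
      simp [div_self k]
    have h2 : ∀ p, (Complex.I * c + ((x r : ℂ) - x p)) / (Complex.I * c - ((x r : ℂ) - x p)) =
        (-1) * (((x r : ℂ) - x p + Complex.I * c) / ((x r : ℂ) - x p - Complex.I * c)) := by
      intro p
      rw [← neg_sub ((x r : ℂ) - x p) (Complex.I * c), div_neg, add_comm]
      ring
    have hcard : N + 1 + (N - 1) = 2 * N := by have := r.pos; omega
    rw [h1, one_mul, Finset.prod_congr rfl fun p _ => h2 p, Finset.prod_mul_distrib,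
      Finset.prod_const, Finset.card_erase_of_mem (Finset.mem_univ r), Finset.card_univ,
      Fintype.card_fin, ← mul_assoc, ← pow_add, hcard, pow_mul]
    norm_num

/-- The Lieb kernel `K = θ'` (it is only evaluated at real arguments). -/
def lieb (c : ℝ) (x : ℂ) : ℂ := deriv (theta c) x

/-! ### The form factor and the ingredients of its determinant representation -/

/-- `F^{(Δ)}_{Φ†} = 2i/(Δ√c) ⟨ψ(μ)| τ(ν)⁻¹ B(ν) |ψ(λ)⟩`. -/
def formFactor (c Δ : ℝ) (M : ℕ) {N : ℕ} (mu : Fin (N + 1) → ℝ) (lam : Fin N → ℝ) : ℂ :=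
  2 * Complex.I / (Δ * (Real.sqrt c : ℝ)) *
    braket (betheVector c Δ M mu)
      ((Ring.inverse (transfer c Δ M (nu c Δ)) * opB c Δ M (nu c Δ)) (betheVector c Δ M lam))

/-- `exp(-2iπ F(w))` for the discrete shift function `F`. -/
def expShift (c : ℝ) {N : ℕ} (mu : Fin (N + 1) → ℝ) (lam : Fin N → ℝ) (w : ℂ) : ℂ :=
  (∏ a, ((mu a : ℂ) - w + Complex.I * c) / ((mu a : ℂ) - w - Complex.I * c)) *
    ∏ a, ((lam a : ℂ) - w - Complex.I * c) / ((lam a : ℂ) - w + Complex.I * c)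

/-- The modified kernel `K(w, w' ∣ v)`. -/
def liebMod (c : ℝ) (w w' v : ℂ) : ℂ :=
  (v - w - Complex.I * c) / (v - w) *
    (lieb c (w - w') - Complex.I * (1 - (v - w' + Complex.I * c) / (v - w' - Complex.I * c)) *
      (1 / (w - w' + Complex.I * c) - 1 / (w - v + Complex.I * c)))

/-- The matrix `U^{(Δ)}`. -/
def matU (c Δ : ℝ) {N : ℕ} (mu : Fin (N + 1) → ℝ) (lam : Fin N → ℝ) :
    Matrix (Fin N) (Fin N) ℂ :=
  Matrix.of fun j k =>
    -Complex.I *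
      (∏ a, ((lam j : ℂ) - mu a) / ((lam j : ℂ) - mu a + Complex.I * c)) *
      ((∏ a, ((lam j : ℂ) - lam a + Complex.I * c)) /
        ∏ a ∈ Finset.univ.erase j, ((lam j : ℂ) - lam a)) *
      (liebMod c (lam j) (lam k) (nu c Δ) / (expShift c mu lam (lam j) - 1))

end LatticeNLS

end

open scoped BigOperators ComplexConjugate

noncomputable section

namespace LatticeNLS

/-! ### The Yang-Baxter algebra -/

/-! The form factor is a scalar product of Bethe vectors in disguise, and that scalar product is
obtained by linear algebra. Throughout, η = ic.

Since μ solves the Bethe equations, ⟨ψ(μ)| is a left eigenvector of τ(ν) with eigenvalue Λ(ν) ≠ 0.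
Once τ(ν) is known to be a unit, its inverse acts to the left, and what remains is the scalar
product of ψ(μ) with the Bethe vector of rapidities ν, λ_1, …, λ_N. Invertibility
(`isUnit_transfer`) holds because at ν every Lax matrix has rank one, with opposite operator
orderings on even and odd sites: the trace telescopes into a product over the links of the ring,
each link operator being triangular with respect to an occupation number.

The scalar product is found in `slavnov`. Placing τ(z) between the eigenvector and a Bethe vector
gives linear relations among the scalar products that omit one of n + 1 rapidities. Lagrange
interpolation turns them into exchange relations for the Vandermonde determinant times the scalar
product (`OnShell.exchange`); Cramer's rule gives the same relations for the determinant of the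
functionals `baxter`, p ↦ Λ(w)p(w) - a(w)p(w+η) - d(w)p(w-η). A nondegenerate system of this kind
fixes an antisymmetric solution from a single value (`eq_zero_of_exchange`). That value is taken at
the rapidities μ_i + η. Scalar products depend on a and d only through their values at the
rapidities (`scal_eq_scal`), and any such values occur in some representation
(`exists_representation`), so a may be assumed to vanish at μ_i + η, where the scalar product
factorizes (`scal_shift`).

Finally a(ν) = 0. For polynomials vanishing at ν - η and at all but one of the rapidities, corrected
by the Baxter polynomial of μ, which the functionals kill, the column of ν has one nonzero entry and
an N × N determinant is left (`scal_cons`). The Bethe equations for λ rewrite its entries through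
the shift function and the kernel K (`det_baxter`). -/

/-- The bilinear exchange relations of the rational six-vertex model. -/
def RTT {R : Type*} [Ring R] [Algebra ℂ R] (η : ℂ) (T : ℂ → Matrix (Fin 2) (Fin 2) R) : Prop :=
  ∀ x y i j k l, (x - y) • (T x i j * T y k l - T y k l * T x i j) =
    η • (T x k j * T y i l - T y k j * T x i l)

namespace RTT

variable {R : Type*} [Ring R] [Algebra ℂ R] {η : ℂ} {T : ℂ → Matrix (Fin 2) (Fin 2) R}

/-- The relation reads `(x - y - η) [B(x), B(y)] = 0`, and exchanging the arguments gives the factor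
`y - x - η`. Both factors vanish only if `η = 0`, so the points `x - y = ±η` are covered too. -/
theorem commute_B (h : RTT η T) (hη : η ≠ 0) (x y : ℂ) : Commute (T x 0 1) (T y 0 1) := by
  have h1 := h x y 0 1 0 1
  have h2 := h y x 0 1 0 1
  rw [← sub_eq_zero, ← sub_smul] at h1 h2
  rcases smul_eq_zero.1 h1 with e | e
  · rcases smul_eq_zero.1 h2 with e' | e'
    · exact absurd (by linear_combination (-1 / 2 : ℂ) * (e + e')) hη
    · exact (sub_eq_zero.1 e').symm
  · exact sub_eq_zero.1 e

theorem A_mul_B (h : RTT η T) {x y : ℂ} (hxy : x ≠ y) :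
    T x 0 0 * T y 0 1 = ((x - y + η) / (x - y)) • (T y 0 1 * T x 0 0) -
      (η / (x - y)) • (T x 0 1 * T y 0 0) := by
  have hx : x - y ≠ 0 := sub_ne_zero.2 hxy
  have h1 := h y x 0 1 0 0
  apply smul_right_injective R hx
  simp only [smul_sub, smul_smul, mul_div_cancel₀ _ hx]
  rw [← neg_sub x y, neg_smul, smul_sub, smul_sub] at h1
  rw [add_smul, ← sub_eq_zero, ← sub_eq_zero.2 h1]
  abel

/-- Written with `-η` so that it has the shape of `A_mul_B` and both fall under `exchange_bethe`. -/
theorem D_mul_B (h : RTT η T) {x y : ℂ} (hxy : x ≠ y) :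
    T x 1 1 * T y 0 1 = ((x - y + -η) / (x - y)) • (T y 0 1 * T x 1 1) -
      (-η / (x - y)) • (T x 0 1 * T y 1 1) := by
  have hx : x - y ≠ 0 := sub_ne_zero.2 hxy
  have h1 := h x y 1 1 0 1
  apply smul_right_injective R hx
  simp only [smul_sub, smul_smul, mul_div_cancel₀ _ hx]
  rw [smul_sub, smul_sub] at h1
  rw [add_smul, ← sub_eq_zero, ← sub_eq_zero.2 h1, neg_smul, neg_smul]
  abel

theorem C_mul_B (h : RTT η T) {x y : ℂ} (hxy : x ≠ y) :
    T x 1 0 * T y 0 1 = T y 0 1 * T x 1 0 +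
      (η / (x - y)) • (T x 0 0 * T y 1 1 - T y 0 0 * T x 1 1) := by
  have hx : x - y ≠ 0 := sub_ne_zero.2 hxy
  have h1 := h x y 1 0 0 1
  apply smul_right_injective R hx
  simp only [smul_add, smul_smul, mul_div_cancel₀ _ hx]
  rw [← h1]
  simp only [smul_sub]
  abel

end RTT

/-! ### Bethe vectors -/

section Bethe

variable {V : Type*} [AddCommGroup V] [Module ℂ V]

/-- The vector `B(x_1) ⋯ B(x_n) |0⟩` attached to a finite set of rapidities. -/
def bethe (T : ℂ → Matrix (Fin 2) (Fin 2) (Module.End ℂ V)) (vac : V) (s : Finset ℂ) : V :=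
  (s.toList.map fun x => T x 0 1).prod vac

/-- `vac` is a pseudo-vacuum with eigenvalues `a`, `d`, for spectral parameters in `X`. -/
structure IsVacuum (T : ℂ → Matrix (Fin 2) (Fin 2) (Module.End ℂ V)) (a d : ℂ → ℂ) (X : Set ℂ)
    (vac : V) : Prop where
  A_apply : ∀ x ∈ X, T x 0 0 vac = a x • vac
  D_apply : ∀ x ∈ X, T x 1 1 vac = d x • vac
  C_apply : ∀ x ∈ X, T x 1 0 vac = 0

variable {η : ℂ} {T : ℂ → Matrix (Fin 2) (Fin 2) (Module.End ℂ V)} {vac : V}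
  {a d : ℂ → ℂ} {X : Set ℂ}

@[simp] theorem bethe_empty : bethe T vac ∅ = vac := by simp [bethe]

/-- The operators `B` commute, so the arbitrary order of `Finset.toList` is immaterial. -/
theorem bethe_insert (h : RTT η T) (hη : η ≠ 0) {x : ℂ} {s : Finset ℂ} (hx : x ∉ s) :
    bethe T vac (insert x s) = T x 0 1 (bethe T vac s) := by
  have hp := (Finset.toList_insert hx).map fun x => T x 0 1
  have := hp.prod_eq' (List.pairwise_map.2 (List.pairwise_of_forall fun _ _ => h.commute_B hη _ _))
  rw [bethe, this]
  simp [bethe]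

/-- The action on Bethe vectors of a family of operators exchanged with `B` as the diagonal entries
of the monodromy matrix are. -/
theorem exchange_bethe (h : RTT η T) (hη : η ≠ 0) (K : ℂ → Module.End ℂ V) (ε : ℂ) (e : ℂ → ℂ)
    (hK : ∀ x y, x ≠ y → K x * T y 0 1 = ((x - y + ε) / (x - y)) • (T y 0 1 * K x) -
      (ε / (x - y)) • (T x 0 1 * K y)) (s : Finset ℂ) :
    ∀ z ∉ s, (∀ x ∈ insert z s, K x vac = e x • vac) →
      K z (bethe T vac s) = (e z * ∏ i ∈ s, ((z - i + ε) / (z - i))) • bethe T vac s +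
        ∑ k ∈ s, (e k * (ε / (k - z)) * ∏ i ∈ s.erase k, ((k - i + ε) / (k - i))) •
          bethe T vac (insert z (s.erase k)) := by
  induction s using Finset.induction_on with
  | empty => intro z _ hz; simpa using hz z (by simp)
  | insert y s hy ih =>
    intro z hz he
    have hzy : z ≠ y := fun e => hz (by simp [e])
    have hzs : z ∉ s := fun e => hz (by simp [e])
    have hzy' : z - y ≠ 0 := sub_ne_zero.2 hzy
    have hyz' : y - z ≠ 0 := sub_ne_zero.2 hzy.symm
    have key := congrArg (fun f : Module.End ℂ V => f (bethe T vac s)) (hK z y hzy)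
    simp only [Module.End.mul_apply, LinearMap.sub_apply, LinearMap.smul_apply] at key
    rw [bethe_insert h hη hy, key, ih z hzs fun x hx => he x (by
        simp only [Finset.mem_insert] at hx ⊢; tauto), ih y hy fun x hx => he x (by
        simp only [Finset.mem_insert] at hx ⊢; tauto)]
    rw [Finset.sum_insert hy, Finset.prod_insert hy, Finset.erase_insert hy]
    simp only [map_add, map_sum, map_smul, smul_add, Finset.smul_sum, smul_smul]
    rw [← bethe_insert h hη hy, ← bethe_insert h hη hzs]
    have h1 : ∀ k ∈ s, T y 0 1 (bethe T vac (insert z (s.erase k))) =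
        bethe T vac (insert z ((insert y s).erase k)) := by
      intro k hk
      have hky : k ≠ y := fun e => hy (e ▸ hk)
      rw [← bethe_insert h hη (by simp [hzy.symm, hy]), Finset.erase_insert_of_ne hky.symm,
        Finset.insert_comm]
    have h2 : ∀ k ∈ s, T z 0 1 (bethe T vac (insert y (s.erase k))) =
        bethe T vac (insert z ((insert y s).erase k)) := by
      intro k hk
      have hky : k ≠ y := fun e => hy (e ▸ hk)
      rw [← bethe_insert h hη (by simp [hzy, hzs]), Finset.erase_insert_of_ne hky.symm]
    rw [Finset.sum_congr rfl fun k hk => by rw [h1 k hk],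
      Finset.sum_congr (s₂ := s) (f := fun k => _ • T z 0 1 _) rfl fun k hk => by rw [h2 k hk]]
    -- The vector with `k` replaced by `z` arises twice: from `K z` after it has passed `B(y)`, and
    -- from `K y` in the exchange term. A partial fraction identity in `z, y, k` merges both into
    -- the single factor `(k - y + ε) / (k - y)`.
    have h3 : ∀ k ∈ s, (e k * (ε / (k - z)) * ∏ i ∈ (insert y s).erase k, ((k - i + ε) / (k - i))) •
        bethe T vac (insert z ((insert y s).erase k)) =
        ((z - y + ε) / (z - y) * (e k * (ε / (k - z)) * ∏ i ∈ s.erase k, ((k - i + ε) / (k - i)))) •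
          bethe T vac (insert z ((insert y s).erase k)) -
        (ε / (z - y) * (e k * (ε / (k - y)) * ∏ i ∈ s.erase k, ((k - i + ε) / (k - i)))) •
          bethe T vac (insert z ((insert y s).erase k)) := by
      intro k hk
      have hky : k ≠ y := fun e => hy (e ▸ hk)
      have hkz : k ≠ z := fun e => hzs (e ▸ hk)
      rw [← sub_smul, Finset.erase_insert_of_ne hky.symm,
        Finset.prod_insert (fun e => hy (Finset.mem_of_mem_erase e))]
      congr 1
      have := sub_ne_zero.2 hky
      have := sub_ne_zero.2 hkz
      field_simp
      ring
    rw [Finset.sum_congr (s₂ := s) rfl h3, Finset.sum_sub_distrib]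
    have h4 : e y * (ε / (y - z)) * ∏ i ∈ s, ((y - i + ε) / (y - i)) =
        -(ε / (z - y) * (e y * ∏ i ∈ s, ((y - i + ε) / (y - i)))) := by
      rw [← neg_sub z y, div_neg]; ring
    rw [h4, neg_smul, mul_left_comm (e z)]
    abel

theorem A_bethe (h : RTT η T) (hη : η ≠ 0) (hv : IsVacuum T a d X vac) {s : Finset ℂ} {z : ℂ}
    (hz : z ∉ s) (hX : ∀ x ∈ insert z s, x ∈ X) :
    T z 0 0 (bethe T vac s) = (a z * ∏ i ∈ s, ((z - i + η) / (z - i))) • bethe T vac s +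
        ∑ k ∈ s, (a k * (η / (k - z)) * ∏ i ∈ s.erase k, ((k - i + η) / (k - i))) •
          bethe T vac (insert z (s.erase k)) :=
  exchange_bethe h hη (fun x => T x 0 0) η a (fun _ _ => h.A_mul_B) s z hz
    fun x hx => hv.A_apply x (hX x hx)

theorem D_bethe (h : RTT η T) (hη : η ≠ 0) (hv : IsVacuum T a d X vac) {s : Finset ℂ} {z : ℂ}
    (hz : z ∉ s) (hX : ∀ x ∈ insert z s, x ∈ X) :
    T z 1 1 (bethe T vac s) = (d z * ∏ i ∈ s, ((z - i + -η) / (z - i))) • bethe T vac s +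
        ∑ k ∈ s, (d k * (-η / (k - z)) * ∏ i ∈ s.erase k, ((k - i + -η) / (k - i))) •
          bethe T vac (insert z (s.erase k)) :=
  exchange_bethe h hη (fun x => T x 1 1) (-η) d (fun _ _ => h.D_mul_B) s z hz
    fun x hx => hv.D_apply x (hX x hx)

/-- The coefficient, symmetric in the rapidities and the spectral parameter, in the action of the
diagonal entries of the monodromy matrix. -/
theorem exchange_coeff {W : Finset ℂ} {z k : ℂ} (hz : z ∈ W) (hk : k ∈ W) (hzk : k ≠ z) (ε : ℂ) :
    ε / (k - z) * ∏ i ∈ (W.erase z).erase k, ((k - i + ε) / (k - i)) =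
      (∏ i ∈ W.erase k, (k - i)⁻¹) * ∏ i ∈ W.erase z, (k + ε - i) := by
  rw [← Finset.mul_prod_erase (W.erase k) _ (Finset.mem_erase.2 ⟨hzk.symm, hz⟩),
    ← Finset.mul_prod_erase (W.erase z) _ (Finset.mem_erase.2 ⟨hzk, hk⟩),
    Finset.erase_right_comm (s := W) (a := k)]
  simp only [div_eq_mul_inv, Finset.prod_mul_distrib, add_sub_right_comm, sub_self, zero_add]
  generalize (∏ x ∈ (W.erase z).erase k, (k - x)⁻¹) = p
  generalize (∏ x ∈ (W.erase z).erase k, (k - x + ε)) = q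
  ring

/-- The action of the transfer matrix on an arbitrary Bethe vector. -/
theorem transfer_bethe (h : RTT η T) (hη : η ≠ 0) (hv : IsVacuum T a d X vac) {W : Finset ℂ}
    {z : ℂ} (hz : z ∈ W) (hX : ∀ x ∈ W, x ∈ X) :
    (T z).trace (bethe T vac (W.erase z)) = ∑ k ∈ W, ((∏ i ∈ W.erase k, (k - i)⁻¹) *
      (a k * ∏ i ∈ W.erase z, (k + η - i) + d k * ∏ i ∈ W.erase z, (k - η - i))) •
        bethe T vac (W.erase k) := by
  have hX' : ∀ x ∈ insert z (W.erase z), x ∈ X := by rwa [Finset.insert_erase hz]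
  rw [Matrix.trace_fin_two, LinearMap.add_apply, A_bethe h hη hv (Finset.notMem_erase z W) hX',
    D_bethe h hη hv (Finset.notMem_erase z W) hX', ← Finset.add_sum_erase W _ hz,
    add_add_add_comm, ← Finset.sum_add_distrib, ← add_smul]
  congr 1
  · congr 1
    simp only [div_eq_mul_inv, Finset.prod_mul_distrib, sub_add_eq_add_sub, ← sub_eq_add_neg]
    ring_nf
  · refine Finset.sum_congr rfl fun k hk => ?_
    obtain ⟨hkz, hk⟩ := Finset.mem_erase.1 hk
    have e : insert z ((W.erase z).erase k) = W.erase k := by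
      rw [Finset.erase_right_comm, Finset.insert_erase (Finset.mem_erase.2 ⟨hkz.symm, hz⟩)]
    rw [e, ← add_smul, mul_assoc, mul_assoc, exchange_coeff hz hk hkz, exchange_coeff hz hk hkz]
    simp only [← sub_eq_add_neg]
    congr 1
    ring

/-- The Bethe equations, in polynomial form. -/
def OnShell (η : ℂ) (a d : ℂ → ℂ) (m : Finset ℂ) : Prop :=
  ∀ k ∈ m, a k * ∏ i ∈ m, (k + η - i) + d k * ∏ i ∈ m, (k - η - i) = 0

/-- The eigenvalue of the transfer matrix. -/
def eigenval (η : ℂ) (a d : ℂ → ℂ) (m : Finset ℂ) (z : ℂ) : ℂ :=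
  (a z * ∏ i ∈ m, (z + η - i) + d z * ∏ i ∈ m, (z - η - i)) / ∏ i ∈ m, (z - i)

/-- In the expansion over `insert z m`, the coefficient of the vector lacking `k ∈ m` contains the
polynomial Bethe equation at `k`; only the vector lacking `z` survives. -/
theorem OnShell.transfer_bethe (h : RTT η T) (hη : η ≠ 0) (hv : IsVacuum T a d X vac)
    {m : Finset ℂ} (hm : OnShell η a d m) {z : ℂ} (hz : z ∉ m) (hX : ∀ x ∈ insert z m, x ∈ X) :
    (T z).trace (bethe T vac m) = eigenval η a d m z • bethe T vac m := by
  have := LatticeNLS.transfer_bethe h hη hv (Finset.mem_insert_self z m) hX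
  rw [Finset.erase_insert hz, Finset.sum_insert hz, Finset.sum_eq_zero (s := m), add_zero,
    Finset.erase_insert hz] at this
  · rw [this, eigenval, Finset.prod_inv_distrib, div_eq_inv_mul]
  · intro k hk
    rw [hm k hk, mul_zero, zero_smul]

end Bethe

/-! ### Dual vectors and scalar products -/

section Dual

variable {V : Type*} [AddCommGroup V] [Module ℂ V]

/-- The transposed monodromy matrix, acting on the dual space. -/
def dualT (T : ℂ → Matrix (Fin 2) (Fin 2) (Module.End ℂ V)) :
    ℂ → Matrix (Fin 2) (Fin 2) (Module.End ℂ (Module.Dual ℂ V)) :=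
  fun x => Matrix.of fun i j => Module.Dual.transpose (R := ℂ) (T x j i)

variable {η : ℂ} {T : ℂ → Matrix (Fin 2) (Fin 2) (Module.End ℂ V)} {vac : V}
  {phi : Module.Dual ℂ V} {a d : ℂ → ℂ} {X : Set ℂ}

@[simp] theorem dualT_apply (x : ℂ) (i j : Fin 2) (f : Module.Dual ℂ V) (v : V) :
    dualT T x i j f v = f (T x j i v) := rfl

/-- Transposition reverses products and swaps the indices inside each entry, which changes the sign
of both sides. Since entry `0 1` of `dualT T` is the transpose of `C`, left vectors built with `C`
are Bethe vectors of the dual, and every result about Bethe vectors applies to them. -/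
theorem RTT.dual (h : RTT η T) : RTT η (dualT T) := by
  intro x y i j k l
  ext f v
  have := congrArg (fun g : Module.End ℂ V => f (g v)) (h x y j i l k)
  simp only [LinearMap.smul_apply, LinearMap.sub_apply, Module.End.mul_apply, map_sub,
    map_smul] at this
  simp only [LinearMap.smul_apply, LinearMap.sub_apply, Module.End.mul_apply, dualT_apply]
  simp only [smul_eq_mul] at this ⊢
  linear_combination -this

/-- The scalar product `⟨0| ∏ C(v) ∏ B(w) |0⟩`. -/
def scal (T : ℂ → Matrix (Fin 2) (Fin 2) (Module.End ℂ V)) (vac : V) (phi : Module.Dual ℂ V)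
    (v w : Finset ℂ) : ℂ :=
  bethe (dualT T) phi v (bethe T vac w)

theorem OnShell.left_eigen (h : RTT η T) (hη : η ≠ 0) (hv : IsVacuum (dualT T) a d X phi)
    {m : Finset ℂ} (hm : OnShell η a d m) {z : ℂ} (hz : z ∉ m) (hX : ∀ x ∈ insert z m, x ∈ X)
    (v : V) : bethe (dualT T) phi m ((T z).trace v) =
      eigenval η a d m z * bethe (dualT T) phi m v := by
  have := congrArg (fun f : Module.Dual ℂ V => f v) (hm.transfer_bethe h.dual hη hv hz hX)
  simpa [Matrix.trace_fin_two] using this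

/-- The linear relations between the scalar products of an eigenvector with the Bethe vectors
obtained by omitting one out of `n + 1` rapidities. -/
theorem OnShell.scal_relation (h : RTT η T) (hη : η ≠ 0) (hv : IsVacuum T a d X vac)
    (hv' : IsVacuum (dualT T) a d X phi) {m : Finset ℂ} (hm : OnShell η a d m) {W : Finset ℂ}
    {z : ℂ} (hz : z ∈ W) (hW : Disjoint W m) (hX : ∀ x ∈ W ∪ m, x ∈ X) :
    eigenval η a d m z * scal T vac phi m (W.erase z) =
      ∑ k ∈ W, (∏ i ∈ W.erase k, (k - i)⁻¹) *
        (a k * ∏ i ∈ W.erase z, (k + η - i) + d k * ∏ i ∈ W.erase z, (k - η - i)) *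
          scal T vac phi m (W.erase k) := by
  have h1 := hm.left_eigen h hη hv' (z := z) (Finset.disjoint_left.1 hW hz)
    (fun x hx => hX x (by
      rcases Finset.mem_insert.1 hx with rfl | hx
      · exact Finset.mem_union_left _ hz
      · exact Finset.mem_union_right _ hx)) (bethe T vac (W.erase z))
  rw [LatticeNLS.transfer_bethe h hη hv hz fun x hx => hX x (Finset.mem_union_left _ hx)] at h1
  simp only [map_sum, map_smul, smul_eq_mul] at h1
  exact h1.symm

end Dual

/-! ### Scalar products only depend on the values of the vacuum eigenvalues -/

section Span

variable {V : Type*} [AddCommGroup V] [Module ℂ V] {η : ℂ}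
  {T : ℂ → Matrix (Fin 2) (Fin 2) (Module.End ℂ V)} {vac : V} {a d : ℂ → ℂ} {X : Set ℂ}

/-- The span of the Bethe vectors with `n` rapidities taken from `U`. -/
def betheSpan (T : ℂ → Matrix (Fin 2) (Fin 2) (Module.End ℂ V)) (vac : V) (U : Finset ℂ)
    (n : ℕ) : Submodule ℂ V :=
  Submodule.span ℂ {u | ∃ s ⊆ U, s.card = n ∧ u = bethe T vac s}

theorem bethe_mem_betheSpan {U s : Finset ℂ} (h : s ⊆ U) :
    bethe T vac s ∈ betheSpan T vac U s.card :=
  Submodule.subset_span ⟨s, h, rfl, rfl⟩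

theorem bethe_mem_betheSpan' {U s : Finset ℂ} {n : ℕ} (h : s ⊆ U) (hn : s.card = n) :
    bethe T vac s ∈ betheSpan T vac U n :=
  Submodule.subset_span ⟨s, h, hn, rfl⟩

theorem betheSpan_mono {U U' : Finset ℂ} (h : U ⊆ U') (n : ℕ) :
    betheSpan T vac U n ≤ betheSpan T vac U' n :=
  Submodule.span_mono fun _ ⟨s, hs, hn, e⟩ => ⟨s, hs.trans h, hn, e⟩

theorem map_mem_of_betheSpan {W : Type*} [AddCommGroup W] [Module ℂ W] {f : V →ₗ[ℂ] W}
    {U : Finset ℂ} {n : ℕ} {P : Submodule ℂ W}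
    (h : ∀ s ⊆ U, s.card = n → f (bethe T vac s) ∈ P) {u : V} (hu : u ∈ betheSpan T vac U n) :
    f u ∈ P := by
  have : betheSpan T vac U n ≤ P.comap f :=
    Submodule.span_le.2 fun _ ⟨s, hs, hn, e⟩ => by
      rw [e]; exact h s hs hn
  exact this hu

theorem B_mem_betheSpan (h : RTT η T) (hη : η ≠ 0) {U : Finset ℂ} {v : ℂ} (hvU : v ∉ U) {n : ℕ}
    {u : V} (hu : u ∈ betheSpan T vac U n) : T v 0 1 u ∈ betheSpan T vac (insert v U) (n + 1) := by
  refine map_mem_of_betheSpan (fun s hs hn => ?_) hu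
  have hvs : v ∉ s := fun e => hvU (hs e)
  rw [← bethe_insert h hη hvs]
  exact bethe_mem_betheSpan' (Finset.insert_subset_insert v hs)
    (by rw [Finset.card_insert_of_notMem hvs, hn])

theorem exchange_mem_betheSpan {K : Module.End ℂ V} {v : ℂ} {s : Finset ℂ} (hv : v ∉ s)
    {c : ℂ} {e : ℂ → ℂ} (hK : K (bethe T vac s) = c • bethe T vac s +
      ∑ k ∈ s, e k • bethe T vac (insert v (s.erase k))) :
    K (bethe T vac s) ∈ betheSpan T vac (insert v s) s.card := by
  rw [hK]
  refine add_mem (Submodule.smul_mem _ _ (bethe_mem_betheSpan (Finset.subset_insert v s)))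
    (sum_mem fun k hk => Submodule.smul_mem _ _ (bethe_mem_betheSpan'
      (Finset.insert_subset_insert v (Finset.erase_subset k s)) ?_))
  rw [Finset.card_insert_of_notMem fun e => hv (Finset.mem_of_mem_erase e),
    Finset.card_erase_add_one hk]

theorem A_mem_betheSpan (h : RTT η T) (hη : η ≠ 0) (hv : IsVacuum T a d X vac) {U : Finset ℂ}
    {v : ℂ} (hvU : v ∉ U) (hX : ∀ x ∈ insert v U, x ∈ X) {n : ℕ} {u : V}
    (hu : u ∈ betheSpan T vac U n) : T v 0 0 u ∈ betheSpan T vac (insert v U) n := by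
  refine map_mem_of_betheSpan (fun s hs hn => ?_) hu
  have hvs : v ∉ s := fun e => hvU (hs e)
  exact betheSpan_mono (Finset.insert_subset_insert v hs) _ (hn ▸ exchange_mem_betheSpan hvs
    (A_bethe h hη hv hvs fun x hx => hX x (Finset.insert_subset_insert v hs hx)))

theorem D_mem_betheSpan (h : RTT η T) (hη : η ≠ 0) (hv : IsVacuum T a d X vac) {U : Finset ℂ}
    {v : ℂ} (hvU : v ∉ U) (hX : ∀ x ∈ insert v U, x ∈ X) {n : ℕ} {u : V}
    (hu : u ∈ betheSpan T vac U n) : T v 1 1 u ∈ betheSpan T vac (insert v U) n := by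
  refine map_mem_of_betheSpan (fun s hs hn => ?_) hu
  have hvs : v ∉ s := fun e => hvU (hs e)
  exact betheSpan_mono (Finset.insert_subset_insert v hs) _ (hn ▸ exchange_mem_betheSpan hvs
    (D_bethe h hη hv hvs fun x hx => hX x (Finset.insert_subset_insert v hs hx)))

/-- Moving `C(v)` past one `B(y)` produces products of `A` and `D`, which preserve the number of
rapidities, and `B(y) C(v)`, which falls under the induction. The coefficients never matter. -/
theorem C_bethe_mem (h : RTT η T) (hη : η ≠ 0) (hv : IsVacuum T a d X vac) {v : ℂ}
    (s : Finset ℂ) : v ∉ s → (∀ x ∈ insert v s, x ∈ X) → ∀ n, s.card = n + 1 →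
      T v 1 0 (bethe T vac s) ∈ betheSpan T vac (insert v s) n := by
  induction s using Finset.induction_on with
  | empty => intro _ _ n hn; simp at hn
  | insert y s hy ih =>
    intro hvs hX n hn
    have hvy : v ≠ y := fun e => hvs (by simp [e])
    have hvs' : v ∉ s := fun e => hvs (by simp [e])
    have hn' : s.card = n := by simpa [Finset.card_insert_of_notMem hy] using hn
    have key := congrArg (fun f : Module.End ℂ V => f (bethe T vac s)) (h.C_mul_B hvy)
    simp only [Module.End.mul_apply, LinearMap.add_apply, LinearMap.sub_apply,
      LinearMap.smul_apply] at key
    rw [bethe_insert h hη hy, key]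
    have hs := bethe_mem_betheSpan' (T := T) (vac := vac) subset_rfl hn'
    have e : insert v (insert y s) = insert y (insert v s) := Finset.insert_comm _ _ _
    have hXs : ∀ x ∈ insert v s, x ∈ X := fun x hx => hX x (by
      simp only [Finset.mem_insert] at hx ⊢; tauto)
    have hXy : ∀ x ∈ insert y s, x ∈ X := fun x hx => hX x (by
      simp only [Finset.mem_insert] at hx ⊢; tauto)
    have hyv : y ∉ insert v s := by simp [hvy.symm, hy]
    refine add_mem ?_ (Submodule.smul_mem _ _ (sub_mem ?_ ?_))
    · rcases n with _ | n
      · rw [Finset.card_eq_zero.1 hn', bethe_empty, hv.C_apply v (hX v (by simp)), map_zero]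
        exact zero_mem _
      · rw [e]
        exact B_mem_betheSpan h hη hyv (ih hvs' hXs n hn')
    · exact A_mem_betheSpan h hη hv hvs hX (D_mem_betheSpan h hη hv hy hXy hs)
    · rw [e] at hX ⊢
      exact A_mem_betheSpan h hη hv hyv hX (D_mem_betheSpan h hη hv hvs' hXs hs)

theorem C_mem_betheSpan (h : RTT η T) (hη : η ≠ 0) (hv : IsVacuum T a d X vac) {U : Finset ℂ}
    {v : ℂ} (hvU : v ∉ U) (hX : ∀ x ∈ insert v U, x ∈ X) {n : ℕ} {u : V}
    (hu : u ∈ betheSpan T vac U (n + 1)) : T v 1 0 u ∈ betheSpan T vac (insert v U) n := by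
  refine map_mem_of_betheSpan (fun s hs hn => ?_) hu
  exact betheSpan_mono (Finset.insert_subset_insert v hs) _ (C_bethe_mem h hη hv s
    (fun e => hvU (hs e)) (fun x hx => hX x (Finset.insert_subset_insert v hs hx)) n hn)

end Span

/-! ### Comparison of two representations through their direct sum -/

section Universality

variable {V₁ V₂ : Type*} [AddCommGroup V₁] [Module ℂ V₁] [AddCommGroup V₂] [Module ℂ V₂] {η : ℂ}
  {T₁ : ℂ → Matrix (Fin 2) (Fin 2) (Module.End ℂ V₁)}
  {T₂ : ℂ → Matrix (Fin 2) (Fin 2) (Module.End ℂ V₂)}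
  {vac₁ : V₁} {vac₂ : V₂} {a d : ℂ → ℂ} {X : Set ℂ}

/-- The direct sum of two representations of the Yang-Baxter algebra. -/
def prodT (T₁ : ℂ → Matrix (Fin 2) (Fin 2) (Module.End ℂ V₁))
    (T₂ : ℂ → Matrix (Fin 2) (Fin 2) (Module.End ℂ V₂)) :
    ℂ → Matrix (Fin 2) (Fin 2) (Module.End ℂ (V₁ × V₂)) :=
  fun x => Matrix.of fun i j => LinearMap.prodMap (T₁ x i j) (T₂ x i j)

@[simp] theorem prodT_apply (x : ℂ) (i j : Fin 2) (u : V₁ × V₂) :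
    prodT T₁ T₂ x i j u = (T₁ x i j u.1, T₂ x i j u.2) := rfl

theorem RTT.prodT (h₁ : RTT η T₁) (h₂ : RTT η T₂) : RTT η (prodT T₁ T₂) := by
  intro x y i j k l
  refine LinearMap.ext fun u => Prod.ext ?_ ?_
  · exact congrArg (fun g : Module.End ℂ V₁ => g u.1) (h₁ x y i j k l)
  · exact congrArg (fun g : Module.End ℂ V₂ => g u.2) (h₂ x y i j k l)

theorem IsVacuum.prodT (h₁ : IsVacuum T₁ a d X vac₁) (h₂ : IsVacuum T₂ a d X vac₂) :
    IsVacuum (prodT T₁ T₂) a d X (vac₁, vac₂) where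
  A_apply x hx := by simp [h₁.A_apply x hx, h₂.A_apply x hx]
  D_apply x hx := by simp [h₁.D_apply x hx, h₂.D_apply x hx]
  C_apply x hx := by simp [h₁.C_apply x hx, h₂.C_apply x hx]

theorem bethe_prodT (s : Finset ℂ) :
    bethe (prodT T₁ T₂) (vac₁, vac₂) s = (bethe T₁ vac₁ s, bethe T₂ vac₂ s) := by
  unfold bethe
  induction s.toList with
  | nil => rfl
  | cons x l ih => simp [ih]

/-- Scalar products only depend on the values of the vacuum eigenvalues at the rapidities. -/
theorem scal_eq_scal (h₁ : RTT η T₁) (h₂ : RTT η T₂) (hη : η ≠ 0)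
    (hv₁ : IsVacuum T₁ a d X vac₁) (hv₂ : IsVacuum T₂ a d X vac₂)
    {phi₁ : Module.Dual ℂ V₁} {phi₂ : Module.Dual ℂ V₂} (e₁ : phi₁ vac₁ = 1) (e₂ : phi₂ vac₂ = 1)
    {v w : Finset ℂ} (hvw : Disjoint v w) (hc : v.card = w.card) (hX : ∀ x ∈ v ∪ w, x ∈ X) :
    scal T₁ vac₁ phi₁ v w = scal T₂ vac₂ phi₂ v w := by
  -- Stated for a whole span in the direct sum because `C(x)` maps a Bethe vector only into a span:
  -- it removes one rapidity and adds `x` to the pool `U`.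
  have key : ∀ (s : Finset ℂ) (U : Finset ℂ), Disjoint s U → (∀ x ∈ s ∪ U, x ∈ X) →
      ∀ u ∈ betheSpan (prodT T₁ T₂) (vac₁, vac₂) U s.card,
        bethe (dualT T₁) phi₁ s u.1 = bethe (dualT T₂) phi₂ s u.2 := by
    intro s
    induction s using Finset.induction_on with
    | empty =>
      intro U _ _ u hu
      -- With no rapidity left the span is the line through the pair of vacua, where the two
      -- functionals agree by normalization.
      have : u ∈ Submodule.span ℂ {((vac₁, vac₂) : V₁ × V₂)} := by
        refine Submodule.span_mono ?_ hu
        rintro _ ⟨s, -, hs, rfl⟩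
        rw [Finset.card_empty, Finset.card_eq_zero] at hs
        simp [hs]
      obtain ⟨r, rfl⟩ := Submodule.mem_span_singleton.1 this
      simp [e₁, e₂]
    | insert x s hx ih =>
      intro U hU hX u hu
      rw [Finset.disjoint_insert_left] at hU
      rw [bethe_insert h₁.dual hη hx, bethe_insert h₂.dual hη hx, dualT_apply, dualT_apply]
      rw [Finset.card_insert_of_notMem hx] at hu
      refine ih (insert x U) (Finset.disjoint_insert_right.2 ⟨hx, hU.2⟩) (fun y hy => hX y ?_) _
        (C_mem_betheSpan (h₁.prodT h₂) hη (hv₁.prodT hv₂) hU.1 (fun y hy => hX y ?_) hu)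
      · simp only [Finset.mem_union, Finset.mem_insert] at hy ⊢; tauto
      · simp only [Finset.mem_union, Finset.mem_insert] at hy ⊢; tauto
  have := key v w hvw hX (bethe (prodT T₁ T₂) (vac₁, vac₂) w)
    (bethe_mem_betheSpan' subset_rfl hc.symm)
  rwa [bethe_prodT] at this

end Universality

/-! ### A scalar product in closed form -/

section Frozen

variable {V : Type*} [AddCommGroup V] [Module ℂ V] {η : ℂ}
  {T : ℂ → Matrix (Fin 2) (Fin 2) (Module.End ℂ V)} {vac : V} {a d : ℂ → ℂ} {X : Set ℂ}

/-- Every unwanted term carries the value of `a` at a rapidity of `s`. -/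
theorem A_bethe_of_zero (h : RTT η T) (hη : η ≠ 0) (hv : IsVacuum T a d X vac) {s : Finset ℂ}
    {z : ℂ} (hz : z ∉ s) (hX : ∀ x ∈ insert z s, x ∈ X) (ha : ∀ x ∈ s, a x = 0) :
    T z 0 0 (bethe T vac s) = (a z * ∏ i ∈ s, ((z - i + η) / (z - i))) • bethe T vac s := by
  rw [A_bethe h hη hv hz hX, Finset.sum_eq_zero, add_zero]
  intro k hk
  rw [ha k hk]; simp

/-- When `a` vanishes on `s`, the usual double sum collapses to the terms `a(v) d(k)`, each removing
one rapidity. -/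
theorem C_bethe_of_zero (h : RTT η T) (hη : η ≠ 0) (hv : IsVacuum T a d X vac) {v : ℂ}
    (s : Finset ℂ) : v ∉ s → (∀ x ∈ insert v s, x ∈ X) → (∀ x ∈ s, a x = 0) →
      T v 1 0 (bethe T vac s) = ∑ k ∈ s, (a v * d k * (η / (v - k)) *
        ((∏ j ∈ s.erase k, ((v - j + η) / (v - j))) *
          ∏ j ∈ s.erase k, ((k - j + -η) / (k - j)))) • bethe T vac (s.erase k) := by
  induction s using Finset.induction_on with
  | empty => intro _ hX _; simpa using hv.C_apply v (hX v (by simp))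
  | insert y s hy ih =>
    intro hvs hX ha
    have hvy : v ≠ y := fun e => hvs (by simp [e])
    have hvs' : v ∉ s := fun e => hvs (by simp [e])
    have key := congrArg (fun f : Module.End ℂ V => f (bethe T vac s)) (h.C_mul_B hvy)
    simp only [Module.End.mul_apply, LinearMap.add_apply, LinearMap.sub_apply,
      LinearMap.smul_apply] at key
    have hXs : ∀ x ∈ insert v s, x ∈ X := fun x hx => hX x (by
      simp only [Finset.mem_insert] at hx ⊢; tauto)
    have hXy : ∀ x ∈ insert y s, x ∈ X := fun x hx => hX x (by
      simp only [Finset.mem_insert] at hx ⊢; tauto)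
    have has : ∀ x ∈ s, a x = 0 := fun x hx => ha x (by simp [hx])
    have hay : a y = 0 := ha y (by simp)
    rw [bethe_insert h hη hy, key, ih hvs' hXs has, D_bethe h hη hv hy hXy,
      D_bethe h hη hv hvs' hXs]
    simp only [map_add, map_sum, map_smul, A_bethe_of_zero h hη hv hvs' hXs has,
      A_bethe_of_zero h hη hv hy hXy has, hay, zero_mul, zero_smul, smul_zero, zero_add]
    have e1 : ∀ k ∈ s, T y 0 1 (bethe T vac (s.erase k)) = bethe T vac (insert y (s.erase k)) :=
      fun k _ => (bethe_insert h hη fun e => hy (Finset.mem_of_mem_erase e)).symm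
    have e2 : ∀ k ∈ s, T v 0 0 (bethe T vac (insert y (s.erase k))) =
        (a v * ((v - y + η) / (v - y) * ∏ i ∈ s.erase k, ((v - i + η) / (v - i)))) •
          bethe T vac (insert y (s.erase k)) := by
      intro k hk
      rw [A_bethe_of_zero h hη hv, Finset.prod_insert fun e => hy (Finset.mem_of_mem_erase e)]
      · simp [hvy, hvs']
      · intro x hx
        exact hX x (by simp only [Finset.mem_insert, Finset.mem_erase] at hx ⊢; tauto)
      · intro x hx
        exact ha x (by simp only [Finset.mem_insert, Finset.mem_erase] at hx ⊢; tauto)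
    -- The rapidity `v` is the only one here at which `a` may be nonzero, so `A(y)` can only
    -- exchange `v` for `y`.
    have e3 : ∀ k ∈ s, T y 0 0 (bethe T vac (insert v (s.erase k))) =
        (a v * (η / (v - y)) * ∏ i ∈ s.erase k, ((v - i + η) / (v - i))) •
          bethe T vac (insert y (s.erase k)) := by
      intro k hk
      rw [A_bethe h hη hv, hay, zero_mul, zero_smul, zero_add,
        Finset.sum_insert fun e => hvs' (Finset.mem_of_mem_erase e), Finset.sum_eq_zero, add_zero,
        Finset.erase_insert fun e => hvs' (Finset.mem_of_mem_erase e)]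
      · intro x hx
        rw [has x (Finset.mem_of_mem_erase hx)]; simp
      · simp [hvy.symm, hy]
      · intro x hx
        exact hX x (by simp only [Finset.mem_insert, Finset.mem_erase] at hx ⊢; tauto)
    rw [Finset.sum_insert hy, Finset.erase_insert hy]
    simp only [Finset.smul_sum, smul_add, smul_sub]
    rw [Finset.sum_congr rfl fun k hk => by rw [e1 k hk],
      Finset.sum_congr (s₂ := s) (f := fun k => (η / (v - y)) • _ • T v 0 0 _) rfl
        fun k hk => by rw [e2 k hk],
      Finset.sum_congr (s₂ := s) (f := fun k => (η / (v - y)) • _ • T y 0 0 _) rfl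
        fun k hk => by rw [e3 k hk]]
    -- The coefficient for `k` collects the contributions of `B(y) C(v)`, `A(v) D(y)` and `A(y)
    -- D(v)`; their sum is again a product.
    have e4 : ∀ k ∈ s, (a v * d k * (η / (v - k)) *
        ((∏ j ∈ (insert y s).erase k, ((v - j + η) / (v - j))) *
          ∏ j ∈ (insert y s).erase k, ((k - j + -η) / (k - j)))) •
            bethe T vac ((insert y s).erase k) =
        (a v * d k * (η / (v - k)) * ((∏ j ∈ s.erase k, ((v - j + η) / (v - j))) *
          ∏ j ∈ s.erase k, ((k - j + -η) / (k - j)))) • bethe T vac (insert y (s.erase k)) +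
        (η / (v - y)) • (d k * (-η / (k - y)) * ∏ j ∈ s.erase k, ((k - j + -η) / (k - j))) •
          (a v * ((v - y + η) / (v - y) * ∏ i ∈ s.erase k, ((v - i + η) / (v - i)))) •
            bethe T vac (insert y (s.erase k)) -
        (η / (v - y)) • (d k * (-η / (k - v)) * ∏ j ∈ s.erase k, ((k - j + -η) / (k - j))) •
          (a v * (η / (v - y)) * ∏ i ∈ s.erase k, ((v - i + η) / (v - i))) •
            bethe T vac (insert y (s.erase k)) := by
      intro k hk
      have hky : k ≠ y := fun e => hy (e ▸ hk)
      have hkv : k ≠ v := fun e => hvs' (e ▸ hk)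
      have hys : y ∉ s.erase k := fun e => hy (Finset.mem_of_mem_erase e)
      rw [Finset.erase_insert_of_ne hky.symm, Finset.prod_insert hys, Finset.prod_insert hys]
      simp only [smul_smul]
      rw [← add_smul, ← sub_smul]
      congr 1
      have := sub_ne_zero.2 hky
      have := sub_ne_zero.2 hkv
      have := sub_ne_zero.2 hkv.symm
      have := sub_ne_zero.2 hvy
      rw [← neg_sub v k]
      field_simp
      ring
    rw [Finset.sum_congr (s₂ := s) rfl e4, Finset.sum_sub_distrib, Finset.sum_add_distrib,
      smul_smul, smul_smul]
    rw [show η / (v - y) * (d y * ∏ i ∈ s, (y - i + -η) / (y - i)) *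
        (a v * ∏ i ∈ s, (v - i + η) / (v - i)) = a v * d y * (η / (v - y)) *
        ((∏ j ∈ s, ((v - j + η) / (v - j))) * ∏ j ∈ s, ((y - j + -η) / (y - j))) by ring]
    abel

/-- The scalar product for rapidities shifted by `η` from each other, if `a` vanishes at one of the
two sets. -/
theorem scal_shift (h : RTT η T) (hη : η ≠ 0) (hv : IsVacuum T a d X vac)
    {phi : Module.Dual ℂ V} (e : phi vac = 1) (m : Finset ℂ) :
    Disjoint m (m.image (· + η)) → (∀ x ∈ m ∪ m.image (· + η), x ∈ X) →
      (∀ x ∈ m, a (x + η) = 0) →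
      scal T vac phi m (m.image (· + η)) = ∏ x ∈ m, -(a x * d (x + η)) := by
  induction m using Finset.induction_on with
  | empty => intro _ _ _; simp [scal, e]
  | insert v m hvm ih =>
    intro hd hX ha
    have hinj : ∀ x, x + η ∈ m.image (· + η) ↔ x ∈ m := fun x => by simp
    rw [Finset.image_insert, Finset.disjoint_insert_left, Finset.disjoint_insert_right] at hd
    obtain ⟨hv1, hv2, hd⟩ := hd
    simp only [Finset.image_insert] at hX ⊢
    have hvη : v + η ∉ m.image (· + η) := by rwa [hinj]
    rw [scal, bethe_insert h.dual hη hvm, dualT_apply, C_bethe_of_zero h hη hv _ hv1 ?_ ?_]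
    · rw [Finset.sum_insert hvη, Finset.sum_eq_zero, add_zero, Finset.erase_insert hvη, map_smul,
        ← scal, ih hd ?_ fun x hx => ha x (by simp [hx]), Finset.prod_insert hvm, smul_eq_mul,
        ← Finset.prod_mul_distrib, Finset.prod_eq_one]
      · rw [show v - (v + η) = -η by ring, div_neg, div_self hη]; ring
      -- For the partner `v + η` the two products cancel factor by factor.
      · intro j hj
        have h1 : v - j ≠ 0 := sub_ne_zero.2 fun e => hv1 (e ▸ Finset.mem_insert_of_mem hj)
        have h2 : v + η - j ≠ 0 := sub_ne_zero.2 fun e => hvη (by rwa [e])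
        rw [show v - j + η = v + η - j by ring, show v + η - j + -η = v - j by ring]
        field_simp
      · intro x hx
        exact hX x (by simp only [Finset.mem_union, Finset.mem_insert] at hx ⊢; tauto)
      -- Any other term contains the factor `v - (v + η) + η = 0`: `C(v)` can only remove its own
      -- partner.
      · intro k hk
        have hkv : v + η ≠ k := fun e => hvη (e ▸ hk)
        rw [Finset.prod_eq_zero (i := v + η) (s := (insert (v + η) (m.image (· + η))).erase k)
          (by simp [hkv])]
        · simp
        · rw [show v - (v + η) + η = 0 by ring, zero_div]
    · intro x hx
      exact hX x (by simp only [Finset.mem_union, Finset.mem_insert] at hx ⊢; tauto)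
    · intro x hx
      rw [← Finset.image_insert (· + η)] at hx
      obtain ⟨y, hy, rfl⟩ := Finset.mem_image.1 hx
      exact ha y hy

end Frozen

/-! ### Determinants of functionals -/

section Exchange

open Polynomial

theorem lagrange_eval {ι : Type*} [DecidableEq ι] {s : Finset ι} {v : ι → ℂ}
    (hv : Set.InjOn v s) {p : ℂ[X]} (hp : p.degree < s.card) (x : ℂ) :
    ∑ l ∈ s, ((∏ i ∈ s.erase l, (v l - v i)⁻¹) * ∏ i ∈ s.erase l, (x - v i)) * p.eval (v l) =
      p.eval x := by
  conv_rhs => rw [Lagrange.eq_interpolate hv hp]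
  rw [Lagrange.interpolate_apply, eval_finsetSum]
  refine Finset.sum_congr rfl fun l _ => ?_
  rw [eval_mul, eval_C, Lagrange.basis, eval_prod, mul_comm, ← Finset.prod_mul_distrib]
  congr 1
  refine Finset.prod_congr rfl fun i _ => ?_
  simp [Lagrange.basisDivisor]

/-- The row of powers of `p` is the Lagrange combination of the rows of powers of the `u l`, exact
because the exponents are below `n`; replacing row `k` by that combination scales the determinant by
the coefficient of row `k`. -/
theorem det_vandermonde_update {n : ℕ} {u : Fin n → ℂ} (hu : Function.Injective u) (k : Fin n)
    (p : ℂ) : (Matrix.vandermonde (Function.update u k p)).det =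
      ((∏ i ∈ Finset.univ.erase k, (u k - u i)⁻¹) * ∏ i ∈ Finset.univ.erase k, (p - u i)) *
        (Matrix.vandermonde u).det := by
  rw [← smul_eq_mul, ← Matrix.det_updateRow_sum (Matrix.vandermonde u) k fun l =>
    ((∏ i ∈ Finset.univ.erase l, (u l - u i)⁻¹) * ∏ i ∈ Finset.univ.erase l, (p - u i))]
  congr 1
  ext i j
  rcases eq_or_ne i k with rfl | hik
  · rw [Matrix.updateRow_self, Matrix.vandermonde_apply, Function.update_self, Finset.sum_apply]
    have := lagrange_eval (s := Finset.univ) hu.injOn (p := X ^ (j : ℕ))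
      (by rw [degree_X_pow]; simp) p
    simp only [eval_pow, eval_X] at this
    rw [← this]
    simp [Matrix.vandermonde_apply]
  · rw [Matrix.updateRow_ne hik, Matrix.vandermonde_apply, Function.update_of_ne hik,
      Matrix.vandermonde_apply]

variable {n : ℕ}

/-- Cramer's rule for the column `i ↦ f i p`, read in row `j`. It is the pattern to be matched by
the scalar products. -/
theorem det_update_relation (f : Fin n → ℂ → ℂ) (u : Fin n → ℂ) (p : ℂ) (j : Fin n) :
    f j p * (Matrix.of fun i k => f i (u k)).det =
      ∑ k, f j (u k) * (Matrix.of fun i l => f i (Function.update u k p l)).det := by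
  have h := congrFun (Matrix.mulVec_cramer (Matrix.of fun i k => f i (u k)) fun i => f i p) j
  rw [Pi.smul_apply, smul_eq_mul, mul_comm] at h
  rw [← h, Matrix.mulVec, dotProduct]
  refine Finset.sum_congr rfl fun k _ => ?_
  rw [Matrix.cramer_apply, Matrix.of_apply]
  congr 2
  ext i l
  rcases eq_or_ne l k with rfl | hlk
  · simp
  · simp [hlk]

/-- An antisymmetric function satisfying the exchange relations of a nonzero determinant is
determined by one of its values. -/
theorem eq_zero_of_exchange (f : Fin n → ℂ → ℂ) (G : (Fin n → ℂ) → ℂ) (ok : ℂ → Prop)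
    (hrel : ∀ u, Function.Injective u → (∀ i, ok (u i)) → ∀ p, ok p → p ∉ Set.range u →
      ∀ j, f j p * G u = ∑ k, f j (u k) * G (Function.update u k p))
    (hperm : ∀ u (σ : Equiv.Perm (Fin n)), G u = 0 → G (u ∘ σ) = 0)
    {v : Fin n → ℂ} (hv : Function.Injective v) (hvok : ∀ i, ok (v i))
    (hdet : (Matrix.of fun i k => f i (v k)).det ≠ 0) (hGv : G v = 0) :
    ∀ u, Function.Injective u → (∀ i, ok (u i)) → G u = 0 := by
  -- Induction on the number of positions where agreement with `v` is not yet imposed.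
  suffices H : ∀ (c : ℕ) (I : Finset (Fin n)), Iᶜ.card = c → ∀ u, Function.Injective u →
      (∀ i, ok (u i)) → (∀ i ∈ I, u i = v i) → G u = 0 from
    fun u hu hok => H _ ∅ rfl u hu hok (by simp)
  intro c
  induction c with
  | zero =>
    intro I hI u _ _ huv
    have : I = Finset.univ := by simpa using hI
    have : u = v := funext fun i => huv i (by simp [this])
    rw [this, hGv]
  | succ c ih =>
    intro I hI u hu hok huv
    obtain ⟨i, hi⟩ : Iᶜ.Nonempty := Finset.card_pos.1 (by omega)
    have hi' : i ∉ I := by simpa using hi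
    have hcard : (insert i I)ᶜ.card = c := by
      rw [Finset.compl_insert, Finset.card_erase_of_mem hi, hI]; rfl
    -- If `v i` sits at a wrong position `k`, a transposition brings it to `i` without disturbing
    -- `I`, and the induction hypothesis applies to `insert i I`.
    have step : ∀ w : Fin n → ℂ, Function.Injective w → (∀ j, ok (w j)) → ∀ k ∉ I, w k = v i →
        (∀ j ∈ I, w j = v j) → G w = 0 := by
      intro w hw hwok k hk hwk hwI
      have := ih (insert i I) hcard (w ∘ Equiv.swap i k) (hw.comp (Equiv.injective _))
        (fun j => hwok _) (fun j hj => by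
          rcases Finset.mem_insert.1 hj with rfl | hj
          · simpa using hwk
          · have hji : j ≠ i := fun e => hi' (e ▸ hj)
            have hjk : j ≠ k := fun e => hk (e ▸ hj)
            simpa [Equiv.swap_apply_of_ne_of_ne hji hjk] using hwI j hj)
      have h2 := hperm _ (Equiv.swap i k) this
      rwa [Function.comp_assoc, ← Equiv.coe_trans, Equiv.swap_swap, Equiv.coe_refl,
        Function.comp_id] at h2
    by_cases hr : v i ∈ Set.range u
    · obtain ⟨k, hk⟩ := hr
      refine step u hu hok k (fun hkI => ?_) hk huv
      rw [huv k hkI] at hk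
      exact hi' (hv hk ▸ hkI)
    -- Contracting the relations at `p = v i` with row `i` of the inverse of `A` isolates `G u`. The
    -- terms `k ∈ I` drop out because `u k = v k` with `k ≠ i`; the others because the update puts
    -- `v i` at a position outside `I`.
    · set A : Matrix (Fin n) (Fin n) ℂ := Matrix.of fun i k => f i (v k) with hA
      have hinv : A⁻¹ * A = 1 := Matrix.nonsing_inv_mul _ (Ne.isUnit hdet)
      have hδ : ∀ k, ∑ j, A⁻¹ i j * f j (v k) = if i = k then 1 else 0 := by
        intro k
        have := congrFun (congrFun hinv i) k
        rwa [Matrix.mul_apply, Matrix.one_apply] at this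
      have key : ∑ j, A⁻¹ i j * (f j (v i) * G u) = 0 := by
        rw [Finset.sum_congr rfl fun j _ => by rw [hrel u hu hok (v i) (hvok i) hr j]]
        simp only [Finset.mul_sum]
        rw [Finset.sum_comm]
        refine Finset.sum_eq_zero fun k _ => ?_
        by_cases hk : k ∈ I
        · have hik : i ≠ k := fun e => hi' (e ▸ hk)
          have := hδ k
          rw [if_neg hik] at this
          simp only [← mul_assoc]
          rw [← Finset.sum_mul, huv k hk, this, zero_mul]
        · refine Finset.sum_eq_zero fun j _ => ?_
          rw [step (Function.update u k (v i)) ?_ ?_ k hk (by simp), mul_zero, mul_zero]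
          · intro j hj
            have hjk : j ≠ k := fun e => hk (e ▸ hj)
            rw [Function.update_of_ne hjk, huv j hj]
          · intro x y hxy
            by_cases hx : x = k <;> by_cases hy : y = k
            · rw [hx, hy]
            · subst hx
              rw [Function.update_self, Function.update_of_ne hy] at hxy
              exact absurd ⟨y, hxy.symm⟩ hr
            · subst hy
              rw [Function.update_self, Function.update_of_ne hx] at hxy
              exact absurd ⟨x, hxy⟩ hr
            · rw [Function.update_of_ne hx, Function.update_of_ne hy] at hxy
              exact hu hxy
          · intro j
            by_cases hj : j = k
            · subst hj; simpa using hvok i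
            · rw [Function.update_of_ne hj]; exact hok j
      simp only [← mul_assoc] at key
      rw [← Finset.sum_mul, hδ i, if_pos rfl, one_mul] at key
      exact key

end Exchange

/-! ### The scalar product as a determinant -/

section Slavnov

open Polynomial

/-- The functional on polynomials whose kernel contains the Baxter polynomial of an eigenvector. -/
def baxter (η : ℂ) (a d : ℂ → ℂ) (m : Finset ℂ) (w : ℂ) : ℂ[X] →ₗ[ℂ] ℂ :=
  eigenval η a d m w • leval w - a w • leval (w + η) - d w • leval (w - η)

theorem baxter_apply (η : ℂ) (a d : ℂ → ℂ) (m : Finset ℂ) (w : ℂ) (p : ℂ[X]) :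
    baxter η a d m w p =
      eigenval η a d m w * p.eval w - a w * p.eval (w + η) - d w * p.eval (w - η) := by
  simp [baxter, leval_apply]

variable {V : Type*} [AddCommGroup V] [Module ℂ V] {η : ℂ}
  {T : ℂ → Matrix (Fin 2) (Fin 2) (Module.End ℂ V)} {vac : V} {phi : Module.Dual ℂ V}
  {a d : ℂ → ℂ} {X : Set ℂ}

/-- Weight the relation `OnShell.scal_relation` for `z` by `p(z) / ∏ (z - i)` and sum over `z ∈ W`:
Lagrange interpolation on `W` resums the products `∏ (k ± η - i)` into `p(k ± η)`, and the three
terms form `baxter`. -/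
theorem OnShell.sum_baxter (h : RTT η T) (hη : η ≠ 0) (hv : IsVacuum T a d X vac)
    (hv' : IsVacuum (dualT T) a d X phi) {m : Finset ℂ} (hm : OnShell η a d m) {W : Finset ℂ}
    (hW : Disjoint W m) (hX : ∀ x ∈ W ∪ m, x ∈ X) {p : ℂ[X]} (hp : p.degree < W.card) :
    ∑ k ∈ W, (∏ i ∈ W.erase k, (k - i)⁻¹) * scal T vac phi m (W.erase k) *
      baxter η a d m k p = 0 := by
  have hL : ∀ x, ∑ l ∈ W, ((∏ i ∈ W.erase l, (l - i)⁻¹) * ∏ i ∈ W.erase l, (x - i)) * p.eval l =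
      p.eval x := fun x => lagrange_eval (v := id) (Set.injOn_id _) hp x
  have h1 : ∑ z ∈ W, (∏ i ∈ W.erase z, (z - i)⁻¹) * p.eval z *
      (eigenval η a d m z * scal T vac phi m (W.erase z)) =
      ∑ k ∈ W, (∏ i ∈ W.erase k, (k - i)⁻¹) * scal T vac phi m (W.erase k) *
        (a k * p.eval (k + η) + d k * p.eval (k - η)) := by
    rw [Finset.sum_congr rfl fun z hz => by rw [hm.scal_relation h hη hv hv' hz hW hX]]
    simp only [Finset.mul_sum]
    rw [Finset.sum_comm]
    refine Finset.sum_congr rfl fun k _ => ?_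
    rw [← hL (k + η), ← hL (k - η), Finset.mul_sum, Finset.mul_sum, ← Finset.sum_add_distrib,
      Finset.mul_sum]
    refine Finset.sum_congr rfl fun z _ => ?_
    ring
  simp only [baxter_apply]
  rw [← sub_eq_zero, ← Finset.sum_sub_distrib] at h1
  rw [← h1]
  refine Finset.sum_congr rfl fun k _ => ?_
  ring

/-- This is `OnShell.sum_baxter` for `W = {p} ∪ {u i}`, cleared of denominators by the Vandermonde
determinant of `u` and `∏ (p - u i)`. The Vandermonde factor makes the scalar product antisymmetric
and gives the relation the exact form of `det_update_relation`. -/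
theorem OnShell.exchange (h : RTT η T) (hη : η ≠ 0) (hv : IsVacuum T a d X vac)
    (hv' : IsVacuum (dualT T) a d X phi) {m : Finset ℂ} (hm : OnShell η a d m)
    (hmX : ∀ x ∈ m, x ∈ X) {n : ℕ} {u : Fin n → ℂ} (hu : Function.Injective u)
    (huX : ∀ i, u i ∈ X ∧ u i ∉ m) {p : ℂ} (hp : p ∈ X ∧ p ∉ m) (hpu : p ∉ Set.range u)
    {q : ℂ[X]} (hq : q.degree < n) :
    baxter η a d m p q * ((Matrix.vandermonde u).det *
        scal T vac phi m (Finset.univ.image u)) =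
      ∑ k, baxter η a d m (u k) q * ((Matrix.vandermonde (Function.update u k p)).det *
        scal T vac phi m (Finset.univ.image (Function.update u k p))) := by
  have hp' : p ∉ Finset.univ.image u := fun e => hpu (by simpa using e)
  have hpu' : ∀ i, p ≠ u i := fun i e => hpu ⟨i, e.symm⟩
  have hW : Disjoint (insert p (Finset.univ.image u)) m := by
    rw [Finset.disjoint_insert_left, Finset.disjoint_left]
    refine ⟨hp.2, fun x hx => ?_⟩
    obtain ⟨i, -, rfl⟩ := Finset.mem_image.1 hx
    exact (huX i).2
  have hX : ∀ x ∈ insert p (Finset.univ.image u) ∪ m, x ∈ X := by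
    intro x hx
    simp only [Finset.mem_union, Finset.mem_insert, Finset.mem_image, Finset.mem_univ,
      true_and] at hx
    rcases hx with (rfl | ⟨i, rfl⟩) | hx
    exacts [hp.1, (huX i).1, hmX x hx]
  have key := hm.sum_baxter h hη hv hv' hW hX (p := q) (hq.trans_le (by
    rw [Finset.card_insert_of_notMem hp', Finset.card_image_of_injective _ hu,
      Finset.card_univ, Fintype.card_fin]
    exact_mod_cast Nat.le_succ n))
  rw [Finset.sum_insert hp', Finset.erase_insert hp', Finset.sum_image hu.injOn,
    Finset.prod_image hu.injOn] at key
  have hne : ∀ i, p - u i ≠ 0 := fun i => sub_ne_zero.2 (hpu' i)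
  have hup : ∀ k, (insert p (Finset.univ.image u)).erase (u k) =
      insert p ((Finset.univ.erase k).image u) := by
    intro k
    rw [Finset.erase_insert_of_ne (hpu' k), Finset.image_erase hu]
  have him : ∀ k, insert p ((Finset.univ.erase k).image u) =
      Finset.univ.image (Function.update u k p) := by
    intro k
    ext x
    simp only [Finset.mem_insert, Finset.mem_image, Finset.mem_erase, Finset.mem_univ, and_true,
      true_and]
    constructor
    · rintro (rfl | ⟨i, hi, rfl⟩)
      · exact ⟨k, by simp⟩
      · exact ⟨i, by simp [hi]⟩
    · rintro ⟨i, rfl⟩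
      by_cases hi : i = k
      · subst hi; simp
      · exact Or.inr ⟨i, hi, by simp [hi]⟩
  have hprod : ∀ k, ∏ i ∈ insert p ((Finset.univ.erase k).image u), (u k - i)⁻¹ =
      (u k - p)⁻¹ * ∏ i ∈ Finset.univ.erase k, (u k - u i)⁻¹ := by
    intro k
    rw [Finset.prod_insert (fun e => hp' (Finset.image_subset_image (Finset.erase_subset _ _) e)),
      Finset.prod_image hu.injOn]
  simp only [hup, hprod] at key
  simp only [him] at key
  have hP : ∏ i, (p - u i) ≠ 0 := Finset.prod_ne_zero_iff.2 fun i _ => hne i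
  have h2 := congrArg (fun z => z * ((Matrix.vandermonde u).det * ∏ i, (p - u i))) key
  simp only [zero_mul, add_mul, Finset.sum_mul] at h2
  rw [← sub_eq_zero, ← h2, sub_eq_add_neg, ← Finset.sum_neg_distrib]
  congr 1
  · rw [Finset.prod_inv_distrib]
    field_simp
  · refine Finset.sum_congr rfl fun k _ => ?_
    rw [det_vandermonde_update hu, ← Finset.mul_prod_erase _ (fun i => p - u i) (Finset.mem_univ k),
      ← neg_sub p (u k)]
    have := hne k
    field_simp

/-- Both `u ↦ V(u) S(u)` and the determinant of the functionals satisfy the exchange relations.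
Their cross-multiplied difference vanishes at `u = v`, hence everywhere. -/
theorem scal_det_eq (h : RTT η T) (hη : η ≠ 0) (hv : IsVacuum T a d X vac)
    (hv' : IsVacuum (dualT T) a d X phi) {m : Finset ℂ} (hm : OnShell η a d m)
    (hmX : ∀ x ∈ m, x ∈ X) {n : ℕ} {u v : Fin n → ℂ} (hu : Function.Injective u)
    (huX : ∀ i, u i ∈ X ∧ u i ∉ m) (hv1 : Function.Injective v) (hvX : ∀ i, v i ∈ X ∧ v i ∉ m)
    (hdet : (Matrix.of fun i k : Fin n => baxter η a d m (v k) (Polynomial.X ^ (i : ℕ))).det ≠ 0) :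
    (Matrix.vandermonde u).det * scal T vac phi m (Finset.univ.image u) *
        (Matrix.of fun i k : Fin n => baxter η a d m (v k) (Polynomial.X ^ (i : ℕ))).det =
      (Matrix.vandermonde v).det * scal T vac phi m (Finset.univ.image v) *
        (Matrix.of fun i k : Fin n => baxter η a d m (u k) (Polynomial.X ^ (i : ℕ))).det := by
  rw [← sub_eq_zero]
  set f : Fin n → ℂ → ℂ := fun i w => baxter η a d m w (Polynomial.X ^ (i : ℕ)) with hf
  refine eq_zero_of_exchange f (fun u =>
    (Matrix.vandermonde u).det * scal T vac phi m (Finset.univ.image u) *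
        (Matrix.of fun i k : Fin n => f i (v k)).det -
      (Matrix.vandermonde v).det * scal T vac phi m (Finset.univ.image v) *
        (Matrix.of fun i k : Fin n => f i (u k)).det) (fun x => x ∈ X ∧ x ∉ m) ?_ ?_ hv1 hvX hdet
    (sub_self _) u hu huX
  · intro u hu huX p hp hpu j
    have h1 := hm.exchange h hη hv hv' hmX hu huX hp hpu (q := Polynomial.X ^ (j : ℕ))
      (by rw [degree_X_pow]; exact_mod_cast j.2)
    have h2 := det_update_relation f u p j
    simp only [mul_sub, Finset.sum_sub_distrib, ← mul_assoc, ← Finset.sum_mul] at h1 ⊢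
    congr 1
    · rw [← h1]
    · have h3 := congrArg (· * ((Matrix.vandermonde v).det *
        scal T vac phi m (Finset.univ.image v))) h2
      simp only [Finset.sum_mul] at h3
      calc _ = _ := by ring
        _ = _ := h3
        _ = _ := Finset.sum_congr rfl fun k _ => by ring
  · intro u σ hG
    have e1 : Finset.univ.image (u ∘ σ) = Finset.univ.image u := by
      rw [← Finset.image_image, Finset.image_univ_equiv]
    have e2 : Matrix.vandermonde (u ∘ σ) = (Matrix.vandermonde u).submatrix σ id := rfl
    have e3 : (Matrix.of fun i k : Fin n => f i ((u ∘ σ) k)) =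
      (Matrix.of fun i k : Fin n => f i (u k)).submatrix id σ := rfl
    simp only [e1, e2, e3, Matrix.det_permute, Matrix.det_permute']
    linear_combination ((Equiv.Perm.sign σ : ℤ) : ℂ) * hG

end Slavnov

/-! ### Chains of commuting sites -/

section Chain

theorem RTT.one {R : Type*} [Ring R] [Algebra ℂ R] (η : ℂ) :
    RTT η (fun _ => (1 : Matrix (Fin 2) (Fin 2) R)) := by
  intro x y i j k l
  have : Commute ((1 : Matrix (Fin 2) (Fin 2) R) i j) ((1 : Matrix (Fin 2) (Fin 2) R) k l) := by
    rw [Matrix.one_apply, Matrix.one_apply]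
    split_ifs
    · exact Commute.one_left _
    · exact Commute.zero_right _
    · exact Commute.zero_left _
    · exact Commute.zero_left _
  rw [this.eq, sub_self, sub_self, smul_zero, smul_zero]

/-- The coproduct of the Yang-Baxter algebra; it allows a monodromy matrix to be built site by site.
-/
theorem RTT.mul {R : Type*} [Ring R] [Algebra ℂ R] {η : ℂ}
    {T₁ T₂ : ℂ → Matrix (Fin 2) (Fin 2) R} (h₁ : RTT η T₁) (h₂ : RTT η T₂)
    (hc : ∀ x y i j k l, Commute (T₁ x i j) (T₂ y k l)) : RTT η (fun x => T₁ x * T₂ x) := by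
  intro x y i j k l
  have e : ∀ x y i j k l, (T₁ x * T₂ x) i j * (T₁ y * T₂ y) k l =
      ∑ p, ∑ q, T₁ x i p * T₁ y k q * (T₂ x p j * T₂ y q l) := by
    intro x y i j k l
    rw [Matrix.mul_apply, Matrix.mul_apply, Finset.sum_mul_sum]
    refine Finset.sum_congr rfl fun p _ => Finset.sum_congr rfl fun q _ => ?_
    rw [mul_assoc, mul_assoc, ← mul_assoc (T₂ x p j), ← (hc y x k q p j).eq, mul_assoc]
  -- The first factors are exchanged, then the second ones. The second and third terms on the right
  -- cancel against each other after summation, with `p` and `q` interchanged.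
  have F : ∀ p q, (x - y) • (T₁ x i p * T₁ y k q * (T₂ x p j * T₂ y q l)) -
      (x - y) • (T₁ y k q * T₁ x i p * (T₂ y q l * T₂ x p j)) =
      η • (T₁ x k p * T₁ y i q * (T₂ x p j * T₂ y q l)) -
      η • (T₁ y k p * T₁ x i q * (T₂ x p j * T₂ y q l)) +
      (η • (T₁ y k q * T₁ x i p * (T₂ x q j * T₂ y p l)) -
      η • (T₁ y k q * T₁ x i p * (T₂ y q j * T₂ x p l))) := by
    intro p q
    have h1 := congrArg (· * (T₂ x p j * T₂ y q l)) (h₁ x y i p k q)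
    have h2 := congrArg (T₁ y k q * T₁ x i p * ·) (h₂ x y p j q l)
    simp only [smul_mul_assoc, mul_smul_comm, sub_mul, mul_sub, smul_sub] at h1 h2
    rw [← h1, ← h2]
    abel
  simp only [e, smul_sub, smul_add, Fin.sum_univ_two]
  rw [← sub_eq_zero]
  have G := congrArg₂ (· + ·) (congrArg₂ (· + ·) (F 0 0) (F 0 1)) (congrArg₂ (· + ·) (F 1 0) (F 1 1))
  rw [← sub_eq_zero] at G
  rw [← G]
  abel

/-- The ordered product of the Lax matrices over a list of sites. -/
def chainT {R ι : Type*} [Ring R] (L : ι → ℂ → Matrix (Fin 2) (Fin 2) R) (l : List ι) (x : ℂ) :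
    Matrix (Fin 2) (Fin 2) R :=
  (l.map fun j => L j x).prod

section

variable {R ι : Type*} [Ring R] {L : ι → ℂ → Matrix (Fin 2) (Fin 2) R}

theorem chainT_cons (j : ι) (l : List ι) (x : ℂ) :
    chainT L (j :: l) x = L j x * chainT L l x := by
  simp [chainT]

theorem commute_chainT {z : R} {l : List ι} {x : ℂ}
    (h : ∀ j ∈ l, ∀ i k, Commute z (L j x i k)) (i k : Fin 2) : Commute z (chainT L l x i k) := by
  induction l generalizing i k with
  | nil =>
    rw [chainT, List.map_nil, List.prod_nil, Matrix.one_apply]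
    split_ifs
    · exact Commute.one_right _
    · exact Commute.zero_right _
  | cons j l ih =>
    rw [chainT_cons, Matrix.mul_apply]
    exact Commute.sum_right _ _ _ fun p _ => (h j (by simp) i p).mul_right
      (ih (fun j' hj' => h j' (by simp [hj'])) p k)

theorem rtt_chainT [Algebra ℂ R] {η : ℂ} (hL : ∀ j, RTT η (L j))
    (hc : ∀ j j', j ≠ j' → ∀ x y i k i' k', Commute (L j x i k) (L j' y i' k')) {l : List ι}
    (hl : l.Nodup) : RTT η (chainT L l) := by
  induction l with
  | nil => exact RTT.one η
  | cons j l ih =>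
    rw [List.nodup_cons] at hl
    rw [show chainT L (j :: l) = fun x => L j x * chainT L l x from funext (chainT_cons j l)]
    exact (hL j).mul (ih hl.2) fun x y i k i' k' => commute_chainT (fun j' hj' i' k' =>
      hc j j' (fun e => hl.1 (e ▸ hj')) x y i k i' k') i' k'

end

variable {V : Type*} [AddCommGroup V] [Module ℂ V] {vac : V} {X : Set ℂ}

theorem IsVacuum.mul {T₁ T₂ : ℂ → Matrix (Fin 2) (Fin 2) (Module.End ℂ V)} {a₁ d₁ a₂ d₂ : ℂ → ℂ}
    (h₁ : IsVacuum T₁ a₁ d₁ X vac) (h₂ : IsVacuum T₂ a₂ d₂ X vac)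
    (hc : ∀ x i j k l, Commute (T₁ x i j) (T₂ x k l)) :
    IsVacuum (fun x => T₁ x * T₂ x) (fun x => a₁ x * a₂ x) (fun x => d₁ x * d₂ x) X vac where
  C_apply x hx := by
    simp [Matrix.mul_apply, Fin.sum_univ_two, h₂.C_apply x hx, h₂.A_apply x hx, h₁.C_apply x hx]
  A_apply x hx := by
    simp [Matrix.mul_apply, Fin.sum_univ_two, h₂.C_apply x hx, h₂.A_apply x hx, h₁.A_apply x hx,
      smul_smul, mul_comm]
  D_apply x hx := by
    -- `C` of the left factor has to pass `B` of the right one before it can kill the vacuum.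
    rw [Matrix.mul_apply, Fin.sum_univ_two, (hc x 1 0 0 1).eq]
    simp [h₁.C_apply x hx, h₂.D_apply x hx, h₁.D_apply x hx, smul_smul, mul_comm]

theorem dualT_mul {T₁ T₂ : ℂ → Matrix (Fin 2) (Fin 2) (Module.End ℂ V)} :
    dualT (fun x => T₁ x * T₂ x) = fun x => dualT T₂ x * dualT T₁ x := by
  funext x
  ext i j f v
  simp [Matrix.mul_apply, Fin.sum_univ_two]

theorem commute_dualT {T₁ T₂ : ℂ → Matrix (Fin 2) (Fin 2) (Module.End ℂ V)} {x y : ℂ}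
    {i j k l : Fin 2} (h : Commute (T₁ x j i) (T₂ y l k)) :
    Commute (dualT T₁ x i j) (dualT T₂ y k l) := by
  ext f v
  have := congrArg (fun g : Module.End ℂ V => f (g v)) h.eq
  simpa using this.symm

variable {ι : Type*} {L : ι → ℂ → Matrix (Fin 2) (Fin 2) (Module.End ℂ V)} {α δ : ι → ℂ → ℂ}

theorem IsVacuum.chainT (h : ∀ j, IsVacuum (L j) (α j) (δ j) X vac)
    (hc : ∀ j j', j ≠ j' → ∀ x y i k i' k', Commute (L j x i k) (L j' y i' k')) {l : List ι}
    (hl : l.Nodup) : IsVacuum (chainT L l) (fun x => (l.map fun j => α j x).prod)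
      (fun x => (l.map fun j => δ j x).prod) X vac := by
  induction l with
  | nil => exact ⟨fun x _ => by simp [LatticeNLS.chainT], fun x _ => by simp [LatticeNLS.chainT],
      fun x _ => by simp [LatticeNLS.chainT]⟩
  | cons j l ih =>
    rw [List.nodup_cons] at hl
    rw [show LatticeNLS.chainT L (j :: l) = fun x => L j x * LatticeNLS.chainT L l x from
      funext (chainT_cons j l)]
    simp only [List.map_cons, List.prod_cons]
    exact (h j).mul (ih hl.2) fun x i k i' k' => commute_chainT (fun j' hj' i' k' =>
      hc j j' (fun e => hl.1 (e ▸ hj')) x x i k i' k') i' k'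

theorem IsVacuum.dual_chainT {phi : Module.Dual ℂ V}
    (h : ∀ j, IsVacuum (dualT (L j)) (α j) (δ j) X phi)
    (hc : ∀ j j', j ≠ j' → ∀ x y i k i' k', Commute (L j x i k) (L j' y i' k')) {l : List ι}
    (hl : l.Nodup) : IsVacuum (dualT (LatticeNLS.chainT L l)) (fun x => (l.map fun j => α j x).prod)
      (fun x => (l.map fun j => δ j x).prod) X phi := by
  induction l with
  | nil =>
    exact ⟨fun x _ => by ext v; simp [LatticeNLS.chainT],
      fun x _ => by ext v; simp [LatticeNLS.chainT],
      fun x _ => by ext v; simp [LatticeNLS.chainT]⟩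
  | cons j l ih =>
    rw [List.nodup_cons] at hl
    rw [show LatticeNLS.chainT L (j :: l) = fun x => L j x * LatticeNLS.chainT L l x from
      funext (chainT_cons j l), dualT_mul]
    simp only [List.map_cons, List.prod_cons, mul_comm (α j _), mul_comm (δ j _)]
    exact (ih hl.2).mul (h j) fun x i k i' k' => commute_dualT (commute_chainT (fun j' hj' i' k' =>
      hc j j' (fun e => hl.1 (e ▸ hj')) x x _ _ i' k') _ _).symm

end Chain

/-! ### Operators acting on one site -/

section Site

variable {M : ℕ}

/-- The operator sending an occupation-number state with `n` quanta at the site `j` to `w n` times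
the one with `e n` quanta there. -/
def siteOp (j : Fin M) (e : ℕ → ℕ) (w : ℕ → ℂ) : Module.End ℂ (Fock M) :=
  Finsupp.linearCombination ℂ fun k => Finsupp.single (Function.update k j (e (k j))) (w (k j))

@[simp] theorem siteOp_single (j : Fin M) (e : ℕ → ℕ) (w : ℕ → ℂ) (k : Fin M → ℕ) (z : ℂ) :
    siteOp j e w (Finsupp.single k z) =
      Finsupp.single (Function.update k j (e (k j))) (z * w (k j)) := by
  simp [siteOp]

theorem siteOp_mul (j : Fin M) (e e' : ℕ → ℕ) (w w' : ℕ → ℂ) :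
    siteOp j e w * siteOp j e' w' = siteOp j (e ∘ e') fun n => w' n * w (e' n) := by
  refine Finsupp.lhom_ext fun k z => ?_
  simp [mul_assoc, -Finsupp.single_mul]

theorem siteOp_smul (j : Fin M) (e : ℕ → ℕ) (w : ℕ → ℂ) (z : ℂ) :
    z • siteOp j e w = siteOp j e fun n => z * w n := by
  refine Finsupp.lhom_ext fun k z => ?_
  simp [mul_left_comm, -Finsupp.single_mul]

theorem siteOp_add (j : Fin M) (e : ℕ → ℕ) (w w' : ℕ → ℂ) :
    siteOp j e w + siteOp j e w' = siteOp j e fun n => w n + w' n := by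
  refine Finsupp.lhom_ext fun k z => ?_
  simp [mul_add]

theorem siteOp_sub (j : Fin M) (e : ℕ → ℕ) (w w' : ℕ → ℂ) :
    siteOp j e w - siteOp j e w' = siteOp j e fun n => w n - w' n := by
  refine Finsupp.lhom_ext fun k z => ?_
  simp [mul_sub]

/-- The shifts need to agree only where the weight is nonzero; this disposes of the truncated
`Nat.pred 0`. -/
theorem siteOp_congr (j : Fin M) {e e' : ℕ → ℕ} {w w' : ℕ → ℂ} (hw : ∀ n, w n = w' n)
    (he : ∀ n, w n ≠ 0 → e n = e' n) : siteOp j e w = siteOp j e' w' := by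
  refine Finsupp.lhom_ext fun k z => ?_
  rw [siteOp_single, siteOp_single, ← hw]
  by_cases h : w (k j) = 0
  · simp [h]
  · rw [he _ h]

theorem one_eq_siteOp (j : Fin M) : (1 : Module.End ℂ (Fock M)) = siteOp j id fun _ => 1 := by
  refine Finsupp.lhom_ext fun k z => ?_
  simp

theorem siteOp_zero (j : Fin M) (e : ℕ → ℕ) {w : ℕ → ℂ} (hw : ∀ n, w n = 0) :
    siteOp j e w = 0 := by
  refine Finsupp.lhom_ext fun k z => ?_
  simp [hw]

theorem siteOp_commute {j j' : Fin M} (h : j ≠ j') (e e' : ℕ → ℕ) (w w' : ℕ → ℂ) :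
    Commute (siteOp j e w) (siteOp j' e' w') := by
  refine Finsupp.lhom_ext fun k z => ?_
  simp [h, h.symm, Function.update_comm h, mul_right_comm, -Finsupp.single_mul]

/-- The Lax matrix of a general site, with the normalization of `χ`, `χ^*` left free. -/
def siteLax (s q p r : ℂ) (β γ : ℕ → ℂ) (j : Fin M) (x : ℂ) :
    Matrix (Fin 2) (Fin 2) (Module.End ℂ (Fock M)) :=
  !![siteOp j id fun n => s * x + p + q * n, siteOp j Nat.succ β;
     siteOp j Nat.pred γ, siteOp j id fun n => -(s * x) + r + q * n]

section

variable (s q p r : ℂ) (β γ : ℕ → ℂ) (j : Fin M) (x : ℂ)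

theorem siteLax_zero_zero : siteLax s q p r β γ j x 0 0 = siteOp j id fun n => s * x + p + q * n :=
  rfl

theorem siteLax_zero_one : siteLax s q p r β γ j x 0 1 = siteOp j Nat.succ β := rfl

theorem siteLax_one_zero : siteLax s q p r β γ j x 1 0 = siteOp j Nat.pred γ := rfl

theorem siteLax_one_one :
    siteLax s q p r β γ j x 1 1 = siteOp j id fun n => -(s * x) + r + q * n := rfl

theorem siteLax_eq_siteOp (i k : Fin 2) :
    ∃ e w, siteLax s q p r β γ j x i k = siteOp j e w := by
  fin_cases i <;> fin_cases k
  exacts [⟨_, _, siteLax_zero_zero ..⟩, ⟨_, _, siteLax_zero_one ..⟩,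
    ⟨_, _, siteLax_one_zero ..⟩, ⟨_, _, siteLax_one_one ..⟩]

end

theorem siteLax_commute {j j' : Fin M} (h : j ≠ j') {s q p r s' q' p' r' : ℂ}
    {β γ β' γ' : ℕ → ℂ} (x y : ℂ) (i k i' k' : Fin 2) :
    Commute (siteLax s q p r β γ j x i k) (siteLax s' q' p' r' β' γ' j' y i' k') := by
  obtain ⟨e, w, h1⟩ := siteLax_eq_siteOp s q p r β γ j x i k
  obtain ⟨e', w', h2⟩ := siteLax_eq_siteOp s' q' p' r' β' γ' j' y i' k'
  rw [h1, h2]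
  exact siteOp_commute h _ _ _ _

/-- Only the products `β n * γ (n + 1)` enter the relations, so `β` and `γ` need not be adjoint.
Their prescribed value makes `[C, B]` act as `q (p + r + 2 q n)`, which is what the exchange of `A`
and `D` requires. -/
theorem rtt_siteLax {η s q p r : ℂ} {β γ : ℕ → ℂ} (hq : q = η * s) (hγ : γ 0 = 0)
    (hβγ : ∀ n : ℕ, β n * γ (n + 1) = q * (n + 1) * (p + r + q * n)) (j : Fin M) :
    RTT η (siteLax s q p r β γ j) := by
  have hBC : siteOp j Nat.succ β * siteOp j Nat.pred γ =
      siteOp j id fun n => q * n * (p + r + q * (n - 1)) := by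
    rw [siteOp_mul]
    refine siteOp_congr j (fun n => ?_) fun n hn => ?_
    · rcases n with _ | n
      · simp [hγ]
      · rw [Nat.pred_succ, mul_comm, hβγ]; push_cast; ring
    · rcases n with _ | n
      · simp [hγ] at hn
      · rfl
  have hCB : siteOp j Nat.pred γ * siteOp j Nat.succ β =
      siteOp j id fun n => q * (n + 1) * (p + r + q * n) := by
    rw [siteOp_mul]
    exact siteOp_congr j (fun n => hβγ n) fun _ _ => rfl
  have hfB : ∀ f : ℕ → ℂ, siteOp j id f * siteOp j Nat.succ β =
      siteOp j Nat.succ fun n => β n * f (n + 1) := fun f => siteOp_mul _ _ _ _ _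
  have hBf : ∀ f : ℕ → ℂ, siteOp j Nat.succ β * siteOp j id f =
      siteOp j Nat.succ fun n => f n * β n := fun f => siteOp_mul _ _ _ _ _
  have hfC : ∀ f : ℕ → ℂ, siteOp j id f * siteOp j Nat.pred γ =
      siteOp j Nat.pred fun n => γ n * f (n - 1) := fun f => siteOp_mul _ _ _ _ _
  have hCf : ∀ f : ℕ → ℂ, siteOp j Nat.pred γ * siteOp j id f =
      siteOp j Nat.pred fun n => f n * γ n := fun f => siteOp_mul _ _ _ _ _
  have hff : ∀ f g : ℕ → ℂ, siteOp j id f * siteOp j id g =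
      siteOp j id fun n => g n * f n := fun f g => siteOp_mul _ _ _ _ _
  -- The truncated subtraction is harmless since `γ 0 = 0`.
  have hγp : ∀ (n : ℕ) (z w : ℂ), γ n * (z + w * ((n - 1 : ℕ) : ℂ)) =
      γ n * (z + w * (n - 1)) := by
    intro n z w
    rcases n with _ | n
    · simp [hγ]
    · simp
  intro x y i j' k l
  fin_cases i <;> fin_cases j' <;> fin_cases k <;> fin_cases l <;>
    simp only [Fin.zero_eta, Fin.mk_one, siteLax_zero_zero, siteLax_zero_one, siteLax_one_zero,
      siteLax_one_one, hBC, hCB, hfB, hBf, hfC, hCf, hff, siteOp_sub, siteOp_smul, sub_self,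
      smul_zero, hγp] <;>
    first
    | done
    | refine siteOp_congr j (fun n => ?_) fun _ _ => rfl
      subst hq
      push_cast
      ring
    | refine siteOp_zero j _ fun n => ?_
      subst hq
      ring

theorem isVacuum_siteLax {s q p r : ℂ} {β γ : ℕ → ℂ} (hγ : γ 0 = 0) (j : Fin M) (X : Set ℂ) :
    IsVacuum (siteLax s q p r β γ j) (fun x => s * x + p) (fun x => -(s * x) + r) X
      (vacuum M) where
  A_apply x _ := by simp [siteLax, vacuum]
  D_apply x _ := by simp [siteLax, vacuum]
  C_apply x _ := by simp [siteLax, vacuum, hγ]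

/-- The coefficient of the pseudo-vacuum. -/
def vacuumDual (M : ℕ) : Module.Dual ℂ (Fock M) := Finsupp.lapply 0

theorem vacuumDual_single (k : Fin M → ℕ) (z : ℂ) :
    vacuumDual M (Finsupp.single k z) = if k = 0 then z else 0 := by
  rw [vacuumDual, Finsupp.lapply_apply, Finsupp.single_apply]

/-- `C_apply` of the dual concerns `B`, which always leaves a quantum at the site `j` and so has no
vacuum component. -/
theorem isVacuum_dual_siteLax {s q p r : ℂ} {β γ : ℕ → ℂ} (j : Fin M)
    (X : Set ℂ) : IsVacuum (dualT (siteLax s q p r β γ j)) (fun x => s * x + p)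
      (fun x => -(s * x) + r) X (vacuumDual M) where
  A_apply x _ := by
    refine Finsupp.lhom_ext fun k z => ?_
    by_cases hk : k = 0 <;> simp [siteLax, vacuumDual_single, hk, mul_comm, -Finsupp.single_mul, -Finsupp.single_add]
  D_apply x _ := by
    refine Finsupp.lhom_ext fun k z => ?_
    by_cases hk : k = 0 <;> simp [siteLax, vacuumDual_single, hk, mul_comm, -Finsupp.single_mul, -Finsupp.single_add]
  C_apply x _ := by
    refine Finsupp.lhom_ext fun k z => ?_
    have : Function.update k j (k j).succ ≠ 0 := fun e => by
      have := congrFun e j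
      simp at this
    simp [siteLax, vacuumDual_single, this, -Finsupp.single_mul]

end Site

/-! ### Representations with prescribed vacuum eigenvalues -/

section Prescribed

open Polynomial

/-- The nodal polynomial of `X` plus the interpolant of `a` is monic of degree `X.card` and takes
the values `a` on `X`; it splits over `ℂ`, and the `p j` are its negated roots. -/
theorem exists_prod_add_eq (X : Finset ℂ) (a : ℂ → ℂ) :
    ∃ p : Fin X.card → ℂ, ∀ x ∈ X, ∏ j, (x + p j) = a x := by
  set I := Lagrange.interpolate X id a with hI
  have hdeg : I.degree < (Lagrange.nodal X (id : ℂ → ℂ)).degree := by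
    rw [Lagrange.degree_nodal]
    exact Lagrange.degree_interpolate_lt _ (Set.injOn_id _)
  set P := Lagrange.nodal X (id : ℂ → ℂ) + I with hP
  have hmonic : P.Monic := (Lagrange.nodal_monic).add_of_left hdeg
  have hnat : P.natDegree = X.card := by
    rw [hP, natDegree_add_eq_left_of_degree_lt hdeg, Lagrange.natDegree_nodal]
  have hsplit := IsAlgClosed.splits P
  have hcard : P.roots.toList.length = X.card := by
    rw [Multiset.length_toList, ← hnat, hsplit.natDegree_eq_card_roots]
  refine ⟨fun j => -P.roots.toList.get (j.cast hcard.symm), fun x hx => ?_⟩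
  have h1 : P.eval x = a x := by
    rw [hP, eval_add, Lagrange.eval_nodal, Finset.prod_eq_zero hx (by simp), zero_add]
    exact Lagrange.eval_interpolate_at_node (v := id) a (Set.injOn_id _) hx
  have h2 : P.eval x = (P.roots.map fun r => x - r).prod := by
    conv_lhs => rw [hsplit.eq_prod_roots_of_monic hmonic]
    rw [eval_multiset_prod, Multiset.map_map]
    simp
  have h3 : (P.roots.map fun r => x - r).prod = (P.roots.toList.map fun r => x - r).prod := by
    conv_lhs => rw [← Multiset.coe_toList P.roots]
    rw [Multiset.map_coe, Multiset.prod_coe]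
  rw [← h1, h2, h3, ← List.prod_ofFn]
  congr 1
  refine List.ext_get (by simp [hcard]) fun n h1 h2 => ?_
  simp [sub_eq_add_neg]

/-- An inhomogeneous chain with one site per root: the `p j` fix `a`, the `r j` fix `d`
independently. With `β = 1`, the weight `γ` is dictated by `rtt_siteLax`; the sign `(-1) ^ X.card`
compensates for `-x` in the entries `D`. -/
theorem exists_representation {η : ℂ} (a d : ℂ → ℂ) (X : Finset ℂ) :
    ∃ (M : ℕ) (T : ℂ → Matrix (Fin 2) (Fin 2) (Module.End ℂ (Fock M))),
      RTT η T ∧ IsVacuum T a d X (vacuum M) ∧ IsVacuum (dualT T) a d X (vacuumDual M) := by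
  obtain ⟨p, hp⟩ := exists_prod_add_eq X a
  obtain ⟨r, hr⟩ := exists_prod_add_eq X fun x => (-1) ^ X.card * d x
  set γ : Fin X.card → ℕ → ℂ := fun j n => η * n * (p j + -r j + η * (n - 1)) with hγ
  have hγ0 : ∀ j, γ j 0 = 0 := fun j => by simp [hγ]
  set L : Fin X.card → ℂ → Matrix (Fin 2) (Fin 2) (Module.End ℂ (Fock X.card)) :=
    fun j => siteLax 1 η (p j) (-r j) (fun _ => 1) (γ j) j with hL
  have hc : ∀ j j', j ≠ j' → ∀ x y i k i' k', Commute (L j x i k) (L j' y i' k') :=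
    fun j j' h x y i k i' k' => siteLax_commute h x y i k i' k'
  have hl := List.nodup_finRange X.card
  have hA : ∀ x ∈ (X : Set ℂ), ((List.finRange X.card).map fun j => 1 * x + p j).prod = a x := by
    intro x hx
    rw [← hp x hx, ← List.ofFn_eq_map, List.prod_ofFn]
    simp
  have hD : ∀ x ∈ (X : Set ℂ), ((List.finRange X.card).map fun j => -(1 * x) + -r j).prod =
      d x := by
    intro x hx
    have := hr x hx
    rw [← List.ofFn_eq_map, List.prod_ofFn]
    have e : ∀ j, -(1 * x) + -r j = -1 * (x + r j) := fun j => by ring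
    simp only [e, Finset.prod_mul_distrib, this, Finset.prod_const, Finset.card_univ,
      Fintype.card_fin]
    rw [← mul_assoc, ← mul_pow]; simp
  refine ⟨X.card, chainT L (List.finRange X.card), rtt_chainT (fun j => rtt_siteLax (by simp)
    (hγ0 j) (fun n => ?_) j) hc hl, ?_, ?_⟩
  · simp only [hγ]; push_cast; ring
  · have := IsVacuum.chainT (fun j => isVacuum_siteLax (s := 1) (q := η) (p := p j) (r := -r j)
      (β := fun _ => 1) (hγ0 j) j (X : Set ℂ)) hc hl
    exact ⟨fun x hx => by rw [this.A_apply x hx, hA x hx],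
      fun x hx => by rw [this.D_apply x hx, hD x hx], this.C_apply⟩
  · have := IsVacuum.dual_chainT (fun j => isVacuum_dual_siteLax (s := 1) (q := η) (p := p j)
      (r := -r j) (β := fun _ => 1) (γ := γ j) j (X : Set ℂ)) hc hl
    exact ⟨fun x hx => by rw [this.A_apply x hx, hA x hx],
      fun x hx => by rw [this.D_apply x hx, hD x hx], this.C_apply⟩

end Prescribed

/-! ### Slavnov's formula: fixing the normalization -/

section Slavnov

open Polynomial

variable {V : Type*} [AddCommGroup V] [Module ℂ V] {η : ℂ}
  {T : ℂ → Matrix (Fin 2) (Fin 2) (Module.End ℂ V)} {vac : V} {phi : Module.Dual ℂ V}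
  {a d : ℂ → ℂ} {X : Set ℂ}

theorem vacuumDual_vacuum (M : ℕ) : vacuumDual M (vacuum M) = 1 := by
  simp [vacuum, vacuumDual_single]

/-- Slavnov's determinant for the scalar product of an eigenvector with an arbitrary Bethe
vector. -/
theorem slavnov (h : RTT η T) (hη : η ≠ 0) (hv : IsVacuum T a d X vac) (e : phi vac = 1) {n : ℕ}
    {u mu : Fin n → ℂ} (hmu : Function.Injective mu) (hu : Function.Injective u)
    (hm : OnShell η a d (Finset.univ.image mu)) (hX : ∀ i, u i ∈ X ∧ mu i ∈ X)
    (h1 : ∀ i j, u i ≠ mu j) (h2 : ∀ i j, u i ≠ mu j + η) (h3 : ∀ i j, mu i ≠ mu j + η) :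
    (Matrix.vandermonde u).det *
        scal T vac phi (Finset.univ.image mu) (Finset.univ.image u) =
      (∏ i, a (mu i)) * (Matrix.of fun i k : Fin n =>
        baxter η a d (Finset.univ.image mu) (u k) (Polynomial.X ^ (i : ℕ))).det := by
  classical
  set m : Finset ℂ := Finset.univ.image mu with hmdef
  set v : Fin n → ℂ := fun i => mu i + η with hvdef
  -- The points `v i = mu i + η` differ from all rapidities, so redefining `a` and `d` there changes
  -- neither the Bethe equations nor the scalar product sought.
  set a' : ℂ → ℂ := fun x => if x ∈ Finset.univ.image v then 0 else a x with ha'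
  set d' : ℂ → ℂ := fun x => if x ∈ Finset.univ.image v then 1 else d x with hd'
  set Y : Finset ℂ := m ∪ Finset.univ.image u ∪ Finset.univ.image v with hY
  have hv1 : Function.Injective v := fun i j hij => hmu (add_right_cancel hij)
  have hvimg : Finset.univ.image v = m.image (· + η) := by
    rw [hmdef, Finset.image_image]; rfl
  have hmv : ∀ x ∈ m, x ∉ Finset.univ.image v := by
    intro x hx
    obtain ⟨i, -, rfl⟩ := Finset.mem_image.1 hx
    simpa [hvdef] using fun j => (h3 i j).symm
  have huv : ∀ i, u i ∉ Finset.univ.image v := fun i => by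
    simpa [hvdef] using fun j => (h2 i j).symm
  have hum : ∀ i, u i ∉ m := fun i => by
    simpa [hmdef] using fun j => (h1 i j).symm
  have hvm : ∀ i, v i ∉ m := fun i hi => hmv _ hi (by simp)
  have ham : ∀ x ∈ m, a' x = a x := fun x hx => if_neg (hmv x hx)
  have hdm : ∀ x ∈ m, d' x = d x := fun x hx => if_neg (hmv x hx)
  have hau : ∀ i, a' (u i) = a (u i) := fun i => if_neg (huv i)
  have hdu : ∀ i, d' (u i) = d (u i) := fun i => if_neg (huv i)
  have hav : ∀ i, a' (v i) = 0 := fun i => if_pos (by simp)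
  have hdv : ∀ i, d' (v i) = 1 := fun i => if_pos (by simp)
  obtain ⟨M, T', hT', hvac', hdual'⟩ := exists_representation (η := η) a' d' Y
  have hm' : OnShell η a' d' m := fun k hk => by rw [ham k hk, hdm k hk]; exact hm k hk
  have hmY : ∀ x ∈ m, x ∈ (Y : Set ℂ) := fun x hx => by simp [hY, hx]
  have huY : ∀ i, u i ∈ (Y : Set ℂ) ∧ u i ∉ m := fun i => ⟨by simp [hY], hum i⟩
  have hvY : ∀ i, v i ∈ (Y : Set ℂ) ∧ v i ∉ m := fun i => ⟨by simp [hY], hvm i⟩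
  -- At `v k` both `a'` and the eigenvalue vanish, the latter since `v k - η` is a root of the
  -- Baxter polynomial. The functional reduces to `-p(mu k)`.
  have hbv : (Matrix.of fun i k : Fin n => baxter η a' d' m (v k) (Polynomial.X ^ (i : ℕ))).det =
      (-1) ^ n * (Matrix.vandermonde mu).det := by
    have : (Matrix.of fun i k : Fin n => baxter η a' d' m (v k) (Polynomial.X ^ (i : ℕ))) =
        -(Matrix.vandermonde mu).transpose := by
      ext i k
      have hz : ∏ x ∈ m, (v k - η - x) = 0 :=
        Finset.prod_eq_zero (i := mu k) (by simp [hmdef]) (by simp [hvdef])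
      simp [baxter_apply, eigenval, hav, hdv, hz, Matrix.vandermonde_apply]
      simp [hvdef]
    rw [this, Matrix.det_neg, Matrix.det_transpose, Fintype.card_fin]
  have hV0 : (Matrix.vandermonde mu).det ≠ 0 := Matrix.det_vandermonde_ne_zero_iff.2 hmu
  have hVv : (Matrix.vandermonde v).det = (Matrix.vandermonde mu).det := by
    simp [Matrix.det_vandermonde, hvdef]
  have hbu : (Matrix.of fun i k : Fin n => baxter η a' d' m (u k) (Polynomial.X ^ (i : ℕ))) =
      Matrix.of fun i k : Fin n => baxter η a d m (u k) (Polynomial.X ^ (i : ℕ)) := by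
    ext i k
    simp [baxter_apply, eigenval, hau, hdu]
  have key := scal_det_eq hT' hη hvac' hdual' hm' hmY hu huY hv1 hvY (by
    rw [hbv]; exact mul_ne_zero (by simp) hV0)
  have hS : scal T' (vacuum M) (vacuumDual M) m (Finset.univ.image v) =
      (-1) ^ n * ∏ i, a (mu i) := by
    rw [hvimg, scal_shift hT' hη hvac' (vacuumDual_vacuum M), hmdef, Finset.prod_image hmu.injOn]
    · rw [Finset.prod_congr rfl fun i _ => show -(a' (mu i) * d' (mu i + η)) = -1 * a (mu i) by
        rw [ham (mu i) (by simp [hmdef]), show mu i + η = v i from rfl, hdv]; ring,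
        Finset.prod_mul_distrib]
      simp
    · rw [← hvimg]; exact Finset.disjoint_left.2 hmv
    · rw [← hvimg]; intro x hx
      simp only [hY, Finset.mem_union, SetLike.mem_coe] at hx ⊢; tauto
    · intro x hx
      exact if_pos (by rw [hvimg]; exact Finset.mem_image_of_mem _ hx)
  -- Return to the original representation: the two share all vacuum eigenvalues at `mu` and `u`.
  have hSu : scal T' (vacuum M) (vacuumDual M) m (Finset.univ.image u) =
      scal T vac phi m (Finset.univ.image u) := by
    have r1 : ∀ x ∈ m ∪ Finset.univ.image u, x ∈ X ∧ x ∈ (Y : Set ℂ) ∧ a' x = a x ∧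
        d' x = d x := by
      intro x hx
      rcases Finset.mem_union.1 hx with hx | hx
      · refine ⟨?_, hmY x hx, ham x hx, hdm x hx⟩
        obtain ⟨i, -, rfl⟩ := Finset.mem_image.1 hx
        exact (hX i).2
      · obtain ⟨i, -, rfl⟩ := Finset.mem_image.1 hx
        exact ⟨(hX i).1, (huY i).1, hau i, hdu i⟩
    refine scal_eq_scal (a := a) (d := d) (X := ↑(m ∪ Finset.univ.image u)) hT' h hη
      ⟨fun x hx => ?_, fun x hx => ?_, fun x hx => ?_⟩
      ⟨fun x hx => ?_, fun x hx => ?_, fun x hx => ?_⟩ (vacuumDual_vacuum M) e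
      (Finset.disjoint_left.2 fun x hx hxu => ?_) ?_ fun x hx => hx
    · rw [hvac'.A_apply x (r1 x hx).2.1, (r1 x hx).2.2.1]
    · rw [hvac'.D_apply x (r1 x hx).2.1, (r1 x hx).2.2.2]
    · exact hvac'.C_apply x (r1 x hx).2.1
    · exact hv.A_apply x (r1 x hx).1
    · exact hv.D_apply x (r1 x hx).1
    · exact hv.C_apply x (r1 x hx).1
    · obtain ⟨i, -, rfl⟩ := Finset.mem_image.1 hxu
      exact hum i hx
    · rw [hmdef, Finset.card_image_of_injective _ hmu, Finset.card_image_of_injective _ hu]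
  rw [hbv, hbu, hS, hVv, hSu] at key
  have h0 : ((-1) ^ n * (Matrix.vandermonde mu).det) ≠ 0 := mul_ne_zero (by simp) hV0
  refine mul_right_cancel₀ h0 (key.trans ?_)
  ring

/-- Slavnov's determinant, evaluated on arbitrary polynomials. -/
theorem slavnov_polynomial (h : RTT η T) (hη : η ≠ 0) (hv : IsVacuum T a d X vac)
    (e : phi vac = 1) {n : ℕ}
    {u mu : Fin n → ℂ} (hmu : Function.Injective mu) (hu : Function.Injective u)
    (hm : OnShell η a d (Finset.univ.image mu)) (hX : ∀ i, u i ∈ X ∧ mu i ∈ X)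
    (h1 : ∀ i j, u i ≠ mu j) (h2 : ∀ i j, u i ≠ mu j + η) (h3 : ∀ i j, mu i ≠ mu j + η)
    (p : Fin n → ℂ[X]) (hp : ∀ i, (p i).degree < n) :
    (Matrix.of fun i k : Fin n => (p i).eval (u k)).det *
        scal T vac phi (Finset.univ.image mu) (Finset.univ.image u) =
      (∏ i, a (mu i)) * (Matrix.of fun i k : Fin n =>
        baxter η a d (Finset.univ.image mu) (u k) (p i)).det := by
  have hsum : ∀ i, p i = ∑ l : Fin n, (p i).coeff l • Polynomial.X ^ (l : ℕ) := by
    intro i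
    rw [Fin.sum_univ_eq_sum_range (fun l => (p i).coeff l • (Polynomial.X : ℂ[X]) ^ l)]
    have hd : (p i).natDegree < n := by
      by_cases h0 : p i = 0
      · rw [h0, natDegree_zero]; exact i.pos
      · exact (natDegree_lt_iff_degree_lt h0).2 (hp i)
    conv_lhs => rw [(p i).as_sum_range' n hd]
    simp [smul_eq_C_mul, C_mul_X_pow_eq_monomial]
  -- Passing from monomials to the `p i` multiplies both determinants by that of the coefficients,
  -- so the `p i` need not be independent.
  have e1 : (Matrix.of fun i k : Fin n => (p i).eval (u k)) =
      (Matrix.of fun i l : Fin n => (p i).coeff l) * (Matrix.vandermonde u).transpose := by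
    ext i k
    rw [Matrix.of_apply]
    conv_lhs => rw [hsum i]
    simp [Matrix.mul_apply, eval_finsetSum, Matrix.vandermonde_apply]
  have e2 : (Matrix.of fun i k : Fin n => baxter η a d (Finset.univ.image mu) (u k) (p i)) =
      (Matrix.of fun i l : Fin n => (p i).coeff l) * Matrix.of fun i k : Fin n =>
        baxter η a d (Finset.univ.image mu) (u k) (Polynomial.X ^ (i : ℕ)) := by
    ext i k
    rw [Matrix.of_apply]
    conv_lhs => rw [hsum i]
    simp only [map_sum, map_smul, Matrix.mul_apply, Matrix.of_apply, smul_eq_mul]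
  rw [e1, e2, Matrix.det_mul, Matrix.det_mul, Matrix.det_transpose, mul_assoc,
    slavnov h hη hv e hmu hu hm hX h1 h2 h3]
  ring

end Slavnov

/-! ### Reduction of the size of the determinant -/

section Reduction

open Polynomial

/-- The polynomial with simple roots at the points of a family. -/
def rootPoly {ι : Type*} (s : Finset ι) (u : ι → ℂ) : ℂ[X] := ∏ i ∈ s, (X - C (u i))

theorem rootPoly_eval {ι : Type*} (s : Finset ι) (u : ι → ℂ) (x : ℂ) :
    (rootPoly s u).eval x = ∏ i ∈ s, (x - u i) := by
  simp [rootPoly, eval_prod]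

theorem rootPoly_monic {ι : Type*} (s : Finset ι) (u : ι → ℂ) : (rootPoly s u).Monic :=
  monic_prod_of_monic _ _ fun _ _ => monic_X_sub_C _

theorem rootPoly_degree {ι : Type*} (s : Finset ι) (u : ι → ℂ) :
    (rootPoly s u).degree = s.card := by
  rw [rootPoly, degree_prod]; simp

theorem degree_sub_lt_of_monic {p q : ℂ[X]} {n : ℕ} (hp : p.Monic) (hq : q.Monic)
    (hpd : p.degree = n) (hqd : q.degree = n) : (p - q).degree < n := by
  have := degree_sub_lt_left (hpd.trans hqd.symm) hp.ne_zero (by rw [hp.leadingCoeff, hq.leadingCoeff])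
  rwa [hpd] at this

/-- Baxter's T-Q equation. It allows the Baxter polynomial to be subtracted from the test
polynomials at no cost. -/
theorem baxter_rootPoly {η : ℂ} {a d : ℂ → ℂ} {n : ℕ} {mu : Fin n → ℂ}
    (hmu : Function.Injective mu) {w : ℂ} (hw : ∀ i, w ≠ mu i) :
    baxter η a d (Finset.univ.image mu) w (rootPoly Finset.univ mu) = 0 := by
  have : ∏ i, (w - mu i) ≠ 0 := Finset.prod_ne_zero_iff.2 fun i _ => sub_ne_zero.2 (hw i)
  rw [baxter_apply, eigenval]
  simp only [rootPoly_eval, Finset.prod_image hmu.injOn]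
  rw [div_mul_cancel₀ _ this]
  ring

/-- The difference of the two monic polynomials has degree below `n`, so interpolation at the `w b`
recovers its value at `θ`. -/
theorem sum_partialFraction {n : ℕ} {mu w : Fin n → ℂ} (hw : Function.Injective w) {θ : ℂ}
    (hθ : ∀ i, θ ≠ w i) :
    ∑ b, (∏ i, (w b - mu i)) / ((w b - θ) * ∏ i ∈ Finset.univ.erase b, (w b - w i)) =
      1 - (∏ i, (θ - mu i)) / ∏ i, (θ - w i) := by
  have hW : ∏ i, (θ - w i) ≠ 0 := Finset.prod_ne_zero_iff.2 fun i _ => sub_ne_zero.2 (hθ i)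
  have h := lagrange_eval (s := Finset.univ) hw.injOn
    (p := rootPoly Finset.univ mu - rootPoly Finset.univ w)
    (degree_sub_lt_of_monic (rootPoly_monic _ _) (rootPoly_monic _ _) (rootPoly_degree _ _)
      (rootPoly_degree _ _)) θ
  simp only [eval_sub, rootPoly_eval] at h
  have h2 : 1 - (∏ i, (θ - mu i)) / ∏ i, (θ - w i) =
      -((∏ i, (θ - mu i)) - ∏ i, (θ - w i)) / ∏ i, (θ - w i) := by
    field_simp; ring
  rw [h2, ← h, ← Finset.sum_neg_distrib, Finset.sum_div]
  refine Finset.sum_congr rfl fun b _ => ?_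
  have h0 : ∏ i, (w b - w i) = 0 := Finset.prod_eq_zero (Finset.mem_univ b) (sub_self _)
  have h3 : ∏ i ∈ Finset.univ.erase b, (w b - w i) ≠ 0 :=
    Finset.prod_ne_zero_iff.2 fun i hi => sub_ne_zero.2 fun e => (Finset.ne_of_mem_erase hi)
      (hw e.symm)
  have h4 : θ - w b ≠ 0 := sub_ne_zero.2 (hθ b)
  rw [h0, sub_zero, ← Finset.mul_prod_erase _ (fun i => θ - w i) (Finset.mem_univ b)] at *
  have h5 := right_ne_zero_of_mul hW
  rw [← neg_sub θ (w b), Finset.prod_inv_distrib]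
  field_simp

theorem prod_erase_succ {R : Type*} [CommMonoid R] {n : ℕ} (b : Fin n) (f : Fin (n + 1) → R) :
    ∏ j ∈ Finset.univ.erase b.succ, f j = f 0 * ∏ j ∈ Finset.univ.erase b, f j.succ := by
  have : (Finset.univ.erase b.succ : Finset (Fin (n + 1))) =
      insert 0 ((Finset.univ.erase b).image Fin.succ) := by
    ext j
    refine Fin.cases ?_ (fun j => ?_) j
    · simp [Fin.succ_ne_zero, Ne.symm]
    · simp [Fin.succ_ne_zero]
  rw [this, Finset.prod_insert (by simp [Fin.succ_ne_zero]),
    Finset.prod_image (Fin.succ_injective n).injOn]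

/-- A rank-one perturbation of a diagonal matrix. -/
theorem det_diagonal_sub {n : ℕ} (h q : Fin n → ℂ) (hh : ∀ i, h i ≠ 0) :
    (Matrix.of fun i k => (if i = k then h k else 0) - q k).det =
      (∏ i, h i) * (1 - ∑ i, q i / h i) := by
  have e : (Matrix.of fun i k => (if i = k then h k else 0) - q k) =
      (1 + Matrix.replicateCol Unit (fun _ : Fin n => (1 : ℂ)) * Matrix.replicateRow Unit fun k => -(q k / h k)) *
        Matrix.diagonal h := by
    ext i k
    rw [Matrix.mul_diagonal, Matrix.add_apply, Matrix.one_apply]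
    have := hh k
    simp only [Matrix.of_apply, Matrix.mul_apply, Matrix.replicateCol_apply,
      Matrix.replicateRow_apply, Finset.univ_unique, Finset.sum_singleton]
    split_ifs <;> field_simp <;> ring
  rw [e, Matrix.det_mul, Matrix.det_diagonal, Matrix.det_one_add_replicateCol_mul_replicateRow,
    mul_comm]
  simp [dotProduct, sub_eq_add_neg]

variable {V : Type*} [AddCommGroup V] [Module ℂ V] {η : ℂ}
  {T : ℂ → Matrix (Fin 2) (Fin 2) (Module.End ℂ V)} {vac : V} {phi : Module.Dual ℂ V}
  {a d : ℂ → ℂ} {Y : Set ℂ}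

/-- The scalar product with a Bethe vector one of whose rapidities is a zero of `a`. -/
theorem scal_cons (h : RTT η T) (hη : η ≠ 0) (hv : IsVacuum T a d Y vac)
    (e : phi vac = 1) {N : ℕ} {mu : Fin (N + 1) → ℂ} {lam : Fin N → ℂ} {ν : ℂ}
    (hmu : Function.Injective mu) (hlam : Function.Injective lam) (hν : ∀ i, ν ≠ lam i)
    (hm : OnShell η a d (Finset.univ.image mu)) (hmX : ∀ i, mu i ∈ Y)
    (hlX : ∀ i, lam i ∈ Y) (hνX : ν ∈ Y) (ha : a ν = 0)
    (h1 : ∀ i j, lam i ≠ mu j) (h1' : ∀ j, ν ≠ mu j) (h2 : ∀ i j, lam i ≠ mu j + η)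
    (h2' : ∀ j, ν ≠ mu j + η) (h3 : ∀ i j, mu i ≠ mu j + η) (h4 : ∀ i, ν - η ≠ lam i) :
    scal T vac phi (Finset.univ.image mu) (insert ν (Finset.univ.image lam)) *
        (∏ i, (ν - η - mu i)) * ∏ b, ((lam b - (ν - η)) * (lam b - ν) *
          ∏ i ∈ Finset.univ.erase b, (lam b - lam i)) =
      (∏ i, a (mu i)) * eigenval η a d (Finset.univ.image mu) ν * (-η * ∏ b, (ν - η - lam b)) *
        (Matrix.of fun i k : Fin N => baxter η a d (Finset.univ.image mu) (lam k)
          ((X - C (ν - η)) * (X - C ν) * rootPoly (Finset.univ.erase i) lam)).det := by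
  set w : Fin (N + 1) → ℂ := Fin.cons ν lam with hwdef
  set θ := ν - η with hθdef
  have hw : Function.Injective w := Fin.cons_injective_iff.2
    ⟨fun ⟨i, hi⟩ => hν i hi.symm, hlam⟩
  have hwθ : ∀ i, θ ≠ w i := Fin.cases (by simpa [hwdef, hθdef] using hη) (by simpa [hwdef] using h4)
  have hwimg : Finset.univ.image w = insert ν (Finset.univ.image lam) := by
    ext x; simp [hwdef, Fin.exists_fin_succ, eq_comm]
  -- Each `H i` has degree `N + 1`, one too many for `slavnov_polynomial`; subtracting the monic
  -- Baxter polynomial `Q` lowers it and is invisible to the functionals.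
  set H : Fin (N + 1) → ℂ[X] := fun i => (X - C θ) * rootPoly (Finset.univ.erase i) w with hH
  have hHdeg : ∀ i, (H i).degree = (N + 1 : ℕ) := fun i => by
    rw [hH, degree_mul, rootPoly_degree, degree_X_sub_C, Finset.card_erase_of_mem
      (Finset.mem_univ i), Finset.card_univ, Fintype.card_fin, Nat.add_sub_cancel, add_comm]
    rfl
  have hHm : ∀ i, (H i).Monic := fun i => (monic_X_sub_C _).mul (rootPoly_monic _ _)
  set Q := rootPoly Finset.univ mu with hQ
  have key := slavnov_polynomial h hη hv e hmu hw hm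
    (fun i => ⟨Fin.cases hνX hlX i, hmX i⟩) (Fin.cases h1' h1) (Fin.cases h2' h2) h3
    (fun i => H i - Q) fun i => degree_sub_lt_of_monic (hHm i) (rootPoly_monic _ _) (hHdeg i)
      ((rootPoly_degree _ _).trans (by simp))
  have hHw : ∀ i k, (H i).eval (w k) = if i = k then
      (w k - θ) * ∏ j ∈ Finset.univ.erase k, (w k - w j) else 0 := by
    intro i k
    rw [hH, eval_mul, rootPoly_eval]
    split_ifs with hik
    · rw [hik]; simp
    · rw [Finset.prod_eq_zero (i := k) (by simp [Ne.symm hik]) (sub_self _), mul_zero]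
  set g : Fin (N + 1) → ℂ := fun k => (w k - θ) * ∏ j ∈ Finset.univ.erase k, (w k - w j) with hg
  have hg0 : ∀ k, g k ≠ 0 := fun k => mul_ne_zero (sub_ne_zero.2 (hwθ k).symm)
    (Finset.prod_ne_zero_iff.2 fun i hi => sub_ne_zero.2 fun e => (Finset.ne_of_mem_erase hi)
      (hw e.symm))
  -- The matrix of values is diagonal minus the rank-one part `Q (w k)`, so its determinant is
  -- explicit.
  have e1 : (Matrix.of fun i k => (H i - Q).eval (w k)).det =
      (∏ i, g i) * ((∏ i, (θ - mu i)) / ∏ i, (θ - w i)) := by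
    have := det_diagonal_sub g (fun k => ∏ i, (w k - mu i)) hg0
    rw [sum_partialFraction hw hwθ, sub_sub_cancel] at this
    rw [← this]
    congr 1
    ext i k
    rw [Matrix.of_apply, Matrix.of_apply, eval_sub, hHw, hQ, rootPoly_eval]
  have hwmu : ∀ k i, w k ≠ mu i := Fin.cases h1' h1
  have e2 : ∀ i k, baxter η a d (Finset.univ.image mu) (w k) (H i - Q) =
      baxter η a d (Finset.univ.image mu) (w k) (H i) := fun i k => by
    rw [map_sub, hQ, baxter_rootPoly hmu (hwmu k), sub_zero]
  -- In the column of `ν` the term in `a` vanishes by `ha` and the term in `d` because `H i` has the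
  -- root `θ = ν - η`. Only the eigenvalue term remains, and it is zero for `i ≠ 0`.
  have e3 : ∀ i, baxter η a d (Finset.univ.image mu) ν (H i) =
      if i = 0 then eigenval η a d (Finset.univ.image mu) ν * g 0 else 0 := by
    intro i
    have := hHw i 0
    have hθ0 : (H i).eval (ν - η) = 0 := by rw [hH, ← hθdef]; simp
    rw [baxter_apply, ha, hθ0]
    rw [show ν = w 0 from rfl, this]
    split_ifs <;> simp [hg]
  have e4 : (Matrix.of fun i k => baxter η a d (Finset.univ.image mu) (w k) (H i - Q)).det =
      eigenval η a d (Finset.univ.image mu) ν * g 0 *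
        (Matrix.of fun i k : Fin N => baxter η a d (Finset.univ.image mu) (lam k)
          (H i.succ)).det := by
    rw [Matrix.det_succ_column_zero, Finset.sum_eq_single 0]
    · simp only [Matrix.of_apply, e2, show w 0 = ν from rfl, e3]
      simp
      exact Or.inl rfl
    · intro i _ hi
      simp only [Matrix.of_apply, e2, show w 0 = ν from rfl, e3, if_neg hi]
      simp
    · simp
  rw [e1, e4, hwimg] at key
  have eH : ∀ i : Fin N, H i.succ =
      (X - C (ν - η)) * (X - C ν) * rootPoly (Finset.univ.erase i) lam := fun i => by
    simp only [hH, rootPoly, prod_erase_succ]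
    rw [← mul_assoc]
    rfl
  have eg : ∀ b : Fin N, g b.succ = (lam b - θ) * (lam b - ν) *
      ∏ i ∈ Finset.univ.erase b, (lam b - lam i) := fun b => by
    simp only [hg, prod_erase_succ]
    rw [← mul_assoc]
    rfl
  have hWθ : ∏ i, (θ - w i) ≠ 0 := Finset.prod_ne_zero_iff.2 fun i _ => sub_ne_zero.2 (hwθ i)
  have eW : ∏ i, (θ - w i) = -η * ∏ b, (θ - lam b) := by
    rw [Fin.prod_univ_succ]
    simp [hwdef, hθdef]
  simp only [eH] at key
  rw [Fin.prod_univ_succ g] at key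
  simp only [eg] at key
  rw [← eW]
  have hg00 := hg0 0
  refine mul_left_cancel₀ hg00 ?_
  have k2 := congrArg (· * ∏ i, (θ - w i)) key
  rw [mul_right_comm _ (scal _ _ _ _ _), mul_assoc (g 0 * _), div_mul_cancel₀ _ hWθ] at k2
  linear_combination k2

end Reduction

/-! ### The lattice nonlinear Schrödinger model as a chain -/

section Model

variable {M : ℕ} {c Δ : ℝ}

theorem siteZ_pos (hc : 0 < c) (hΔ : 0 < Δ) (hcΔ : c * Δ < 4) (j : Fin M) : 0 < siteZ c Δ j := by
  have := mul_pos hc hΔ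
  rw [siteZ]
  rcases neg_one_pow_eq_or ℝ ((j : ℕ) + 1) with h | h <;> rw [h] <;> linarith

theorem chi_eq_siteOp (j : Fin M) :
    chi Δ j = siteOp j Nat.pred fun n => ((Real.sqrt (Δ * n) : ℝ) : ℂ) := rfl

theorem chiStar_eq_siteOp (j : Fin M) :
    chiStar Δ j = siteOp j Nat.succ fun n => ((Real.sqrt (Δ * (n + 1)) : ℝ) : ℂ) := rfl

theorem rho_eq_siteOp (j : Fin M) :
    rho c Δ j = siteOp j id fun n => ((Real.sqrt (siteZ c Δ j + c * (Δ * n) / 4) : ℝ) : ℂ) := by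
  refine Finsupp.lhom_ext fun k z => ?_
  simp [rho, siteOp]

theorem chiStar_mul_chi (hΔ : 0 < Δ) (j : Fin M) :
    chiStar Δ j * chi Δ j = siteOp j id fun n => (Δ : ℂ) * n := by
  rw [chi_eq_siteOp, chiStar_eq_siteOp, siteOp_mul]
  refine siteOp_congr j (fun n => ?_) fun n hn => ?_
  · rcases n with _ | n
    · simp
    · rw [Nat.pred_succ, ← Complex.ofReal_mul, Nat.cast_succ,
        Real.mul_self_sqrt (by positivity)]
      push_cast
      ring
  · rcases n with _ | n
    · simp at hn
    · rfl

/-- The weight of the entry `B` of the Lax matrix. -/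
def weightB (c Δ : ℝ) {M : ℕ} (j : Fin M) (n : ℕ) : ℂ :=
  -(Complex.I * (Real.sqrt c : ℝ)) *
    ((Real.sqrt (Δ * (n + 1)) * Real.sqrt (siteZ c Δ j + c * (Δ * n) / 4) : ℝ) : ℂ)

/-- The weight of the entry `C` of the Lax matrix. -/
def weightC (c Δ : ℝ) {M : ℕ} (j : Fin M) (n : ℕ) : ℂ :=
  Complex.I * (Real.sqrt c : ℝ) *
    ((Real.sqrt (Δ * n) * Real.sqrt (siteZ c Δ j + c * (Δ * (n - 1 : ℕ)) / 4) : ℝ) : ℂ)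

theorem weightC_zero (j : Fin M) : weightC c Δ j 0 = 0 := by simp [weightC]

theorem weightC_succ (j : Fin M) (n : ℕ) : weightC c Δ j (n + 1) = conj (weightB c Δ j n) := by
  rw [weightC, weightB, map_mul, map_neg, map_mul, Complex.conj_I, Complex.conj_ofReal,
    Complex.conj_ofReal, Nat.add_sub_cancel]
  push_cast
  ring

theorem lax_eq_siteLax (hΔ : 0 < Δ) (j : Fin M) (x : ℂ) :
    lax c Δ j x = siteLax (-(Complex.I * Δ / 2)) (c * Δ / 2) (siteZ c Δ j) (siteZ c Δ j)
      (weightB c Δ j) (weightC c Δ j) j x := by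
  rw [lax, siteLax, chiStar_mul_chi hΔ, one_eq_siteOp j, siteOp_smul, siteOp_smul, siteOp_smul,
    siteOp_add, siteOp_add, rho_eq_siteOp, chi_eq_siteOp, chiStar_eq_siteOp, siteOp_mul,
    siteOp_mul, siteOp_smul, siteOp_smul]
  have h00 : (siteOp j id fun n => (-(Complex.I * x * Δ / 2) + siteZ c Δ j) * 1 +
      (c : ℂ) / 2 * (Δ * n)) = siteOp j id fun n : ℕ =>
      -(Complex.I * Δ / 2) * x + siteZ c Δ j + c * Δ / 2 * n :=
    siteOp_congr j (fun n => by ring) fun _ _ => rfl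
  have h11 : (siteOp j id fun n => (Complex.I * x * Δ / 2 + siteZ c Δ j) * 1 +
      (c : ℂ) / 2 * (Δ * n)) = siteOp j id fun n : ℕ =>
      -(-(Complex.I * Δ / 2) * x) + siteZ c Δ j + c * Δ / 2 * n :=
    siteOp_congr j (fun n => by ring) fun _ _ => rfl
  rw [h00, h11]
  have h01 : (siteOp j (Nat.succ ∘ id) fun n => -(Complex.I * (Real.sqrt c : ℝ)) *
      (((Real.sqrt (siteZ c Δ j + c * (Δ * n) / 4) : ℝ) : ℂ) *
        ((Real.sqrt (Δ * ((id n : ℕ) + 1)) : ℝ) : ℂ))) = siteOp j Nat.succ (weightB c Δ j) :=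
    siteOp_congr j (fun n => by rw [weightB, id]; push_cast; ring) fun _ _ => rfl
  have h10 : (siteOp j (id ∘ Nat.pred) fun n => Complex.I * (Real.sqrt c : ℝ) *
      (((Real.sqrt (Δ * n) : ℝ) : ℂ) *
        ((Real.sqrt (siteZ c Δ j + c * (Δ * (n.pred : ℕ)) / 4) : ℝ) : ℂ))) =
      siteOp j Nat.pred (weightC c Δ j) :=
    siteOp_congr j (fun n => by rw [weightC, Nat.pred_eq_sub_one]; push_cast; ring) fun _ _ => rfl
  rw [h01, h10]

/-- Here `s = -iΔ/2` and `η = ic`, so `η s = cΔ/2` is the coefficient of `n`. The condition on the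
weights uses that the radicand of `rho` is nonnegative. -/
theorem rtt_lax (hc : 0 < c) (hΔ : 0 < Δ) (hcΔ : c * Δ < 4) (j : Fin M) :
    RTT (Complex.I * c) (lax c Δ j) := by
  rw [show lax c Δ j = _ from funext (lax_eq_siteLax hΔ j)]
  refine rtt_siteLax ?_ (weightC_zero j) (fun n => ?_) j
  · linear_combination ((c : ℂ) * Δ / 2) * Complex.I_mul_I
  · have hZ := siteZ_pos hc hΔ hcΔ j
    have h1 : 0 ≤ Δ * ((n : ℝ) + 1) := by positivity
    have h2 : 0 ≤ siteZ c Δ j + c * (Δ * n) / 4 := by positivity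
    have e1 : ((Real.sqrt c : ℝ) : ℂ) * (Real.sqrt c : ℝ) = c := by
      rw [← Complex.ofReal_mul, Real.mul_self_sqrt hc.le]
    have e2 : ((Real.sqrt (Δ * ((n : ℝ) + 1)) : ℝ) : ℂ) * (Real.sqrt (Δ * ((n : ℝ) + 1)) : ℝ) =
        Δ * (n + 1) := by
      rw [← Complex.ofReal_mul, Real.mul_self_sqrt h1]; push_cast; ring
    have e3 : ((Real.sqrt (siteZ c Δ j + c * (Δ * n) / 4) : ℝ) : ℂ) *
        (Real.sqrt (siteZ c Δ j + c * (Δ * n) / 4) : ℝ) = siteZ c Δ j + c * (Δ * n) / 4 := by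
      rw [← Complex.ofReal_mul, Real.mul_self_sqrt h2]; push_cast; ring
    rw [weightB, weightC, Nat.add_sub_cancel]
    push_cast
    generalize ((Real.sqrt c : ℝ) : ℂ) = A at e1 ⊢
    generalize ((Real.sqrt (Δ * ((n : ℝ) + 1)) : ℝ) : ℂ) = B at e2 ⊢
    generalize ((Real.sqrt (siteZ c Δ j + c * (Δ * n) / 4) : ℝ) : ℂ) = C at e3 ⊢
    calc _ = -(Complex.I * Complex.I) * (A * A) * (B * B) * (C * C) := by ring
      _ = _ := by rw [Complex.I_mul_I, e1, e2, e3]; ring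

theorem lax_commute (hΔ : 0 < Δ) (j j' : Fin M) (h : j ≠ j') (x y : ℂ) (i k i' k' : Fin 2) :
    Commute (lax c Δ j x i k) (lax c Δ j' y i' k') := by
  rw [lax_eq_siteLax hΔ, lax_eq_siteLax hΔ]
  exact siteLax_commute h x y i k i' k'

theorem monodromy_eq_chainT (c Δ : ℝ) (M : ℕ) :
    monodromy c Δ M = chainT (lax c Δ) (List.ofFn (Fin.rev : Fin M → Fin M)) := by
  funext x
  rw [monodromy, chainT, List.map_ofFn]
  rfl

theorem nodup_ofFn_rev (M : ℕ) : (List.ofFn (Fin.rev : Fin M → Fin M)).Nodup :=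
  List.nodup_ofFn.2 Fin.rev_injective

theorem rtt_monodromy (hc : 0 < c) (hΔ : 0 < Δ) (hcΔ : c * Δ < 4) (M : ℕ) :
    RTT (Complex.I * c) (monodromy c Δ M) := by
  rw [monodromy_eq_chainT]
  exact rtt_chainT (rtt_lax hc hΔ hcΔ) (lax_commute hΔ) (nodup_ofFn_rev M)

theorem prod_siteZ (z : ℂ) (m : ℕ) : ∏ j : Fin (m + m), (z + siteZ c Δ j) =
    (z + 1 + c * Δ / 4) ^ m * (z + 1 - c * Δ / 4) ^ m := by
  simp only [siteZ]
  rw [Fin.prod_univ_eq_prod_range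
    (fun j : ℕ => z + ((1 + (-1) ^ (j + 1) * (c * Δ / 4) : ℝ) : ℂ)) (m + m)]
  induction m with
  | zero => simp
  | succ m ih =>
    have e : m + 1 + (m + 1) = m + m + 1 + 1 := by ring
    have h1 : (-1 : ℝ) ^ (m + m + 1) = -1 := Odd.neg_one_pow ⟨m, by ring⟩
    have h2 : (-1 : ℝ) ^ (m + m + 1 + 1) = 1 := Even.neg_one_pow ⟨m + 1, by ring⟩
    rw [e, Finset.prod_range_succ, Finset.prod_range_succ, ih, h1, h2]
    push_cast
    ring

theorem prod_vacA (hM : Even M) (x : ℂ) :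
    ((List.ofFn (Fin.rev : Fin M → Fin M)).map fun j =>
      -(Complex.I * Δ / 2) * x + siteZ c Δ j).prod = vacA c Δ M x := by
  rw [List.map_ofFn, List.prod_ofFn]
  have := Equiv.prod_comp Fin.revPerm (fun j : Fin M => -(Complex.I * Δ / 2) * x + siteZ c Δ j)
  refine this.trans ?_
  obtain ⟨m, rfl⟩ := hM
  rw [prod_siteZ, vacA, show (m + m) / 2 = m by omega]
  ring

theorem prod_vacD (hM : Even M) (x : ℂ) :
    ((List.ofFn (Fin.rev : Fin M → Fin M)).map fun j =>
      -(-(Complex.I * Δ / 2) * x) + siteZ c Δ j).prod = vacD c Δ M x := by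
  rw [List.map_ofFn, List.prod_ofFn]
  have := Equiv.prod_comp Fin.revPerm (fun j : Fin M => -(-(Complex.I * Δ / 2) * x) + siteZ c Δ j)
  refine this.trans ?_
  obtain ⟨m, rfl⟩ := hM
  rw [prod_siteZ, vacD, show (m + m) / 2 = m by omega]
  ring

theorem isVacuum_monodromy (hΔ : 0 < Δ) (hM : Even M) :
    IsVacuum (monodromy c Δ M) (vacA c Δ M) (vacD c Δ M) Set.univ (vacuum M) := by
  rw [monodromy_eq_chainT, ← funext (prod_vacA hM), ← funext (prod_vacD hM)]
  refine IsVacuum.chainT (fun j => ?_) (lax_commute hΔ) (nodup_ofFn_rev M)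
  rw [show lax c Δ j = _ from funext (lax_eq_siteLax hΔ j)]
  exact isVacuum_siteLax (weightC_zero j) j _

theorem isVacuum_dual_monodromy (hΔ : 0 < Δ) (hM : Even M) :
    IsVacuum (dualT (monodromy c Δ M)) (vacA c Δ M) (vacD c Δ M) Set.univ (vacuumDual M) := by
  rw [monodromy_eq_chainT, ← funext (prod_vacA hM), ← funext (prod_vacD hM)]
  refine IsVacuum.dual_chainT (fun j => ?_) (lax_commute hΔ) (nodup_ofFn_rev M)
  rw [show lax c Δ j = _ from funext (lax_eq_siteLax hΔ j)]
  exact isVacuum_dual_siteLax j _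

/-! ### Adjoints -/

theorem braket_single (k : Fin M → ℕ) (z : ℂ) (v : Fock M) :
    braket (Finsupp.single k z) v = conj z * v k := by
  simp [braket]

theorem braket_zero_left (v : Fock M) : braket 0 v = 0 := by simp [braket]

theorem braket_add_left (u u' v : Fock M) : braket (u + u') v = braket u v + braket u' v :=
  Finsupp.sum_add_index' (by simp) (by intros; rw [map_add, add_mul])

theorem braket_add_right (u v v' : Fock M) : braket u (v + v') = braket u v + braket u v' := by
  simp [braket, mul_add, Finsupp.sum_add]

/-- `g` is the adjoint of `f`. -/
def IsAdj (f g : Module.End ℂ (Fock M)) : Prop := ∀ u v, braket (f u) v = braket u (g v)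

theorem IsAdj.mul {f g f' g' : Module.End ℂ (Fock M)} (h : IsAdj f g) (h' : IsAdj f' g') :
    IsAdj (f * f') (g' * g) := fun u v => by
  rw [Module.End.mul_apply, h, h', Module.End.mul_apply]

theorem IsAdj.add {f g f' g' : Module.End ℂ (Fock M)} (h : IsAdj f g) (h' : IsAdj f' g') :
    IsAdj (f + f') (g + g') := fun u v => by
  rw [LinearMap.add_apply, LinearMap.add_apply, braket_add_left, braket_add_right, h, h']

theorem isAdj_of_single {f g : Module.End ℂ (Fock M)}
    (h : ∀ k z k' z', braket (f (Finsupp.single k z)) (Finsupp.single k' z') =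
      braket (Finsupp.single k z) (g (Finsupp.single k' z'))) : IsAdj f g := by
  intro u v
  induction u using Finsupp.induction_linear with
  | zero => simp [braket_zero_left]
  | add u u' hu hu' => rw [map_add, braket_add_left, braket_add_left, hu, hu']
  | single k z =>
    induction v using Finsupp.induction_linear with
    | zero => rw [map_zero]; simp [braket]
    | add v v' hv hv' => rw [map_add, braket_add_right, braket_add_right, hv, hv']
    | single k' z' => exact h k z k' z'

theorem isAdj_siteOp_id (j : Fin M) (w : ℕ → ℂ) :
    IsAdj (siteOp j id w) (siteOp j id fun n => conj (w n)) := by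
  refine isAdj_of_single fun k z k' z' => ?_
  rw [siteOp_single, siteOp_single, braket_single, braket_single]
  simp only [id, Function.update_eq_self, Finsupp.single_apply, map_mul]
  split_ifs with h
  · rw [h]; ring
  · simp

theorem update_succ_eq_iff (j : Fin M) (k k' : Fin M → ℕ) :
    k' = Function.update k j (k j + 1) ↔ Function.update k' j (k' j - 1) = k ∧ k' j ≠ 0 := by
  constructor
  · rintro rfl; simp
  · rintro ⟨rfl, h⟩
    simp [Nat.sub_add_cancel (Nat.pos_of_ne_zero h)]

theorem isAdj_siteOp_succ (j : Fin M) {β γ : ℕ → ℂ} (h0 : γ 0 = 0)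
    (h : ∀ n, γ (n + 1) = conj (β n)) : IsAdj (siteOp j Nat.succ β) (siteOp j Nat.pred γ) := by
  refine isAdj_of_single fun k z k' z' => ?_
  rw [siteOp_single, siteOp_single, braket_single, braket_single]
  simp only [Finsupp.single_apply, map_mul, Nat.succ_eq_add_one, Nat.pred_eq_sub_one]
  by_cases h1 : k' j = 0
  · rw [if_neg, h1, h0]
    · simp
    · intro e; exact ((update_succ_eq_iff j k k').1 e).2 h1
  · by_cases h2 : k' = Function.update k j (k j + 1)
    · rw [if_pos h2, if_pos ((update_succ_eq_iff j k k').1 h2).1, h2]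
      simp [h]; ring
    · rw [if_neg h2, if_neg fun e => h2 ((update_succ_eq_iff j k k').2 ⟨e, h1⟩)]
      simp

theorem isAdj_siteOp_pred (j : Fin M) {β γ : ℕ → ℂ} (h0 : γ 0 = 0)
    (h : ∀ n, γ (n + 1) = conj (β n)) : IsAdj (siteOp j Nat.pred γ) (siteOp j Nat.succ β) := by
  refine isAdj_of_single fun k z k' z' => ?_
  rw [siteOp_single, siteOp_single, braket_single, braket_single]
  simp only [Finsupp.single_apply, map_mul, Nat.succ_eq_add_one, Nat.pred_eq_sub_one]
  by_cases h1 : k j = 0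
  · have h2 : Function.update k' j (k' j + 1) ≠ k := fun e =>
      ((update_succ_eq_iff j k' k).1 e.symm).2 h1
    rw [if_neg h2, h1, h0]
    simp
  · by_cases h2 : k = Function.update k' j (k' j + 1)
    · rw [if_pos h2.symm, if_pos ((update_succ_eq_iff j k' k).1 h2).1.symm, h2]
      simp [h]; ring
    · rw [if_neg (Ne.symm h2), if_neg fun e => h2 ((update_succ_eq_iff j k' k).2 ⟨e.symm, h1⟩)]
      simp

/-- `A` and `D` differ by the sign of `iλΔ/2`, which conjugation reverses, and the weight of `C` is
conjugate to that of `B`. -/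
theorem isAdj_lax (hΔ : 0 < Δ) (j : Fin M) (x : ℂ) (i k : Fin 2) :
    IsAdj (lax c Δ j x i k) (lax c Δ j (conj x) i.rev k.rev) := by
  rw [lax_eq_siteLax hΔ, lax_eq_siteLax hΔ]
  fin_cases i <;> fin_cases k <;>
    simp only [Fin.zero_eta, Fin.mk_one, show Fin.rev (0 : Fin 2) = 1 from rfl,
      show Fin.rev (1 : Fin 2) = 0 from rfl, siteLax_zero_zero, siteLax_zero_one, siteLax_one_zero,
      siteLax_one_one]
  · convert isAdj_siteOp_id j _ using 3
    simp [map_ofNat (starRingEnd ℂ) 2, neg_div]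
  · exact isAdj_siteOp_succ j (weightC_zero j) (weightC_succ j)
  · exact isAdj_siteOp_pred j (weightC_zero j) (weightC_succ j)
  · convert isAdj_siteOp_id j _ using 3
    simp [map_ofNat (starRingEnd ℂ) 2, neg_div]

theorem isAdj_one : IsAdj (1 : Module.End ℂ (Fock M)) 1 := fun _ _ => rfl

theorem isAdj_zero : IsAdj (0 : Module.End ℂ (Fock M)) 0 := fun _ v => by
  simp [braket]

theorem isAdj_chainT (hΔ : 0 < Δ) (x : ℂ) {l : List (Fin M)} (hl : l.Nodup) (i k : Fin 2) :
    IsAdj (chainT (lax c Δ) l x i k) (chainT (lax c Δ) l (conj x) i.rev k.rev) := by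
  induction l generalizing i k with
  | nil =>
    simp only [chainT, List.map_nil, List.prod_nil, Matrix.one_apply, Fin.rev_inj]
    split_ifs
    exacts [isAdj_one, isAdj_zero]
  | cons j l ih =>
    rw [List.nodup_cons] at hl
    -- Taking adjoints reverses the order of the sites; commutation between different sites restores
    -- it.
    have hcomm : ∀ p, chainT (lax c Δ) l (conj x) (Fin.rev p) k.rev *
        lax c Δ j (conj x) i.rev (Fin.rev p) = lax c Δ j (conj x) i.rev (Fin.rev p) *
          chainT (lax c Δ) l (conj x) (Fin.rev p) k.rev := fun p =>
      (commute_chainT (fun j' hj' a b => lax_commute hΔ j j' (fun e => hl.1 (e ▸ hj')) _ _ _ _ _ _)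
        _ _).symm.eq
    rw [chainT_cons, chainT_cons, Matrix.mul_apply, Matrix.mul_apply, Fin.sum_univ_two,
      Fin.sum_univ_two, add_comm (lax c Δ j (conj x) i.rev 0 * _)]
    have h0 := (isAdj_lax (c := c) hΔ j x i 0).mul (ih hl.2 0 k)
    have h1 := (isAdj_lax (c := c) hΔ j x i 1).mul (ih hl.2 1 k)
    rw [hcomm] at h0 h1
    exact h0.add h1

theorem betheVector_eq_bethe (hc : 0 < c) (hΔ : 0 < Δ) (hcΔ : c * Δ < 4) {N : ℕ} {x : Fin N → ℝ}
    (hx : Function.Injective x) : betheVector c Δ M x =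
      bethe (monodromy c Δ M) (vacuum M) (Finset.univ.image fun i => (x i : ℂ)) := by
  induction N with
  | zero => simp [betheVector]
  | succ N ih =>
    have e : (Finset.univ.image fun i => (x i : ℂ)) =
        insert (x 0 : ℂ) (Finset.univ.image fun i : Fin N => (x i.succ : ℂ)) := by
      ext y; simp [Fin.exists_fin_succ, eq_comm]
    rw [e, bethe_insert (rtt_monodromy hc hΔ hcΔ M) (by simp [hc.ne']), ←
      ih (x := fun i => x i.succ) fun i j h => Fin.succ_injective _ (hx h)]
    · rw [betheVector, List.ofFn_succ, List.prod_cons]; rfl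
    · simp only [Finset.mem_image, Finset.mem_univ, true_and, not_exists]
      intro i h
      exact absurd (hx (Complex.ofReal_injective h)) (Fin.succ_ne_zero i)

theorem braket_vacuum (v : Fock M) : braket (vacuum M) v = vacuumDual M v := by
  rw [vacuum, braket_single]; simp [vacuumDual]

/-- For real rapidities the adjoint of `B(x)` is `C(x)`, so the bra is the Bethe vector of the dual
representation. -/
theorem braket_betheVector (hc : 0 < c) (hΔ : 0 < Δ) (hcΔ : c * Δ < 4) {N : ℕ} {x : Fin N → ℝ}
    (hx : Function.Injective x) (v : Fock M) : braket (betheVector c Δ M x) v =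
      bethe (dualT (monodromy c Δ M)) (vacuumDual M) (Finset.univ.image fun i => (x i : ℂ)) v := by
  induction N generalizing v with
  | zero => simp [betheVector, braket_vacuum]
  | succ N ih =>
    have e : (Finset.univ.image fun i => (x i : ℂ)) =
        insert (x 0 : ℂ) (Finset.univ.image fun i : Fin N => (x i.succ : ℂ)) := by
      ext y; simp [Fin.exists_fin_succ, eq_comm]
    rw [e, bethe_insert (rtt_monodromy hc hΔ hcΔ M).dual (by simp [hc.ne']), dualT_apply, ←
      ih (x := fun i => x i.succ) fun i j h => Fin.succ_injective _ (hx h)]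
    · rw [betheVector, List.ofFn_succ, List.prod_cons]
      have := isAdj_chainT (c := c) hΔ (x 0) (nodup_ofFn_rev M) 0 1
      rw [← monodromy_eq_chainT, Complex.conj_ofReal] at this
      exact this _ _
    · simp only [Finset.mem_image, Finset.mem_univ, true_and, not_exists]
      intro i h
      exact absurd (hx (Complex.ofReal_injective h)) (Fin.succ_ne_zero i)

end Model

/-! ### Invertibility of the transfer matrix at the special point -/

section Unit

/-- Off the diagonal `f` strictly lowers the height `h`. In a vector of the kernel the coefficient
at a support point of maximal height cannot be cancelled; surjectivity follows by induction on the
height. -/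
theorem isUnit_of_triangular {σ : Type*} (f : Module.End ℂ (σ →₀ ℂ)) (h : σ → ℕ) (D e : σ → ℂ)
    (s : σ → σ) (hf : ∀ k, f (Finsupp.single k 1) =
      D k • Finsupp.single k 1 + e k • Finsupp.single (s k) 1)
    (hD : ∀ k, D k ≠ 0) (he : ∀ k, e k ≠ 0 → h (s k) < h k) : IsUnit f := by
  classical
  rw [Module.End.isUnit_iff]
  constructor
  · rw [injective_iff_map_eq_zero]
    intro v hv
    by_contra hne
    obtain ⟨k, hk, hmax⟩ := v.support.exists_max_image h (Finsupp.support_nonempty_iff.2 hne)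
    have h1 : f v = v.sum fun k' z => z • (D k' • Finsupp.single k' (1 : ℂ) +
        e k' • Finsupp.single (s k') 1) := by
      conv_lhs => rw [← Finsupp.sum_single v]
      rw [Finsupp.sum, map_sum]
      refine Finset.sum_congr rfl fun k' _ => ?_
      show f (Finsupp.single k' (v k')) = v k' • (D k' • Finsupp.single k' (1 : ℂ) +
        e k' • Finsupp.single (s k') 1)
      rw [← hf, ← map_smul, Finsupp.smul_single_one]
    have h2 := DFunLike.congr_fun (h1.symm.trans hv) k
    rw [Finsupp.sum, Finsupp.finsetSum_apply, Finset.sum_eq_single k] at h2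
    · have : e k * (Finsupp.single (s k) (1 : ℂ)) k = 0 := by
        by_cases h0 : e k = 0
        · rw [h0, zero_mul]
        · rw [Finsupp.single_eq_of_ne, mul_zero]
          intro hs
          have := he k h0
          rw [← hs] at this
          exact lt_irrefl _ this
      simp only [Finsupp.smul_apply, Finsupp.add_apply, smul_eq_mul, this, Finsupp.single_eq_same,
        add_zero, mul_one, Finsupp.zero_apply] at h2
      exact (mul_ne_zero (Finsupp.mem_support_iff.1 hk) (hD k)) h2
    · intro k' hk' hkk'
      have : e k' * (Finsupp.single (s k') (1 : ℂ)) k = 0 := by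
        by_cases h0 : e k' = 0
        · rw [h0, zero_mul]
        · rw [Finsupp.single_eq_of_ne, mul_zero]
          intro hs
          have := he k' h0
          rw [← hs] at this
          exact absurd (hmax k' hk') (not_le.2 this)
      rw [Finsupp.smul_apply, Finsupp.add_apply, Finsupp.smul_apply, Finsupp.smul_apply,
        Finsupp.single_eq_of_ne hkk'.symm, smul_eq_mul (e k'), this, smul_zero, zero_add, smul_zero]
    · intro hk'; exact absurd hk hk'
  · have key : ∀ n k, h k < n → Finsupp.single k (1 : ℂ) ∈ LinearMap.range f := by
      intro n
      induction n with
      | zero => intro k hk; exact absurd hk (Nat.not_lt_zero _)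
      | succ n ih =>
        intro k hk
        have h1 : e k • Finsupp.single (s k) (1 : ℂ) ∈ LinearMap.range f := by
          by_cases h0 : e k = 0
          · rw [h0, zero_smul]; exact zero_mem _
          · exact Submodule.smul_mem _ _ (ih _ (by have := he k h0; omega))
        have h2 : D k • Finsupp.single k (1 : ℂ) ∈ LinearMap.range f := by
          have := sub_mem (LinearMap.mem_range_self f (Finsupp.single k 1)) h1
          rwa [hf, add_sub_cancel_right] at this
        have := Submodule.smul_mem _ (D k)⁻¹ h2
        rwa [smul_smul, inv_mul_cancel₀ (hD k), one_smul] at this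
    intro v
    have : v ∈ LinearMap.range f := by
      rw [← Finsupp.sum_single v]
      refine sum_mem fun k _ => ?_
      rw [← Finsupp.smul_single_one]
      exact Submodule.smul_mem _ _ (key _ k (Nat.lt_succ_self _))
    exact this

/-- The product `L (n - 1) ⋯ L 0`. -/
def descProd {R : Type*} [Monoid R] (L : ℕ → R) : ℕ → R
  | 0 => 1
  | n + 1 => L n * descProd L n

theorem prod_ofFn_rev {R : Type*} [Monoid R] (L : ℕ → R) (n : ℕ) :
    (List.ofFn fun j : Fin n => L j.rev).prod = descProd L n := by
  induction n with
  | zero => simp [descProd]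
  | succ n ih =>
    rw [List.ofFn_succ, List.prod_cons, descProd, ← ih]
    simp

/-- A chain of Lax matrices of rank one, with alternating operator orderings, is a product of
operators attached to its links. -/
theorem descProd_factor {R : Type*} [Ring R] (P Q : ℕ → Fin 2 → R)
    (L : ℕ → Matrix (Fin 2) (Fin 2) R) (M : ℕ)
    (hPP : ∀ i j, i < M → j < M → i ≠ j → ∀ a b, Commute (P i a) (P j b))
    (hPQ : ∀ i j, i < M → j < M → i ≠ j → ∀ a b, Commute (P i a) (Q j b))
    (hQQ : ∀ i j, i < M → j < M → i ≠ j → ∀ a b, Commute (Q i a) (Q j b))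
    (heven : ∀ t, 2 * t < M → ∀ a b, L (2 * t) a b = 2 * (P (2 * t) a * Q (2 * t) b))
    (hodd : ∀ t, 2 * t + 1 < M → ∀ a b, L (2 * t + 1) a b =
      2 * (Q (2 * t + 1) b * P (2 * t + 1) a))
    (hlink : ∀ i j, i < M → j < M → i ≠ j → IsUnit (∑ m, Q j m * P i m)) (h2 : IsUnit (2 : R))
    (t : ℕ) (ht : 2 * (t + 1) ≤ M) :
    ∃ U, IsUnit U ∧ (∀ z, (∀ j < 2 * (t + 1), ∀ a, Commute z (P j a) ∧ Commute z (Q j a)) →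
        Commute z U) ∧
      ∀ a b, descProd L (2 * (t + 1)) a b = U * (P (2 * t + 1) a * Q 0 b) := by
  have h4 : IsUnit (4 : R) := by
    have := h2.mul h2
    norm_num at this
    exact this
  have hz4 : ∀ z : R, Commute z 4 := fun z => Nat.commute_cast z 4
  have hz2 : ∀ z : R, Commute z 2 := fun z => Nat.commute_cast z 2
  have h22 : ∀ z : R, 2 * (2 * z) = 4 * z := fun z => by rw [← mul_assoc]; norm_num
  induction t with
  | zero =>
    refine ⟨4 * ∑ m, Q 1 m * P 0 m, h4.mul (hlink 0 1 (by omega) (by omega) (by omega)),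
      fun z hz => (hz4 z).mul_right (Commute.sum_right _ _ _ fun m _ =>
        (hz 1 (by omega) m).2.mul_right (hz 0 (by omega) m).1), fun a b => ?_⟩
    have e0 := heven 0 (by omega)
    have e1 := hodd 0 (by omega)
    simp only [mul_zero, zero_add] at e0 e1
    have hc : ∀ m, Commute (P 1 a) (P 0 m) := fun m => hPP 1 0 (by omega) (by omega) (by omega) a m
    simp only [zero_add, mul_one, mul_zero, descProd, Matrix.mul_apply, e0, e1, Fin.sum_univ_two,
      mul_add, add_mul, mul_assoc, (hz2 _).left_comm, h22, (hc _).left_comm]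
  | succ t ih =>
    obtain ⟨U, hU, hUc, hUe⟩ := ih (by omega)
    -- Two more sites add two links. Operators on the same site are never interchanged: the
    -- alternating orderings already put each `P` and `Q` in the right relative position. The
    -- commutation clause on `U` lets `P` and `Q` of new sites pass it.
    refine ⟨4 * ((∑ m, Q (2 * t + 3) m * P (2 * t + 2) m) * (U *
        ∑ m, Q (2 * t + 2) m * P (2 * t + 1) m)),
      h4.mul ((hlink _ _ (by omega) (by omega) (by omega)).mul
        (hU.mul (hlink _ _ (by omega) (by omega) (by omega)))), fun z hz => ?_, fun a b => ?_⟩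
    · refine (hz4 z).mul_right (Commute.mul_right (Commute.sum_right _ _ _ fun m _ =>
        (hz _ (by omega) m).2.mul_right (hz _ (by omega) m).1) (Commute.mul_right
        (hUc z fun j hj => hz j (by omega)) (Commute.sum_right _ _ _ fun m _ =>
        (hz _ (by omega) m).2.mul_right (hz _ (by omega) m).1)))
    have e0 := heven (t + 1) (by omega)
    have e1 := hodd (t + 1) (by omega)
    simp only [show 2 * (t + 1) = 2 * t + 2 by ring, show 2 * t + 2 + 1 = 2 * t + 3 by ring]
      at e0 e1 hUe
    have c1 : ∀ m, Commute (P (2 * t + 3) a) (P (2 * t + 2) m) := fun m =>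
      hPP _ _ (by omega) (by omega) (by omega) a m
    have c2 : ∀ m, Commute (P (2 * t + 3) a) (Q (2 * t + 2) m) := fun m =>
      hPQ _ _ (by omega) (by omega) (by omega) a m
    have c3 : Commute (P (2 * t + 3) a) U := hUc _ fun j hj m =>
      ⟨hPP _ _ (by omega) (by omega) (by omega) a m, hPQ _ _ (by omega) (by omega) (by omega) a m⟩
    have c4 : ∀ m, Commute (P (2 * t + 3) a) (P (2 * t + 1) m) := fun m =>
      hPP _ _ (by omega) (by omega) (by omega) a m
    have c5 : ∀ m, Commute (Q (2 * t + 2) m) U := fun m => hUc _ fun j hj m' =>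
      ⟨(hPQ _ _ (by omega) (by omega) (by omega) m' m).symm,
        hQQ _ _ (by omega) (by omega) (by omega) m m'⟩
    rw [show 2 * (t + 1 + 1) = 2 * t + 3 + 1 by ring, descProd, descProd,
      show 2 * (t + 1) + 1 = 2 * t + 3 by ring]
    simp only [Matrix.mul_apply, e0, e1, hUe, Fin.sum_univ_two, mul_add, add_mul, mul_assoc,
      (hz2 _).left_comm, h22, (c1 _).left_comm, (c2 _).left_comm, c3.left_comm, (c4 _).left_comm,
      (c5 _).left_comm]
    abel

end Unit

/-! ### Rank-one Lax matrices at ν and the product over links -/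

section Transfer

variable {M : ℕ} {c Δ : ℝ}

/-- The diagonal weight of the factors of the Lax matrix at the special point. -/
def factorDiag (c Δ : ℝ) (i n : ℕ) : ℝ :=
  Real.sqrt ((if Even i then 1 - c * Δ / 4 else 1) + c * Δ / 4 * n)

/-- The left factor of the Lax matrix at the special point. -/
def factorP (c Δ : ℝ) (j : Fin M) : Fin 2 → Module.End ℂ (Fock M) :=
  ![siteOp j Nat.succ fun n => -(Complex.I * (Real.sqrt c : ℝ)) / 2 *
      (Real.sqrt (Δ * (n + 1)) : ℝ),
    siteOp j id fun n => (factorDiag c Δ j n : ℂ)]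

/-- The right factor of the Lax matrix at the special point. -/
def factorQ (c Δ : ℝ) (j : Fin M) : Fin 2 → Module.End ℂ (Fock M) :=
  ![siteOp j Nat.pred fun n => Complex.I * (Real.sqrt c : ℝ) / 2 * (Real.sqrt (Δ * n) : ℝ),
    siteOp j id fun n => (factorDiag c Δ j n : ℂ)]

theorem factorP_zero (j : Fin M) : factorP c Δ j 0 = siteOp j Nat.succ fun n =>
    -(Complex.I * (Real.sqrt c : ℝ)) / 2 * (Real.sqrt (Δ * (n + 1)) : ℝ) := rfl

theorem factorP_one (j : Fin M) :
    factorP c Δ j 1 = siteOp j id fun n => (factorDiag c Δ j n : ℂ) := rfl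

theorem factorQ_zero (j : Fin M) : factorQ c Δ j 0 = siteOp j Nat.pred fun n =>
    Complex.I * (Real.sqrt c : ℝ) / 2 * (Real.sqrt (Δ * n) : ℝ) := rfl

theorem factorQ_one (j : Fin M) :
    factorQ c Δ j 1 = siteOp j id fun n => (factorDiag c Δ j n : ℂ) := rfl

theorem factorP_eq_siteOp (j : Fin M) (a : Fin 2) : ∃ e w, factorP c Δ j a = siteOp j e w := by
  fin_cases a
  exacts [⟨_, _, factorP_zero j⟩, ⟨_, _, factorP_one j⟩]

theorem factorQ_eq_siteOp (j : Fin M) (a : Fin 2) : ∃ e w, factorQ c Δ j a = siteOp j e w := by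
  fin_cases a
  exacts [⟨_, _, factorQ_zero j⟩, ⟨_, _, factorQ_one j⟩]

theorem factorDiag_arg_pos (hc : 0 < c) (hΔ : 0 < Δ) (hcΔ : c * Δ < 4) (i n : ℕ) :
    0 < (if Even i then 1 - c * Δ / 4 else 1) + c * Δ / 4 * n := by
  have : 0 ≤ c * Δ / 4 * n := by positivity
  split_ifs <;> linarith

/-- The term `m = 1` is diagonal with positive entries, while `m = 0` moves a quantum from `j` to
`i`: the sum is triangular for the occupation of `j`. -/
theorem isUnit_link (hc : 0 < c) (hΔ : 0 < Δ) (hcΔ : c * Δ < 4) {i j : Fin M} (hij : i ≠ j) :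
    IsUnit (∑ m, factorQ c Δ j m * factorP c Δ i m) := by
  refine isUnit_of_triangular _ (fun k => k j)
    (fun k => (factorDiag c Δ i (k i) : ℂ) * factorDiag c Δ j (k j))
    (fun k => (-(Complex.I * (Real.sqrt c : ℝ)) / 2 * (Real.sqrt (Δ * (k i + 1)) : ℝ)) *
      (Complex.I * (Real.sqrt c : ℝ) / 2 * (Real.sqrt (Δ * k j) : ℝ)))
    (fun k => Function.update (Function.update k i (k i + 1)) j (k j - 1)) (fun k => ?_)
    (fun k => ?_) fun k hk => ?_
  · rw [Fin.sum_univ_two, LinearMap.add_apply, add_comm]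
    simp only [factorP, factorQ, Matrix.cons_val_zero, Matrix.cons_val_one, Module.End.mul_apply,
      siteOp_single, one_mul, Function.update_of_ne hij.symm, id, Function.update_eq_self,
      Finsupp.smul_single_one, Nat.succ_eq_add_one, Nat.pred_eq_sub_one]
  · refine mul_ne_zero ?_ ?_ <;>
    exact_mod_cast (Real.sqrt_pos.2 (factorDiag_arg_pos hc hΔ hcΔ _ _)).ne'
  · have : k j ≠ 0 := by
      rintro h; rw [h] at hk; simp at hk
    simp only [Function.update_self]
    omega

theorem factorDiag_mul_self (hc : 0 < c) (hΔ : 0 < Δ) (hcΔ : c * Δ < 4) (i n : ℕ) :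
    (factorDiag c Δ i n : ℂ) * factorDiag c Δ i n =
      (if Even i then 1 - c * Δ / 4 else 1 : ℂ) + c * Δ / 4 * n := by
  rw [← Complex.ofReal_mul, factorDiag, Real.mul_self_sqrt (factorDiag_arg_pos hc hΔ hcΔ i n).le]
  split_ifs <;> push_cast <;> ring

theorem ofReal_sqrt_mul_self {x : ℝ} (hx : 0 ≤ x) :
    ((Real.sqrt x : ℝ) : ℂ) * (Real.sqrt x : ℝ) = x := by
  rw [← Complex.ofReal_mul, Real.mul_self_sqrt hx]

theorem nu_mul (hΔ : 0 < Δ) : -(Complex.I * Δ / 2) * nu c Δ = -1 + c * Δ / 4 := by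
  have : (Δ : ℂ) ≠ 0 := by exact_mod_cast hΔ.ne'
  rw [nu]
  field_simp
  linear_combination (16 - 4 * (c : ℂ) * Δ) * Complex.I_sq

theorem two_mul_siteOp (j : Fin M) (e : ℕ → ℕ) (w : ℕ → ℂ) :
    2 * siteOp j e w = siteOp j e fun n => 2 * w n := by
  rw [two_mul, ← two_smul ℂ, siteOp_smul]

/-- By `nu_mul`, with `Z = 1 - cΔ/4` the entry `A` becomes `(c/2) χ*χ` and the entry `D` becomes
`2ρ²`, so the matrix is a column times a row, in normal order. -/
theorem lax_nu_even (hc : 0 < c) (hΔ : 0 < Δ) (hcΔ : c * Δ < 4) (j : Fin M)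
    (hj : Even (j : ℕ)) (a b : Fin 2) :
    lax c Δ j (nu c Δ) a b = 2 * (factorP c Δ j a * factorQ c Δ j b) := by
  have hZ : siteZ c Δ j = 1 - c * Δ / 4 := by rw [siteZ, hj.add_one.neg_one_pow]; ring
  have hd := factorDiag_mul_self hc hΔ hcΔ j
  simp only [if_pos hj] at hd
  have hs := ofReal_sqrt_mul_self hc.le
  rw [lax_eq_siteLax hΔ]
  fin_cases a <;> fin_cases b <;>
    simp only [Fin.zero_eta, Fin.mk_one, siteLax_zero_zero, siteLax_zero_one, siteLax_one_zero,
      siteLax_one_one, factorP_zero, factorP_one, factorQ_zero, factorQ_one, siteOp_mul,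
      two_mul_siteOp, nu_mul hΔ]
  · refine siteOp_congr j (fun n => ?_) fun n hn => ?_
    · rcases n with _ | n
      · simp [hZ]
      · have h1 := ofReal_sqrt_mul_self (x := Δ * ((n : ℝ) + 1)) (by positivity)
        rw [Nat.pred_succ, Nat.cast_succ, hZ]
        push_cast at h1 ⊢
        generalize ((Real.sqrt (Δ * ((n : ℝ) + 1)) : ℝ) : ℂ) = S at h1 ⊢
        generalize ((Real.sqrt c : ℝ) : ℂ) = C at hs ⊢
        linear_combination 1 / 2 * (C * C * (S * S) * Complex.I_mul_I - S * S * hs - c * h1)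
    · rcases n with _ | n
      · simp [hZ] at hn
      · rfl
  · refine siteOp_congr j (fun n => ?_) fun n hn => rfl
    rw [weightB, factorDiag, if_pos hj, hZ, show c * (Δ * n) / 4 = c * Δ / 4 * (n : ℝ) by ring]
    simp only [id]
    push_cast
    ring
  · refine siteOp_congr j (fun n => ?_) fun n hn => rfl
    rw [weightC, factorDiag, if_pos hj, hZ, Nat.pred_eq_sub_one,
      show c * (Δ * ((n - 1 : ℕ) : ℝ)) / 4 = c * Δ / 4 * ((n - 1 : ℕ) : ℝ) by ring]
    push_cast
    ring
  · refine siteOp_congr j (fun n => ?_) fun n hn => rfl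
    rw [id, hd, hZ]
    push_cast
    ring

/-- With `Z = 1 + cΔ/4` the entry `A` is `(c/2) χχ*` instead, which forces the opposite ordering.
The diagonal weight then has constant term `1`, since it is evaluated after `χ*` has raised `n` by
one. -/
theorem lax_nu_odd (hc : 0 < c) (hΔ : 0 < Δ) (hcΔ : c * Δ < 4) (j : Fin M)
    (hj : ¬ Even (j : ℕ)) (a b : Fin 2) :
    lax c Δ j (nu c Δ) a b = 2 * (factorQ c Δ j b * factorP c Δ j a) := by
  have hZ : siteZ c Δ j = 1 + c * Δ / 4 := by
    rw [siteZ, (Nat.not_even_iff_odd.1 hj).add_one.neg_one_pow]; ring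
  have hd := factorDiag_mul_self hc hΔ hcΔ j
  simp only [if_neg hj] at hd
  have hs := ofReal_sqrt_mul_self hc.le
  rw [lax_eq_siteLax hΔ]
  fin_cases a <;> fin_cases b <;>
    simp only [Fin.zero_eta, Fin.mk_one, siteLax_zero_zero, siteLax_zero_one, siteLax_one_zero,
      siteLax_one_one, factorP_zero, factorP_one, factorQ_zero, factorQ_one, siteOp_mul,
      two_mul_siteOp, nu_mul hΔ]
  · refine siteOp_congr j (fun n => ?_) fun n hn => rfl
    have h1 := ofReal_sqrt_mul_self (x := Δ * ((n : ℝ) + 1)) (by positivity)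
    rw [Nat.succ_eq_add_one, Nat.cast_succ, hZ]
    push_cast at h1 ⊢
    generalize ((Real.sqrt (Δ * ((n : ℝ) + 1)) : ℝ) : ℂ) = S at h1 ⊢
    generalize ((Real.sqrt c : ℝ) : ℂ) = C at hs ⊢
    linear_combination 1 / 2 * (C * C * (S * S) * Complex.I_mul_I - S * S * hs - c * h1)
  · refine siteOp_congr j (fun n => ?_) fun n hn => rfl
    rw [weightB, factorDiag, if_neg hj, hZ, Nat.succ_eq_add_one, Nat.cast_succ,
      show 1 + c * Δ / 4 + c * (Δ * n) / 4 = 1 + c * Δ / 4 * ((n : ℝ) + 1) by ring]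
    push_cast
    ring
  · refine siteOp_congr j (fun n => ?_) fun n hn => rfl
    rcases n with _ | n
    · simp [weightC_zero]
    · rw [weightC, factorDiag, if_neg hj, hZ, Nat.add_sub_cancel, id, Nat.cast_succ,
        show 1 + c * Δ / 4 + c * (Δ * n) / 4 = 1 + c * Δ / 4 * ((n : ℝ) + 1) by ring]
      push_cast
      ring
  · refine siteOp_congr j (fun n => ?_) fun n hn => rfl
    rw [id, hd, hZ]
    push_cast
    ring

theorem isUnit_transfer (hc : 0 < c) (hΔ : 0 < Δ) (hcΔ : c * Δ < 4) (hM : Even M) (hM0 : 0 < M) :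
    IsUnit (transfer c Δ M (nu c Δ)) := by
  obtain ⟨t, rfl⟩ : ∃ t, M = 2 * (t + 1) := by
    obtain ⟨m, rfl⟩ := hM
    exact ⟨m - 1, by omega⟩
  set M := 2 * (t + 1) with hMt
  let P : ℕ → Fin 2 → Module.End ℂ (Fock M) := fun i =>
    if h : i < M then factorP c Δ ⟨i, h⟩ else 0
  let Q : ℕ → Fin 2 → Module.End ℂ (Fock M) := fun i =>
    if h : i < M then factorQ c Δ ⟨i, h⟩ else 0
  let L : ℕ → Matrix (Fin 2) (Fin 2) (Module.End ℂ (Fock M)) := fun i =>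
    if h : i < M then lax c Δ ⟨i, h⟩ (nu c Δ) else 1
  have hP : ∀ i (h : i < M), P i = factorP c Δ ⟨i, h⟩ := fun i h => dif_pos h
  have hQ : ∀ i (h : i < M), Q i = factorQ c Δ ⟨i, h⟩ := fun i h => dif_pos h
  have hL : ∀ i (h : i < M), L i = lax c Δ ⟨i, h⟩ (nu c Δ) := fun i h => dif_pos h
  have hne : ∀ {i j} (hi : i < M) (hj : j < M), i ≠ j → (⟨i, hi⟩ : Fin M) ≠ ⟨j, hj⟩ :=
    fun hi hj h e => h (congrArg Fin.val e)
  have hlink : ∀ i j, i < M → j < M → i ≠ j → IsUnit (∑ m, Q j m * P i m) := by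
    intro i j hi hj h
    rw [hP i hi, hQ j hj]
    exact isUnit_link hc hΔ hcΔ (hne hi hj h)
  have h2 : IsUnit (2 : Module.End ℂ (Fock M)) := by
    have := (IsUnit.mk0 (2 : ℂ) two_ne_zero).map (algebraMap ℂ (Module.End ℂ (Fock M)))
    rwa [map_ofNat] at this
  obtain ⟨U, hU, -, hUe⟩ := descProd_factor P Q L M
    (fun i j hi hj h a b => by
      obtain ⟨e, w, h1⟩ := factorP_eq_siteOp (c := c) (Δ := Δ) ⟨i, hi⟩ a
      obtain ⟨e', w', h2⟩ := factorP_eq_siteOp (c := c) (Δ := Δ) ⟨j, hj⟩ b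
      rw [hP i hi, hP j hj, h1, h2]
      exact siteOp_commute (hne hi hj h) _ _ _ _)
    (fun i j hi hj h a b => by
      obtain ⟨e, w, h1⟩ := factorP_eq_siteOp (c := c) (Δ := Δ) ⟨i, hi⟩ a
      obtain ⟨e', w', h2⟩ := factorQ_eq_siteOp (c := c) (Δ := Δ) ⟨j, hj⟩ b
      rw [hP i hi, hQ j hj, h1, h2]
      exact siteOp_commute (hne hi hj h) _ _ _ _)
    (fun i j hi hj h a b => by
      obtain ⟨e, w, h1⟩ := factorQ_eq_siteOp (c := c) (Δ := Δ) ⟨i, hi⟩ a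
      obtain ⟨e', w', h2⟩ := factorQ_eq_siteOp (c := c) (Δ := Δ) ⟨j, hj⟩ b
      rw [hQ i hi, hQ j hj, h1, h2]
      exact siteOp_commute (hne hi hj h) _ _ _ _)
    (fun i hi a b => by
      rw [hL _ hi, hP _ hi, hQ _ hi]
      exact lax_nu_even hc hΔ hcΔ _ (even_two_mul i) a b)
    (fun i hi a b => by
      rw [hL _ hi, hP _ hi, hQ _ hi]
      exact lax_nu_odd hc hΔ hcΔ _ (by simp) a b)
    hlink h2 t hMt.ge
  have hmon : monodromy c Δ M (nu c Δ) = descProd L M := by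
    rw [← prod_ofFn_rev, monodromy]
    congr 2
    funext j
    exact (hL _ j.rev.isLt).symm
  -- The trace contracts the two free ends, and the link between the last site and the first closes
  -- the ring.
  have htr : transfer c Δ M (nu c Δ) = U * ∑ m, Q 0 m * P (2 * t + 1) m := by
    rw [transfer, hmon, Matrix.trace, Finset.mul_sum]
    refine Finset.sum_congr rfl fun m _ => ?_
    rw [Matrix.diag_apply, hUe]
    obtain ⟨e, w, h1⟩ := factorP_eq_siteOp (c := c) (Δ := Δ) (M := M) ⟨2 * t + 1, by omega⟩ m
    obtain ⟨e', w', h2⟩ := factorQ_eq_siteOp (c := c) (Δ := Δ) (M := M) ⟨0, hM0⟩ m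
    rw [hP (2 * t + 1) (by omega), hQ 0 hM0, h1, h2,
      (siteOp_commute (hne (by omega) hM0 (by omega)) e e' w w').eq]
  rw [htr]
  exact hU.mul (hlink _ _ (by omega) (by omega) (by omega))

end Transfer

/-! ### The Lieb kernel and the vacuum eigenvalues near the special point -/

section Analysis

variable {M : ℕ} {c Δ : ℝ}

theorem ofReal_add_I_mul_ne_zero (x : ℝ) {s : ℝ} (hs : s ≠ 0) : (x : ℂ) + Complex.I * s ≠ 0 := by
  intro e
  have := congrArg Complex.im e
  simp at this
  exact hs this

theorem lieb_ofReal (hc : 0 < c) (x : ℝ) :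
    lieb c x = Complex.I * (1 / (x + Complex.I * c) - 1 / (x - Complex.I * c)) := by
  have h1 : (x : ℂ) + Complex.I * c ≠ 0 := ofReal_add_I_mul_ne_zero x hc.ne'
  have h2 : (x : ℂ) - Complex.I * c ≠ 0 := by
    have := ofReal_add_I_mul_ne_zero x (neg_ne_zero.2 hc.ne')
    push_cast at this
    rwa [mul_neg, ← sub_eq_add_neg] at this
  have h3 : Complex.I * c - x ≠ 0 := by rw [← neg_sub]; exact neg_ne_zero.2 h2
  have h1' : Complex.I * c + x ≠ 0 := by rwa [add_comm]
  -- The argument of the logarithm avoids the branch cut: it is `1` at `x = 0` and has nonzero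
  -- imaginary part otherwise.
  have hslit : (Complex.I * c + x) / (Complex.I * c - x) ∈ Complex.slitPlane := by
    have hn : 0 < c ^ 2 + x ^ 2 := by positivity
    have e : (Complex.I * c + x) / (Complex.I * c - x) =
        (((c ^ 2 - x ^ 2) / (c ^ 2 + x ^ 2) : ℝ) : ℂ) +
          ((-(2 * c * x) / (c ^ 2 + x ^ 2) : ℝ) : ℂ) * Complex.I := by
      have hn' : (c : ℂ) ^ 2 + (x : ℂ) ^ 2 ≠ 0 := by exact_mod_cast hn.ne'
      push_cast
      rw [div_eq_iff h3]
      field_simp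
      linear_combination (2 * (c : ℂ) ^ 2 * x) * Complex.I_sq
    rw [Complex.mem_slitPlane_iff, e]
    by_cases hx : x = 0
    · left; simp [hx, hc.ne']
    · right
      simp only [Complex.add_im, Complex.ofReal_im, Complex.im_ofReal_mul,
        Complex.I_im, mul_one, zero_add]
      exact div_ne_zero (neg_ne_zero.2 (mul_ne_zero (by positivity) hx)) hn.ne'
  have hd : HasDerivAt (fun z : ℂ => (Complex.I * c + z) / (Complex.I * c - z))
      ((1 * (Complex.I * c - x) - (Complex.I * c + x) * (-1)) / (Complex.I * c - x) ^ 2) (x : ℂ) :=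
    ((hasDerivAt_id (x : ℂ)).const_add _).div ((hasDerivAt_id (x : ℂ)).const_sub _) h3
  have := ((hd.clog hslit).const_mul Complex.I).deriv
  rw [lieb, show theta c = fun z => Complex.I *
    Complex.log ((Complex.I * c + z) / (Complex.I * c - z)) from rfl, this]
  field_simp
  ring

theorem nu_eq (c Δ : ℝ) : nu c Δ = Complex.I * ((-(2 / Δ) + c / 2 : ℝ) : ℂ) := by
  rw [nu]; push_cast; ring

/-- Both `ν` and `ν - ic` lie in the open lower half-plane, hence differ from every real rapidity.
-/
theorem nu_im_neg (hΔ : 0 < Δ) (hcΔ : c * Δ < 4) : -(2 / Δ) + c / 2 < 0 := by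
  rw [neg_add_lt_iff_lt_add, add_zero, div_lt_div_iff₀ two_pos hΔ]
  linarith

theorem vacA_ne_zero (hc : 0 < c) (hΔ : 0 < Δ) (hcΔ : c * Δ < 4) (x : ℝ) :
    vacA c Δ M x ≠ 0 := by
  have := mul_pos hc hΔ
  refine mul_ne_zero (pow_ne_zero _ fun e => ?_) (pow_ne_zero _ fun e => ?_) <;>
  · have := congrArg Complex.re e
    simp at this
    linarith

theorem vacA_nu (hΔ : 0 < Δ) (hM : Even M) (hM0 : 0 < M) : vacA c Δ M (nu c Δ) = 0 := by
  have h := nu_mul (c := c) hΔ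
  rw [vacA, show -(Complex.I * nu c Δ * Δ / 2) + 1 - c * Δ / 4 = 0 by linear_combination h,
    zero_pow, mul_zero]
  obtain ⟨m, rfl⟩ := hM
  omega

/-- Together with `vacA_nu` this makes the eigenvalue of `τ(ν)` nonzero. -/
theorem vacD_nu_ne_zero (hΔ : 0 < Δ) (hcΔ : c * Δ < 4) : vacD c Δ M (nu c Δ) ≠ 0 := by
  have h := nu_mul (c := c) hΔ
  have h1 : Complex.I * nu c Δ * Δ / 2 + 1 + c * Δ / 4 = 2 := by linear_combination -h
  have h2 : Complex.I * nu c Δ * Δ / 2 + 1 - c * Δ / 4 = ((2 - c * Δ / 2 : ℝ) : ℂ) := by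
    push_cast; linear_combination -h
  rw [vacD, h1, h2]
  refine mul_ne_zero (pow_ne_zero _ two_ne_zero) (pow_ne_zero _ ?_)
  have : (0 : ℝ) < 2 - c * Δ / 2 := by linarith
  exact_mod_cast this.ne'

end Analysis

/-! ### Consequences of the Bethe equations -/

section BetheEquations

variable {M : ℕ} {c Δ : ℝ}

theorem prod_neg_fin {n : ℕ} (f : Fin n → ℂ) : ∏ i, -f i = (-1) ^ n * ∏ i, f i := by
  rw [Finset.prod_neg, Finset.card_univ, Fintype.card_fin]

theorem sub_add_ne_zero (hc : 0 < c) (x y : ℝ) : (x : ℂ) + Complex.I * c - y ≠ 0 := by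
  have := ofReal_add_I_mul_ne_zero (x - y) hc.ne'
  push_cast at this
  rwa [sub_add_eq_add_sub] at this

theorem sub_sub_ne_zero (hc : 0 < c) (x y : ℝ) : (x : ℂ) - Complex.I * c - y ≠ 0 := by
  have := neg_ne_zero.2 (sub_add_ne_zero hc y x)
  rwa [show -((y : ℂ) + Complex.I * c - x) = (x : ℂ) - Complex.I * c - y by ring] at this

/-- The factors `i = r`, absent from the Bethe equations, are `ic` and `-ic`; they supply the
relative sign. -/
theorem IsBetheSolution.onShell (hc : 0 < c) (hΔ : 0 < Δ) (hcΔ : c * Δ < 4) {n : ℕ}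
    {x : Fin n → ℝ} (h : IsBetheSolution c Δ M x) (r : Fin n) :
    vacA c Δ M (x r) * ∏ i, ((x r : ℂ) + Complex.I * c - x i) +
      vacD c Δ M (x r) * ∏ i, ((x r : ℂ) - Complex.I * c - x i) = 0 := by
  have e := h.equation r
  have h0 : ∏ p ∈ Finset.univ.erase r, ((x r : ℂ) - Complex.I * c - x p) ≠ 0 :=
    Finset.prod_ne_zero_iff.2 fun p _ => sub_sub_ne_zero hc _ _
  simp only [sub_add_eq_add_sub, sub_right_comm _ (x _ : ℂ) (Complex.I * c)] at e
  rw [Finset.prod_div_distrib, div_eq_div_iff (vacA_ne_zero hc hΔ hcΔ _) h0] at e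
  rw [← Finset.mul_prod_erase _ _ (Finset.mem_univ r),
    ← Finset.mul_prod_erase _ (fun i => (x r : ℂ) - Complex.I * c - x i) (Finset.mem_univ r)]
  linear_combination -(Complex.I * c) * e

/-- In the product of all Bethe equations the double products agree after transposing the indices,
and the sign is `(-1) ^ (n (n + 1)) = 1`. This trades the `a(μ)` of Slavnov's formula for `d(μ)`. -/
theorem IsBetheSolution.prod_vacA (hc : 0 < c) (hΔ : 0 < Δ) (hcΔ : c * Δ < 4) {n : ℕ}
    {x : Fin n → ℝ} (h : IsBetheSolution c Δ M x) :
    ∏ r, vacA c Δ M (x r) = ∏ r, vacD c Δ M (x r) := by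
  have e : ∀ r, vacD c Δ M (x r) * ∏ i, ((x r : ℂ) - Complex.I * c - x i) =
      (-1) ^ (n + 1) * vacA c Δ M (x r) * ∏ i, ((x i : ℂ) - Complex.I * c - x r) := by
    intro r
    have h1 : ∏ i, ((x i : ℂ) - Complex.I * c - x r) =
        (-1) ^ n * ∏ i, ((x r : ℂ) + Complex.I * c - x i) := by
      rw [← prod_neg_fin]
      exact Finset.prod_congr rfl fun i _ => by ring
    have h2 : ((-1 : ℂ)) ^ (n + 1) * (-1) ^ n = -1 := by
      rw [← pow_add]; exact Odd.neg_one_pow ⟨n, by ring⟩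
    rw [h1]
    linear_combination h.onShell hc hΔ hcΔ r -
      vacA c Δ M (x r) * (∏ i, ((x r : ℂ) + Complex.I * c - x i)) * h2
  have e' := Finset.prod_congr (rfl : (Finset.univ : Finset (Fin n)) = _) fun r _ => e r
  rw [Finset.prod_mul_distrib, Finset.prod_mul_distrib, Finset.prod_mul_distrib,
    Finset.prod_const, Finset.card_univ, Fintype.card_fin, ← pow_mul,
    Even.neg_one_pow (by rw [mul_comm]; exact Nat.even_mul_succ_self n), one_mul] at e'
  rw [Finset.prod_comm] at e'
  refine (mul_right_cancel₀ ?_ e').symm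
  exact Finset.prod_ne_zero_iff.2 fun r _ => Finset.prod_ne_zero_iff.2 fun i _ =>
    sub_sub_ne_zero hc _ _

theorem expShift_mul (hc : 0 < c) {N : ℕ} (mu : Fin (N + 1) → ℝ) (lam : Fin N → ℝ) (w : ℝ) :
    expShift c mu lam w * ((∏ i, ((w : ℂ) + Complex.I * c - mu i)) *
      ∏ i, ((w : ℂ) - Complex.I * c - lam i)) =
    (∏ i, ((w : ℂ) - Complex.I * c - mu i)) * ∏ i, ((w : ℂ) + Complex.I * c - lam i) := by
  have h1 : ∀ i, ((mu i : ℂ) - w + Complex.I * c) / ((mu i : ℂ) - w - Complex.I * c) =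
      ((w : ℂ) - Complex.I * c - mu i) / ((w : ℂ) + Complex.I * c - mu i) := fun i => by
    rw [← neg_div_neg_eq]; congr 1 <;> ring
  have h2 : ∀ i, ((lam i : ℂ) - w - Complex.I * c) / ((lam i : ℂ) - w + Complex.I * c) =
      ((w : ℂ) + Complex.I * c - lam i) / ((w : ℂ) - Complex.I * c - lam i) := fun i => by
    rw [← neg_div_neg_eq]; congr 1 <;> ring
  have h3 : ∏ i, ((w : ℂ) + Complex.I * c - mu i) ≠ 0 :=
    Finset.prod_ne_zero_iff.2 fun i _ => sub_add_ne_zero hc _ _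
  have h4 : ∏ i, ((w : ℂ) - Complex.I * c - lam i) ≠ 0 :=
    Finset.prod_ne_zero_iff.2 fun i _ => sub_sub_ne_zero hc _ _
  simp only [expShift, h1, h2, Finset.prod_div_distrib]
  field_simp

/-- At a common rapidity both systems determine the same ratio `d / a`; equating the two expressions
says that `expShift` is `1` there. -/
theorem IsBetheSolution.ne_of_expShift (hc : 0 < c) (hΔ : 0 < Δ) (hcΔ : c * Δ < 4) {N : ℕ}
    {mu : Fin (N + 1) → ℝ} {lam : Fin N → ℝ} (hmu : IsBetheSolution c Δ M mu)
    (hlam : IsBetheSolution c Δ M lam) {k : Fin N} (hk : expShift c mu lam (lam k) ≠ 1)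
    (a : Fin (N + 1)) : lam k ≠ mu a := by
  intro e
  have h1 := hmu.onShell hc hΔ hcΔ a
  have h2 := hlam.onShell hc hΔ hcΔ k
  rw [← e] at h1
  have h3 := expShift_mul hc mu lam (lam k)
  have h4 := vacA_ne_zero (M := M) hc hΔ hcΔ (lam k)
  have h5 : (∏ i, ((lam k : ℂ) + Complex.I * c - mu i)) *
      ∏ i, ((lam k : ℂ) - Complex.I * c - lam i) ≠ 0 :=
    mul_ne_zero (Finset.prod_ne_zero_iff.2 fun i _ => sub_add_ne_zero hc _ _)
      (Finset.prod_ne_zero_iff.2 fun i _ => sub_sub_ne_zero hc _ _)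
  refine hk (mul_right_cancel₀ h5 (h3.trans (mul_left_cancel₀ h4 ?_)))
  linear_combination (∏ i, ((lam k : ℂ) - Complex.I * c - mu i)) * h2 -
    (∏ i, ((lam k : ℂ) - Complex.I * c - lam i)) * h1

end BetheEquations

/-! ### Entries of the reduced determinant and the kernel -/

section Determinant

-- The Bethe equation for `lam k` eliminates `d (lam k)`, leaving `a (lam k)` times a difference of
-- two simple poles; the eigenvalue contributes only on the diagonal.
open Polynomial in
theorem baxter_rootPoly_erase {N : ℕ} {η ν : ℂ} {a d : ℂ → ℂ} {m : Finset ℂ} {lam : Fin N → ℂ}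
    (hp : ∀ i k, lam k + η - lam i ≠ 0) (hm : ∀ i k, lam k - η - lam i ≠ 0) {k : Fin N}
    (hk : a (lam k) * ∏ i, (lam k + η - lam i) + d (lam k) * ∏ i, (lam k - η - lam i) = 0)
    (i : Fin N) :
    baxter η a d m (lam k) ((X - C (ν - η)) * (X - C ν) * rootPoly (Finset.univ.erase i) lam) =
      (if i = k then eigenval η a d m (lam k) * ((lam i - (ν - η)) * (lam i - ν) *
        ∏ b ∈ Finset.univ.erase i, (lam i - lam b)) else 0) -
      a (lam k) * (∏ b, (lam k + η - lam b)) *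
        ((lam k - ν + 2 * η) * (lam k - ν + η) / (lam k + η - lam i) -
          (lam k - ν) * (lam k - ν - η) / (lam k - η - lam i)) := by
  have e0 : eval (lam k) ((X - C (ν - η)) * (X - C ν) * rootPoly (Finset.univ.erase i) lam) =
      if i = k then (lam i - (ν - η)) * (lam i - ν) *
        ∏ b ∈ Finset.univ.erase i, (lam i - lam b) else 0 := by
    rw [eval_mul, rootPoly_eval]
    split_ifs with h
    · rw [h]; simp
    · rw [Finset.prod_eq_zero (i := k) (by simp [Ne.symm h]) (sub_self _), mul_zero]
  rw [baxter_apply, e0]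
  simp only [eval_mul, eval_sub, eval_X, eval_C, rootPoly_eval]
  rw [← Finset.mul_prod_erase _ _ (Finset.mem_univ i),
    ← Finset.mul_prod_erase _ (fun b => lam k - η - lam b) (Finset.mem_univ i)] at hk
  rw [← Finset.mul_prod_erase _ (fun b => lam k + η - lam b) (Finset.mem_univ i)]
  generalize ∏ b ∈ Finset.univ.erase i, (lam k + η - lam b) = P at hk ⊢
  generalize ∏ b ∈ Finset.univ.erase i, (lam k - η - lam b) = P' at hk ⊢
  have h1 := hp i k
  have h2 := hm i k
  have e1 : d (lam k) * P' =
      -(a (lam k) * ((lam k + η - lam i) * P)) / (lam k - η - lam i) := by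
    rw [eq_div_iff h2]; linear_combination hk
  rw [mul_ite, mul_zero]
  rw [show d (lam k) * ((lam k - η - (ν - η)) * (lam k - η - ν) * P') =
    (lam k - η - (ν - η)) * (lam k - η - ν) * (d (lam k) * P') by ring, e1]
  field_simp
  ring

/-- Conjugation by a diagonal matrix does not change the determinant. It moves to the rows a factor
which Slavnov's entries carry on the columns. -/
theorem det_of_scaling {N : ℕ} {t h L : Fin N → ℂ} (ht : ∀ i, t i ≠ 0)
    {A B : Matrix (Fin N) (Fin N) ℂ} (hA : ∀ i k, t i * A i k = h i * (L k * t k) * B i k) :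
    A.det = (∏ i, h i) * (∏ i, L i) * B.det := by
  have e : Matrix.diagonal t * A = Matrix.diagonal h * B * Matrix.diagonal fun k => L k * t k := by
    ext i k
    rw [Matrix.diagonal_mul, Matrix.mul_diagonal, Matrix.diagonal_mul, hA]
    ring
  have e' := congrArg Matrix.det e
  rw [Matrix.det_mul, Matrix.det_mul, Matrix.det_mul, Matrix.det_diagonal, Matrix.det_diagonal,
    Matrix.det_diagonal, Finset.prod_mul_distrib] at e'
  refine mul_left_cancel₀ (Finset.prod_ne_zero_iff.2 fun i _ => ht i) (e'.trans ?_)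
  ring

/-- By `lieb_ofReal` the kernel is rational. The factors `x - ν` and `y - ν + ic` are absorbed in
`det_baxter` by the diagonal normalization and by the conjugation. -/
theorem liebMod_eq {c : ℝ} (hc : 0 < c) {x y : ℝ} {ν : ℂ} (hx : (x : ℂ) - ν ≠ 0)
    (hx' : (x : ℂ) - ν + Complex.I * c ≠ 0) (hy : (y : ℂ) - ν + Complex.I * c ≠ 0) :
    ((y : ℂ) - ν + 2 * (Complex.I * c)) * (y - ν + Complex.I * c) / (y + Complex.I * c - x) -
      (y - ν) * (y - ν - Complex.I * c) / (y - Complex.I * c - x) =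
    (x - ν) * (y - ν + Complex.I * c) * (-Complex.I * liebMod c x y ν) := by
  have h1 := sub_add_ne_zero hc y x
  have h2 := sub_sub_ne_zero hc y x
  have hl := lieb_ofReal hc (x - y)
  push_cast at hl
  rw [liebMod, hl]
  have h3 : (x : ℂ) - y + Complex.I * c ≠ 0 := by
    rw [show (x : ℂ) - y + Complex.I * c = -(y - Complex.I * c - x) by ring]
    exact neg_ne_zero.2 h2
  have h4 : (x : ℂ) - y - Complex.I * c ≠ 0 := by
    rw [show (x : ℂ) - y - Complex.I * c = -(y + Complex.I * c - x) by ring]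
    exact neg_ne_zero.2 h1
  have h5 : ν - x ≠ 0 := by rw [← neg_sub]; exact neg_ne_zero.2 hx
  have h6 : ν - y - Complex.I * c ≠ 0 := by
    rw [show ν - y - Complex.I * c = -(y - ν + Complex.I * c) by ring]
    exact neg_ne_zero.2 hy
  have e : -Complex.I * ((ν - x - Complex.I * c) / (ν - x) *
      (Complex.I * (1 / ((x : ℂ) - y + Complex.I * c) - 1 / (x - y - Complex.I * c)) -
        Complex.I * (1 - (ν - y + Complex.I * c) / (ν - y - Complex.I * c)) *
          (1 / (x - y + Complex.I * c) - 1 / (x - ν + Complex.I * c)))) =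
      (ν - x - Complex.I * c) / (ν - x) *
      ((1 / ((x : ℂ) - y + Complex.I * c) - 1 / (x - y - Complex.I * c)) -
        (1 - (ν - y + Complex.I * c) / (ν - y - Complex.I * c)) *
          (1 / (x - y + Complex.I * c) - 1 / (x - ν + Complex.I * c))) := by
    linear_combination (-((ν - x - Complex.I * c) / (ν - x) *
      ((1 / ((x : ℂ) - y + Complex.I * c) - 1 / (x - y - Complex.I * c)) -
        (1 - (ν - y + Complex.I * c) / (ν - y - Complex.I * c)) *
          (1 / (x - y + Complex.I * c) - 1 / (x - ν + Complex.I * c))))) * Complex.I_mul_I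
  rw [e]
  generalize Complex.I * (c : ℂ) = η at *
  field_simp
  ring

end Determinant

/-! ### The form factor up to prefactors -/

section FormFactor

variable {M N : ℕ} {c Δ : ℝ} {mu : Fin (N + 1) → ℝ} {lam : Fin N → ℝ}

theorem nu_add_ne {s : ℝ} (hs : -(2 / Δ) + c / 2 + s ≠ 0) (x : ℝ) :
    nu c Δ + Complex.I * s ≠ x := by
  intro e
  rw [nu_eq] at e
  have := congrArg Complex.im e
  simp at this
  exact hs this

theorem injective_ofReal_comp {n : ℕ} {x : Fin n → ℝ} (hx : Function.Injective x) :
    Function.Injective fun i => (x i : ℂ) := fun _ _ h => hx (Complex.ofReal_injective h)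

/-- The eigenvalue of the transfer matrix on the eigenvector with rapidities `μ`, at `λ_k`. -/
def eigenvalAt (c Δ : ℝ) (M : ℕ) (mu : Fin (N + 1) → ℝ) (w : ℂ) : ℂ :=
  eigenval (Complex.I * c) (vacA c Δ M) (vacD c Δ M) (Finset.univ.image fun i => (mu i : ℂ)) w

theorem eigenvalAt_eq (hmu : Function.Injective mu) (w : ℂ) : eigenvalAt c Δ M mu w =
    (vacA c Δ M w * ∏ i, (w + Complex.I * c - mu i) +
      vacD c Δ M w * ∏ i, (w - Complex.I * c - mu i)) / ∏ i, (w - mu i) := by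
  simp only [eigenvalAt, eigenval, Finset.prod_image (injective_ofReal_comp hmu).injOn]

/-- The Bethe equations for `lam` express `d / a` at `lam k`, and comparison with the products over
`mu` leaves exactly the shift function. -/
theorem vacD_mul_prod (hc : 0 < c) (hΔ : 0 < Δ) (hcΔ : c * Δ < 4)
    (hlam : IsBetheSolution c Δ M lam) (k : Fin N) :
    vacD c Δ M (lam k) * ∏ i, ((lam k : ℂ) - Complex.I * c - mu i) =
      -(expShift c mu lam (lam k) * (vacA c Δ M (lam k) *
        ∏ i, ((lam k : ℂ) + Complex.I * c - mu i))) := by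
  have h0 : ∏ i, ((lam k : ℂ) + Complex.I * c - lam i) ≠ 0 :=
    Finset.prod_ne_zero_iff.2 fun i _ => sub_add_ne_zero hc _ _
  have h1 := hlam.onShell hc hΔ hcΔ k
  have h2 := expShift_mul hc mu lam (lam k)
  refine mul_right_cancel₀ h0 ?_
  linear_combination (-vacD c Δ M (lam k)) * h2 + expShift c mu lam (lam k) *
    (∏ i, ((lam k : ℂ) + Complex.I * c - mu i)) * h1

theorem eigenvalAt_lam (hc : 0 < c) (hΔ : 0 < Δ) (hcΔ : c * Δ < 4) (hmu : Function.Injective mu)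
    (hlam : IsBetheSolution c Δ M lam) (k : Fin N) : eigenvalAt c Δ M mu (lam k) =
    vacA c Δ M (lam k) * (1 - expShift c mu lam (lam k)) *
      (∏ i, ((lam k : ℂ) + Complex.I * c - mu i)) / ∏ i, ((lam k : ℂ) - mu i) := by
  rw [eigenvalAt_eq hmu, vacD_mul_prod hc hΔ hcΔ hlam]
  congr 1
  ring

open Polynomial in
theorem det_baxter (hc : 0 < c) (hΔ : 0 < Δ) (hcΔ : c * Δ < 4)
    (hmu : Function.Injective mu) (hlam : IsBetheSolution c Δ M lam)
    (hgen : ∀ k, expShift c mu lam (lam k) ≠ 1) (hne : ∀ k a, lam k ≠ mu a) :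
    (Matrix.of fun i k : Fin N => baxter (Complex.I * c) (vacA c Δ M) (vacD c Δ M)
      (Finset.univ.image fun i => (mu i : ℂ)) (lam k) ((X - C (nu c Δ - Complex.I * c)) *
        (X - C (nu c Δ)) * rootPoly (Finset.univ.erase i) fun i => (lam i : ℂ))).det =
    (∏ b, (((lam b : ℂ) - (nu c Δ - Complex.I * c)) * (lam b - nu c Δ) *
      ∏ i ∈ Finset.univ.erase b, ((lam b : ℂ) - lam i))) * (∏ k, eigenvalAt c Δ M mu (lam k)) *
      (1 + matU c Δ mu lam).det := by
  have hn := nu_im_neg (c := c) hΔ hcΔ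
  have hy : ∀ i, (lam i : ℂ) - nu c Δ ≠ 0 := fun i e => by
    have := nu_add_ne (c := c) (Δ := Δ) (s := 0) (by simpa using hn.ne) (lam i)
    refine this ?_
    push_cast
    linear_combination -e
  have hy' : ∀ i, (lam i : ℂ) - nu c Δ + Complex.I * c ≠ 0 := fun i e => by
    have := nu_add_ne (c := c) (Δ := Δ) (s := -c) (by linarith) (lam i)
    refine this ?_
    push_cast
    linear_combination -e
  have hQ : ∀ k, ∏ i, ((lam k : ℂ) - mu i) ≠ 0 := fun k => Finset.prod_ne_zero_iff.2 fun i _ =>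
    sub_ne_zero.2 fun e => hne k i (Complex.ofReal_injective e)
  have hQ' : ∀ k, ∏ i, ((lam k : ℂ) + Complex.I * c - mu i) ≠ 0 := fun k =>
    Finset.prod_ne_zero_iff.2 fun i _ => sub_add_ne_zero hc _ _
  have hP : ∀ k, ∏ i, ((lam k : ℂ) + Complex.I * c - lam i) ≠ 0 := fun k =>
    Finset.prod_ne_zero_iff.2 fun i _ => sub_add_ne_zero hc _ _
  have hπ : ∀ k, ∏ i ∈ Finset.univ.erase k, ((lam k : ℂ) - lam i) ≠ 0 := fun k =>
    Finset.prod_ne_zero_iff.2 fun i hi => sub_ne_zero.2 fun e => (Finset.ne_of_mem_erase hi)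
      (hlam.injective (Complex.ofReal_injective e.symm))
  have he : ∀ k, expShift c mu lam (lam k) - 1 ≠ 0 := fun k => sub_ne_zero.2 (hgen k)
  -- `β k` is the row factor of `matU`; by the next identities it is also, up to the eigenvalue and
  -- a sign, the coefficient `a (lam k) ∏ (lam k + ic - lam i)` of the columns.
  set β : Fin N → ℂ := fun k => (∏ i, ((lam k : ℂ) - mu i)) *
    (∏ i, ((lam k : ℂ) + Complex.I * c - lam i)) /
      ((∏ i, ((lam k : ℂ) + Complex.I * c - mu i)) * (expShift c mu lam (lam k) - 1)) with hβ
  have hβ0 : ∀ k, β k ≠ 0 := fun k =>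
    div_ne_zero (mul_ne_zero (hQ k) (hP k)) (mul_ne_zero (hQ' k) (he k))
  have hΛβ : ∀ k, vacA c Δ M (lam k) * ∏ i, ((lam k : ℂ) + Complex.I * c - lam i) =
      -(eigenvalAt c Δ M mu (lam k) * β k) := fun k => by
    have h1 := hQ k
    have h2 := hQ' k
    have h3 := he k
    rw [eigenvalAt_lam hc hΔ hcΔ hmu hlam]
    simp only [hβ]
    field_simp
    ring
  have hU : ∀ i k, matU c Δ mu lam i k = -Complex.I * β i *
      liebMod c (lam i) (lam k) (nu c Δ) / ∏ b ∈ Finset.univ.erase i, ((lam i : ℂ) - lam b) := by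
    intro i k
    simp only [matU, Matrix.of_apply, hβ, Finset.prod_div_distrib, sub_add_eq_add_sub]
    have h2 := hQ' i
    have h3 := he i
    have h4 := hπ i
    field_simp
  refine det_of_scaling (t := fun i => β i * (lam i - nu c Δ + Complex.I * c))
    (fun i => mul_ne_zero (hβ0 i) (hy' i)) fun i k => ?_
  have key := baxter_rootPoly_erase (η := Complex.I * c) (ν := nu c Δ) (a := vacA c Δ M)
    (d := vacD c Δ M) (m := Finset.univ.image fun i => (mu i : ℂ)) (lam := fun i => (lam i : ℂ))
    (fun i k => sub_add_ne_zero hc _ _) (fun i k => sub_sub_ne_zero hc _ _)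
    (hlam.onShell hc hΔ hcΔ k) i
  rw [Matrix.of_apply, key, hΛβ, liebMod_eq hc (hy i) (hy' i) (hy' k), Matrix.add_apply, hU,
    ← eigenvalAt]
  have h4 := hπ i
  rcases eq_or_ne i k with rfl | hik
  · rw [if_pos rfl, Matrix.one_apply_eq]
    field_simp
    ring
  · rw [if_neg hik, Matrix.one_apply_ne hik]
    field_simp
    ring

theorem formFactor_mul (hc : 0 < c) (hΔ : 0 < Δ) (hcΔ : c * Δ < 4) (hM : Even M) (hM0 : 0 < M)
    (hmu : IsBetheSolution c Δ M mu) (hlam : IsBetheSolution c Δ M lam)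
    (hgen : ∀ k, expShift c mu lam (lam k) ≠ 1) (hne : ∀ k a, lam k ≠ mu a) :
    formFactor c Δ M mu lam * ∏ i, (nu c Δ - Complex.I * c - mu i) =
      2 * Complex.I / (Δ * (Real.sqrt c : ℝ)) * ((∏ i, vacA c Δ M (mu i)) *
        (-(Complex.I * c) * ∏ b, (nu c Δ - Complex.I * c - lam b)) *
          (∏ k, eigenvalAt c Δ M mu (lam k)) * (1 + matU c Δ mu lam).det) := by
  have hn := nu_im_neg (c := c) hΔ hcΔ
  have hη : Complex.I * (c : ℂ) ≠ 0 := by simp [hc.ne']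
  have hν : ∀ x : ℝ, nu c Δ ≠ x := fun x => by
    have := nu_add_ne (c := c) (Δ := Δ) (s := 0) (by simpa using hn.ne) x
    simpa using this
  have hν' : ∀ x : ℝ, nu c Δ - Complex.I * c ≠ x := fun x => by
    have := nu_add_ne (c := c) (Δ := Δ) (s := -c) (by linarith) x
    push_cast at this
    rwa [mul_neg, ← sub_eq_add_neg] at this
  have hreal : ∀ x y : ℝ, (x : ℂ) ≠ y + Complex.I * c := fun x y e =>
    sub_add_ne_zero hc y x (sub_eq_zero.2 e.symm)
  have hshell : OnShell (Complex.I * c) (vacA c Δ M) (vacD c Δ M)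
      (Finset.univ.image fun i => (mu i : ℂ)) := by
    intro k hk
    obtain ⟨r, -, rfl⟩ := Finset.mem_image.1 hk
    simpa only [Finset.prod_image (injective_ofReal_comp hmu.injective).injOn] using
      hmu.onShell hc hΔ hcΔ r
  have hrtt := rtt_monodromy hc hΔ hcΔ M
  have hS := scal_cons hrtt hη (isVacuum_monodromy hΔ hM) (vacuumDual_vacuum M)
    (injective_ofReal_comp hmu.injective) (injective_ofReal_comp hlam.injective)
    (fun i => hν _) hshell (fun _ => Set.mem_univ _) (fun _ => Set.mem_univ _) (Set.mem_univ _)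
    (vacA_nu hΔ hM hM0) (fun i j e => hne i j (Complex.ofReal_injective e)) (fun j => hν _)
    (fun i j => hreal _ _) (fun j e => hν' (mu j) (by rw [e]; ring)) (fun i j => hreal _ _)
    (fun i => hν' _)
  rw [det_baxter hc hΔ hcΔ hmu.injective hlam hgen hne] at hS
  set h : ℂ := ∏ b, (((lam b : ℂ) - (nu c Δ - Complex.I * c)) * (lam b - nu c Δ) *
      ∏ i ∈ Finset.univ.erase b, ((lam b : ℂ) - lam i)) with hh
  have hh0 : h ≠ 0 := Finset.prod_ne_zero_iff.2 fun b _ => mul_ne_zero (mul_ne_zero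
    (sub_ne_zero.2 (hν' _).symm) (sub_ne_zero.2 (hν _).symm))
    (Finset.prod_ne_zero_iff.2 fun i hi => sub_ne_zero.2 fun e => (Finset.ne_of_mem_erase hi)
      (hlam.injective (Complex.ofReal_injective e.symm)))
  rw [← eigenvalAt] at hS
  have hΛ : eigenvalAt c Δ M mu (nu c Δ) ≠ 0 := by
    rw [eigenvalAt_eq hmu.injective, vacA_nu hΔ hM hM0, zero_mul, zero_add]
    exact div_ne_zero (mul_ne_zero (vacD_nu_ne_zero hΔ hcΔ) (Finset.prod_ne_zero_iff.2
      fun i _ => sub_ne_zero.2 (hν' _))) (Finset.prod_ne_zero_iff.2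
      fun i _ => sub_ne_zero.2 (hν _))
  -- The inverse acts on the left eigenvector; the resulting `1 / Λ(ν)` cancels the factor `Λ(ν)`
  -- supplied by `scal_cons`.
  have hb : ∀ v, eigenvalAt c Δ M mu (nu c Δ) *
      braket (betheVector c Δ M mu) (Ring.inverse (transfer c Δ M (nu c Δ)) v) =
        braket (betheVector c Δ M mu) v := fun v => by
    rw [braket_betheVector hc hΔ hcΔ hmu.injective, braket_betheVector hc hΔ hcΔ hmu.injective,
      eigenvalAt, ← hshell.left_eigen hrtt hη (isVacuum_dual_monodromy hΔ hM) (by simp [(hν _).symm])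
        (fun _ _ => Set.mem_univ _)]
    congr 1
    have := Ring.mul_inverse_cancel _ (isUnit_transfer hc hΔ hcΔ hM hM0)
    exact congrArg (fun f : Module.End ℂ (Fock M) => f v) this
  have hB : braket (betheVector c Δ M mu) (opB c Δ M (nu c Δ) (betheVector c Δ M lam)) =
      scal (monodromy c Δ M) (vacuum M) (vacuumDual M) (Finset.univ.image fun i => (mu i : ℂ))
        (insert (nu c Δ) (Finset.univ.image fun i => (lam i : ℂ))) := by
    rw [braket_betheVector hc hΔ hcΔ hmu.injective, scal, betheVector_eq_bethe hc hΔ hcΔ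
      hlam.injective, bethe_insert hrtt hη (by simp [(hν _).symm])]
    rfl
  rw [← hB, ← hb] at hS
  rw [formFactor, Module.End.mul_apply, mul_assoc]
  congr 1
  refine mul_left_cancel₀ (mul_ne_zero hΛ hh0) ?_
  linear_combination hS

end FormFactor

end LatticeNLS

end

/-! ### Assembly of the prefactors -/

theorem mainTheorem3 (c Δ : ℝ) (hc : 0 < c) (hΔ : 0 < Δ) (hcΔ : c * Δ < 4)
    (M : ℕ) (hM : Even M) (hM0 : 0 < M) (N : ℕ)
    (mu : Fin (N + 1) → ℝ) (lam : Fin N → ℝ)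
    (hmu : LatticeNLS.IsBetheSolution c Δ M mu)
    (hlam : LatticeNLS.IsBetheSolution c Δ M lam)
    (hgen : ∀ k, LatticeNLS.expShift c mu lam (lam k) ≠ 1) :
    IsUnit (LatticeNLS.transfer c Δ M (LatticeNLS.nu c Δ)) ∧
    LatticeNLS.formFactor c Δ M mu lam =
      (-2 * (Real.sqrt c : ℂ)) / Δ *
        (∏ a, (LatticeNLS.nu c Δ - mu a) / (LatticeNLS.nu c Δ - mu a - Complex.I * c)) *
        ((∏ a, ((lam a : ℂ) - LatticeNLS.nu c Δ + Complex.I * c)) /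
          ∏ a, ((mu a : ℂ) - LatticeNLS.nu c Δ)) *
        (∏ a, ∏ b, 1 / ((mu a : ℂ) - lam b)) *
        (∏ a, LatticeNLS.vacD c Δ M (mu a)) *
        (∏ k, (LatticeNLS.vacA c Δ M (lam k) * (1 - LatticeNLS.expShift c mu lam (lam k)) *
          ∏ b, ((mu b : ℂ) - lam k - Complex.I * c))) *
        (1 + LatticeNLS.matU c Δ mu lam).det := by
  open LatticeNLS in
  refine ⟨isUnit_transfer hc hΔ hcΔ hM hM0, ?_⟩
  have hne : ∀ k a, lam k ≠ mu a := fun k a => hmu.ne_of_expShift hc hΔ hcΔ hlam (hgen k) a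
  have hn := nu_im_neg (c := c) hΔ hcΔ
  have key := formFactor_mul hc hΔ hcΔ hM hM0 hmu hlam hgen hne
  have hν : ∏ i, (nu c Δ - mu i) ≠ 0 := Finset.prod_ne_zero_iff.2 fun i _ => sub_ne_zero.2 fun e =>
    nu_add_ne (c := c) (Δ := Δ) (s := 0) (by simpa using hn.ne) (mu i) (by simpa using e)
  have hν' : ∏ i, (nu c Δ - Complex.I * c - mu i) ≠ 0 :=
    Finset.prod_ne_zero_iff.2 fun i _ => sub_ne_zero.2 fun e =>
    nu_add_ne (c := c) (Δ := Δ) (s := -c) (by linarith) (mu i) (by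
      rw [← e]; push_cast; ring)
  -- Reversing the differences gives `(-1) ^ (N + 1)` in numerator and denominator alike, so no sign
  -- survives.
  have e1 : ∏ k, eigenvalAt c Δ M mu (lam k) = (∏ a, ∏ b, 1 / ((mu a : ℂ) - lam b)) *
      ∏ k, (vacA c Δ M (lam k) * (1 - expShift c mu lam (lam k)) *
        ∏ b, ((mu b : ℂ) - lam k - Complex.I * c)) := by
    rw [Finset.prod_comm, ← Finset.prod_mul_distrib]
    refine Finset.prod_congr rfl fun k _ => ?_
    have h1 : ∏ i, ((mu i : ℂ) - lam k) = (-1) ^ (N + 1) * ∏ i, ((lam k : ℂ) - mu i) := by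
      simp only [← prod_neg_fin, neg_sub]
    have h2 : ∏ i, ((mu i : ℂ) - lam k - Complex.I * c) =
        (-1) ^ (N + 1) * ∏ i, ((lam k : ℂ) + Complex.I * c - mu i) := by
      rw [← prod_neg_fin]
      exact Finset.prod_congr rfl fun i _ => by ring
    have h3 : ((-1 : ℂ)) ^ (N + 1) ≠ 0 := pow_ne_zero _ (by norm_num)
    rw [eigenvalAt_lam hc hΔ hcΔ hmu.injective hlam, Finset.prod_div_distrib, h1, h2,
      Finset.prod_const_one]
    field_simp
  have e2 : ∏ i, ((mu i : ℂ) - nu c Δ) = (-1) ^ (N + 1) * ∏ i, (nu c Δ - mu i) := by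
    simp only [← prod_neg_fin, neg_sub]
  have e3 : ∏ b, ((lam b : ℂ) - nu c Δ + Complex.I * c) =
      (-1) ^ N * ∏ b, (nu c Δ - Complex.I * c - lam b) := by
    rw [← prod_neg_fin]
    exact Finset.prod_congr rfl fun i _ => by ring
  have e4 : ∏ a, (nu c Δ - mu a) / (nu c Δ - mu a - Complex.I * c) =
      (∏ a, (nu c Δ - mu a)) / ∏ a, (nu c Δ - Complex.I * c - mu a) := by
    rw [Finset.prod_div_distrib]
    simp only [sub_right_comm]
  have hs : ((Real.sqrt c : ℝ) : ℂ) ≠ 0 := by exact_mod_cast (Real.sqrt_pos.2 hc).ne'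
  have hΔ' : (Δ : ℂ) ≠ 0 := by exact_mod_cast hΔ.ne'
  have hsq := ofReal_sqrt_mul_self hc.le
  -- The factor `ic` stems from `(ν - ic) - ν` in the reduction step; its minus sign cancels against
  -- `(-1) ^ N / (-1) ^ (N + 1)` from `e2` and `e3`.
  have e5 : 2 * Complex.I / (Δ * ((Real.sqrt c : ℝ) : ℂ)) * (Complex.I * c) =
      -2 * ((Real.sqrt c : ℝ) : ℂ) / Δ := by
    rw [← hsq]
    field_simp
    linear_combination Complex.I_sq
  have h3 : ((-1 : ℂ)) ^ N ≠ 0 := pow_ne_zero _ (by norm_num)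
  refine mul_right_cancel₀ hν' (key.trans ?_)
  rw [e1, e2, e3, e4, hmu.prod_vacA hc hΔ hcΔ, ← e5, pow_succ]
  field_simp
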